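/- Let $\mathscr{A}$ be a countably infinite alphabet, consisting of the letters $a,b,c,d,e,t,x,y,z$ and of the letters $t_i,x_i,z_i$ for $i\in\mathbb{N}$. An identity is an expression $\mathbf{u}\approx\mathbf{v}$ with $\mathbf{u},\mathbf{v}\in\mathscr{A}^*$. A monoid $\mathbf{M}$ satisfies it if $\mathbf{u}\theta=\mathbf{v}\theta$ for every assignment $\theta:\mathscr{A}\to\mathbf{M}$. For a set $\Sigma$ of identities, $\Sigma\vdash\mathbf{u}\approx\mathbf{v}$ means that there is a finite sequence of words from $\mathbf{u}$ to $\mathbf{v}$ in which, for any two consecutive words, one is $\mathbf{r}(\mathbf{p}\theta)\mathbf{s}$ and the other is $\mathbf{r}(\mathbf{q}\theta)\mathbf{s}$ for some $\mathbf{p}\approx\mathbf{q}$ in $\Sigma$, some substitution $\theta:\mathscr{A}\to\mathscr{A}^*$ and some $\mathbf{r},\mathbf{s}\in\mathscr{A}^*$. The set $\Sigma$ is an identity basis for $\mathbf{M}$ if the identities satisfied by $\mathbf{M}$ are exactly the identities $\mathbf{u}\approx\mathbf{v}$ with $\Sigma\vdash\mathbf{u}\approx\mathbf{v}$. It is irredundant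 if no $\sigma\in\Sigma$ is derivable from $\Sigma\setminus\{\sigma\}$. For $\mathscr{W}\subseteq\mathscr{A}^*$, let $\mathbf{M}(\mathscr{W})$ be the Rees quotient of $\mathscr{A}^*$ by the ideal of all words that are not (contiguous) subwords of any word in $\mathscr{W}$. For $n\ge 2$ let $$\mathbf{w}_n=x_0\,z_1xyz_2\,x_1x_0\,x_2x_1\,x_3x_2\cdots x_nx_{n-1}\,z_1xyz_2\,x_n,$$ let $\mathbf{w}_n'$ be the word obtained from $\mathbf{w}_n$ by interchanging $x$ and $y$, and let $$\Sigma=\{\mathbf{w}_n\approx\mathbf{w}_n'\mid n\ge 2\}\cup\{xt_1xt_2x\approx x^3t_1t_2,\ x^3t_1t_2\approx t_1t_2x^3,\ x^3\approx x^4\}.$$ Let $\mathscr{V}$ consist of the following words: 1. $xxyy$, $xyzyxz$, $zxyzyx$; 2. $xyabbaxy$, $axybcabxyc$, $abxyacbdxycd$, $xyabcadbecdexy$, $xydcdabcaebexy$, $dxycdabcaebxye$; 3. $atxyaxy$, $abaxybxy$, $abxyaxyb$, $abbxyaxy$, $abxybaxy$, $abxyacbcxy$, $axybcbacxy$, $axybbcacxy$,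 $axybbaccxy$, $axybbacxyc$, $axybcabdcxyd$, $abxyacbddxyc$, $axybcabdcdxy$, $dxycdabcaebexy$, and the reverses of these fourteen words. **Theorem.** The set $\mathscr{V}$ has exactly $37$ elements, the monoid $\mathbf{M}(\mathscr{V})$ is finite, $\Sigma$ is an identity basis for $\mathbf{M}(\mathscr{V})$, and $\Sigma$ is infinite and irredundant. In particular, $\mathbf{M}(\mathscr{V})$ is a finite monoid with an infinite irredundant basis of monoid identities. -/

import Mathlib

namespace Irredundant

/-- A countably infinite alphabet of variables: the symbols `a, b, c, d, e, t, x, y, z`, and the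
subscripted symbols `t_i`, `x_i`, `z_i`. -/
inductive Letter : Type
  | a | b | c | d | e | t | x | y | z
  | tsub (i : ℕ)
  | xsub (i : ℕ)
  | zsub (i : ℕ)
  deriving DecidableEq

/-- Words over the alphabet, including the empty word `1`, under concatenation. -/
abbrev Word : Type := FreeMonoid Letter

/-- The identity `u ≈ v` is the pair `(u, v)`. -/
abbrev Identity : Type := Word × Word

/-- The word with the given sequence of letters. -/
def word (l : List Letter) : Word := FreeMonoid.ofList l

/-- `M ⊨ u ≈ v`: every assignment of elements of `M` to the letters gives `u` and `v`
the same value. -/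
def Satisfies (M : Type*) [Monoid M] (p : Identity) : Prop :=
  ∀ θ : Letter → M, FreeMonoid.lift θ p.1 = FreeMonoid.lift θ p.2

/-- One step of equational deduction: for some identity `p ≈ q` of the system, some substitution
`θ` of words for letters and some words `r`, `s`, one of `u`, `v` is `r (p θ) s` and the other is
`r (q θ) s`. -/
def DerivationStep (S : Set Identity) (u v : Word) : Prop :=
  ∃ p ∈ S, ∃ (θ : Letter → Word) (r s : Word),
    (u = r * FreeMonoid.lift θ p.1 * s ∧ v = r * FreeMonoid.lift θ p.2 * s) ∨
    (u = r * FreeMonoid.lift θ p.2 * s ∧ v = r * FreeMonoid.lift θ p.1 * s)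

/-- `S ⊢ u ≈ v`: there is a finite sequence of deduction steps from `u` to `v`. -/
def Derives (S : Set Identity) (p : Identity) : Prop :=
  Relation.ReflTransGen (DerivationStep S) p.1 p.2

/-- `S` is an identity basis for `M`: the identities satisfied by `M` are exactly those that can be
derived from `S`. -/
def IsIdentityBasis (S : Set Identity) (M : Type*) [Monoid M] : Prop :=
  ∀ p : Identity, Satisfies M p ↔ Derives S p

/-- No identity of `S` can be derived from the remaining ones. -/
def IsIrredundant (S : Set Identity) : Prop :=
  ∀ p ∈ S, ¬ Derives (S \ {p}) p

/-- `IsFactor u w`: `u` is a (contiguous) subword of `w`. -/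
def IsFactor (u w : Word) : Prop := ∃ r s : Word, w = r * u * s

/-- The factorial closure of a set of words: all subwords of its members. -/
def factorialClosure (W : Set Word) : Set Word := {u | ∃ w ∈ W, IsFactor u w}

/-- The ideal of all words that are not subwords of members of `W`. -/
def factorIdeal (W : Set Word) : Set Word := (factorialClosure W)ᶜ

theorem mul_mem_factorIdeal_left {W : Set Word} {u : Word} (hu : u ∈ factorIdeal W) (v : Word) :
    v * u ∈ factorIdeal W := by
  rintro ⟨w, hw, r, s, rfl⟩
  exact hu ⟨_, hw, r * v, s, by simp only [mul_assoc]⟩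

theorem mul_mem_factorIdeal_right {W : Set Word} {u : Word} (hu : u ∈ factorIdeal W) (v : Word) :
    u * v ∈ factorIdeal W := by
  rintro ⟨w, hw, r, s, rfl⟩
  exact hu ⟨_, hw, r, v * s, by simp only [mul_assoc]⟩

/-- The Rees congruence of the ideal `factorIdeal W`: all words of the ideal are identified, and
every other word is congruent to itself only. -/
def reesCon (W : Set Word) : Con Word where
  r u v := u = v ∨ (u ∈ factorIdeal W ∧ v ∈ factorIdeal W)
  iseqv :=
    { refl := fun _ => Or.inl rfl
      symm := by
        rintro u v (rfl | ⟨hu, hv⟩)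
        · exact Or.inl rfl
        · exact Or.inr ⟨hv, hu⟩
      trans := by
        rintro u v w (rfl | ⟨hu, hv⟩) (rfl | ⟨hv', hw⟩)
        · exact Or.inl rfl
        · exact Or.inr ⟨hv', hw⟩
        · exact Or.inr ⟨hu, hv⟩
        · exact Or.inr ⟨hu, hw⟩ }
  mul' := by
    rintro u v u' v' (rfl | ⟨hu, hv⟩) (rfl | ⟨hu', hv'⟩)
    · exact Or.inl rfl
    · exact Or.inr ⟨mul_mem_factorIdeal_left hu' _, mul_mem_factorIdeal_left hv' _⟩
    · exact Or.inr ⟨mul_mem_factorIdeal_right hu _, mul_mem_factorIdeal_right hv _⟩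
    · exact Or.inr ⟨mul_mem_factorIdeal_right hu _, mul_mem_factorIdeal_right hv _⟩

/-- The monoid `M(W)`: the Rees quotient of the free monoid by `factorIdeal W`. -/
abbrev ReesMonoid (W : Set Word) : Type := (reesCon W).Quotient

open Letter

/-- The word `x_0 z_1 p q z_2 (x_1 x_0) (x_2 x_1) ⋯ (x_n x_{n-1}) z_1 p q z_2 x_n`. -/
def chainWord (p q : Letter) (n : ℕ) : Word :=
  word ([xsub 0, zsub 1, p, q, zsub 2] ++
    (List.range n).flatMap (fun i => [xsub (i + 1), xsub i]) ++
    [zsub 1, p, q, zsub 2, xsub n])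

/-- The word `w_n`. -/
def w (n : ℕ) : Word := chainWord x y n

/-- The word `w_n'`, obtained from `w_n` by interchanging `x` and `y`. -/
def w' (n : ℕ) : Word := chainWord y x n

/-- The identity system consisting of `w_n ≈ w_n'` for `n ≥ 2`, of
`x t_1 x t_2 x ≈ x³ t_1 t_2` and `x³ t_1 t_2 ≈ t_1 t_2 x³`, and of `x³ ≈ x⁴`. -/
def identitySystem : Set Identity :=
  {p | ∃ n : ℕ, 2 ≤ n ∧ p = (w n, w' n)} ∪
  {(word [x, tsub 1, x, tsub 2, x], word [x, x, x, tsub 1, tsub 2]),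
   (word [x, x, x, tsub 1, tsub 2], word [tsub 1, tsub 2, x, x, x]),
   (word [x, x, x], word [x, x, x, x])}

/-- Three short words. -/
def shortWords : List (List Letter) :=
  [[x, x, y, y],
   [x, y, z, y, x, z],
   [z, x, y, z, y, x]]

/-- Six words, each of which coincides with its own reverse up to a change of letter names. -/
def selfDualWords : List (List Letter) :=
  [[x, y, a, b, b, a, x, y],
   [a, x, y, b, c, a, b, x, y, c],
   [a, b, x, y, a, c, b, d, x, y, c, d],
   [x, y, a, b, c, a, d, b, e, c, d, e, x, y],
   [x, y, d, c, d, a, b, c, a, e, b, e, x, y],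
   [d, x, y, c, d, a, b, c, a, e, b, x, y, e]]

/-- Fourteen words that are to be taken together with their reverses. -/
def nonSelfDualWords : List (List Letter) :=
  [[a, t, x, y, a, x, y],
   [a, b, a, x, y, b, x, y],
   [a, b, x, y, a, x, y, b],
   [a, b, b, x, y, a, x, y],
   [a, b, x, y, b, a, x, y],
   [a, b, x, y, a, c, b, c, x, y],
   [a, x, y, b, c, b, a, c, x, y],
   [a, x, y, b, b, c, a, c, x, y],
   [a, x, y, b, b, a, c, c, x, y],
   [a, x, y, b, b, a, c, x, y, c],
   [a, x, y, b, c, a, b, d, c, x, y, d],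
   [a, b, x, y, a, c, b, d, d, x, y, c],
   [a, x, y, b, c, a, b, d, c, d, x, y],
   [d, x, y, c, d, a, b, c, a, e, b, e, x, y]]

/-- The set of 37 words that defines the monoid. -/
def wordSet : Set Word :=
  {u | u ∈ (shortWords ++ selfDualWords ++ nonSelfDualWords ++
    nonSelfDualWords.map List.reverse).map word}

end Irredundant

set_option linter.constructorNameAsVariable false

namespace Irredundant

/-! ### Words as lists -/

/-! An identity holds in M(V) iff every substitution of words either makes its two sides equal or
sends both into the ideal of non-factors (`satisfies_iff`). So each factor of V is an isoterm: no
identity that holds can change it.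

Soundness. No letter occurs three times in a word of V, so a substitution that does not erase x
sends both sides of each cube identity into the ideal. An image of w_n in which x and y survive has
the form X₀ B m B Xₙ, where B has length at least 2 and m = X₁X₀X₂X₁⋯XₙXₙ₋₁ is a chain of possibly
empty blocks. A finite check (`linkedFree_wordList`) shows that no word of V contains such a factor.

Completeness. Letters that occur at least three times can be gathered into cubes and removed, so let
u ≈ v hold with every letter occurring at most twice on each side. Apart from abab and baba, every
two-letter word of this kind is a factor of V up to renaming. Hence u and v have the same projection
to each pair of letters, except for inverted pairs, with abab on one side and baba on the other. If
there is no inverted pair then u = v. Otherwise some inverted pair x, y is adjacent at both of its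
occurrences (`Holds.exists_adjacent_inverted`), and it suffices to derive its exchange in u, which
lowers the number of inverted pairs.

For that exchange, each of the 34 longer words of V forbids one pattern of letters around the two
occurrences of xy. These patterns force u to contain X₀ Z xy Z' m Z xy Z' Xₙ with m a chain from X₀
to Xₙ, and this is an instance of w_n. To see the chain, read the trimmed middle part as a queue: a
first occurrence pushes a letter and a last occurrence pops it. Letters on the left are in the queue
at the start, and those that leave on the right remain at the end. The patterns make the queue
first-in-first-out (`Frame.lt_of_lt`) and make letters leave in whole batches (the `no_split`
lemmas). The batches are the blocks of the chain (`Frame.exists_chain_from`).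

Irredundance. The words w_n and xt₁xt₂x are isoterms for the remaining identities, since an instance
of w_k inside w_n that moves anything has k = n. The other two cube identities are separated from
the rest by a four-element monoid and by the additive monoid of natural numbers. -/

theorem word_append (l l' : List Letter) : word (l ++ l') = word l * word l' := rfl

theorem word_injective : Function.Injective word := fun _ _ h => h

theorem lift_word {M : Type*} [Monoid M] (θ : Letter → M) (l : List Letter) :
    FreeMonoid.lift θ (word l) = (l.map θ).prod :=
  FreeMonoid.lift_apply θ (word l)

theorem lift_word_word (θ : Letter → List Letter) (l : List Letter) :
    FreeMonoid.lift (fun c => word (θ c)) (word l) = word (l.flatMap θ) := by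
  rw [lift_word]
  induction l with
  | nil => rfl
  | cons c l ih => simp only [List.map_cons, List.prod_cons, ih, List.flatMap_cons, word_append]

/-! ### Equational deduction -/

theorem DerivationStep.symm {S : Set Identity} {u v : Word} (h : DerivationStep S u v) :
    DerivationStep S v u := by
  obtain ⟨p, hp, θ, r, s, h | h⟩ := h
  · exact ⟨p, hp, θ, r, s, Or.inr ⟨h.2, h.1⟩⟩
  · exact ⟨p, hp, θ, r, s, Or.inl ⟨h.2, h.1⟩⟩

theorem DerivationStep.mul_left_right {S : Set Identity} {u v : Word} (h : DerivationStep S u v)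
    (a b : Word) : DerivationStep S (a * u * b) (a * v * b) := by
  obtain ⟨p, hp, θ, r, s, h | h⟩ := h
  · refine ⟨p, hp, θ, a * r, s * b, Or.inl ?_⟩
    rw [h.1, h.2]
    simp only [mul_assoc, and_self]
  · refine ⟨p, hp, θ, a * r, s * b, Or.inr ?_⟩
    rw [h.1, h.2]
    simp only [mul_assoc, and_self]

/-- Derivability of `u ≈ v` for words given as lists. -/
def DerivesList (S : Set Identity) (u v : List Letter) : Prop := Derives S (word u, word v)

theorem DerivesList.refl (S : Set Identity) (u : List Letter) : DerivesList S u u :=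
  Relation.ReflTransGen.refl

theorem DerivesList.trans {S : Set Identity} {u v w : List Letter} (h : DerivesList S u v)
    (h' : DerivesList S v w) : DerivesList S u w :=
  Relation.ReflTransGen.trans h h'

theorem DerivesList.symm {S : Set Identity} {u v : List Letter} (h : DerivesList S u v) :
    DerivesList S v u := by
  have key : ∀ u v : Word, Relation.ReflTransGen (DerivationStep S) u v →
      Relation.ReflTransGen (DerivationStep S) v u := by
    intro u v h
    induction h with
    | refl => exact Relation.ReflTransGen.refl
    | tail _ h ih => exact Relation.ReflTransGen.head h.symm ih
  exact key _ _ h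

theorem DerivesList.append {S : Set Identity} {u v : List Letter} (h : DerivesList S u v)
    (r s : List Letter) : DerivesList S (r ++ u ++ s) (r ++ v ++ s) := by
  have key : ∀ u v : Word, Relation.ReflTransGen (DerivationStep S) u v →
      Relation.ReflTransGen (DerivationStep S) (word r * u * word s) (word r * v * word s) := by
    intro u v h
    induction h with
    | refl => exact Relation.ReflTransGen.refl
    | tail _ h ih => exact ih.tail (h.mul_left_right _ _)
  exact key _ _ h

theorem DerivesList.of_mem {S : Set Identity} {p q : List Letter} (h : (word p, word q) ∈ S)
    (θ : Letter → List Letter) : DerivesList S (p.flatMap θ) (q.flatMap θ) := by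
  refine Relation.ReflTransGen.single ⟨_, h, fun c => word (θ c), 1, 1, Or.inl ?_⟩
  simp only [lift_word_word, one_mul, mul_one, and_self]

theorem Derives.satisfies {S : Set Identity} {M : Type*} [Monoid M]
    (hS : ∀ p ∈ S, Satisfies M p) {p : Identity} (h : Derives S p) : Satisfies M p := by
  intro φ
  have key : ∀ u v : Word, DerivationStep S u v → FreeMonoid.lift φ u = FreeMonoid.lift φ v := by
    have hcomp : ∀ (θ : Letter → Word) (u : Word), FreeMonoid.lift φ (FreeMonoid.lift θ u) =
        FreeMonoid.lift (fun c => FreeMonoid.lift φ (θ c)) u := by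
      intro θ u
      have : (FreeMonoid.lift φ).comp (FreeMonoid.lift θ) =
          FreeMonoid.lift (fun c => FreeMonoid.lift φ (θ c)) := by
        ext c
        simp
      rw [← this]
      rfl
    rintro u v ⟨p, hp, θ, r, s, ⟨rfl, rfl⟩ | ⟨rfl, rfl⟩⟩
    · simp only [map_mul, hcomp, hS p hp _]
    · simp only [map_mul, hcomp, hS p hp _]
  have : ∀ u v : Word, Relation.ReflTransGen (DerivationStep S) u v →
      FreeMonoid.lift φ u = FreeMonoid.lift φ v := by
    intro u v h
    induction h with
    | refl => rfl
    | tail _ h ih => exact ih.trans (key _ _ h)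
  exact this _ _ h

/-! ### The monoid defined by the 37 words -/

/-- The 37 words as a list of lists of letters. -/
def wordList : List (List Letter) :=
  shortWords ++ selfDualWords ++ nonSelfDualWords ++ nonSelfDualWords.map List.reverse

/-- `l` is a contiguous subword of one of the 37 words. -/
def IsFactorWord (l : List Letter) : Prop := ∃ v ∈ wordList, l <:+: v

instance : DecidablePred IsFactorWord := fun l =>
  inferInstanceAs (Decidable (∃ v ∈ wordList, l <:+: v))

theorem word_mem_factorialClosure {l : List Letter} :
    word l ∈ factorialClosure wordSet ↔ IsFactorWord l := by
  constructor
  · rintro ⟨w, hw, r, s, h⟩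
    obtain ⟨v, hv, rfl⟩ := List.mem_map.1 hw
    exact ⟨v, hv, r, s, h.symm⟩
  · rintro ⟨v, hv, r, s, h⟩
    exact ⟨word v, List.mem_map.2 ⟨v, hv, rfl⟩, word r, word s, congrArg word h.symm⟩

/-- Every assignment into the quotient lifts to a substitution by choosing representatives, and the
Rees congruence identifies distinct words only inside the ideal. -/
theorem satisfies_iff {p q : List Letter} :
    Satisfies (ReesMonoid wordSet) (word p, word q) ↔ ∀ θ : Letter → List Letter,
      p.flatMap θ = q.flatMap θ ∨ (¬ IsFactorWord (p.flatMap θ) ∧ ¬ IsFactorWord (q.flatMap θ)) := by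
  have key : ∀ (θ : Letter → List Letter) (u : List Letter),
      FreeMonoid.lift (fun c => (((word (θ c) : Word)) : ReesMonoid wordSet)) (word u) =
        ((word (u.flatMap θ) : Word) : ReesMonoid wordSet) := by
    intro θ u
    rw [← lift_word_word, lift_word, lift_word]
    induction u with
    | nil => rfl
    | cons c u ih => simp only [List.map_cons, List.prod_cons, ih, Con.coe_mul]
  have main : ∀ θ : Letter → List Letter,
      (FreeMonoid.lift (fun c => (((word (θ c) : Word)) : ReesMonoid wordSet)) (word p) =
        FreeMonoid.lift (fun c => (((word (θ c) : Word)) : ReesMonoid wordSet)) (word q)) ↔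
      (p.flatMap θ = q.flatMap θ ∨
        (¬ IsFactorWord (p.flatMap θ) ∧ ¬ IsFactorWord (q.flatMap θ))) := by
    intro θ
    rw [key, key, Con.eq, ← word_mem_factorialClosure, ← word_mem_factorialClosure]
    exact Iff.rfl
  constructor
  · intro h θ
    exact (main θ).1 (h _)
  · intro h φ
    have : φ = fun c => (((word (FreeMonoid.toList (φ c).out) : Word)) : ReesMonoid wordSet) := by
      funext c
      exact (Quotient.out_eq (φ c)).symm
    rw [this]
    exact (main _).2 (h _)

/-- The monoid satisfies `p ≈ q`. -/
def Holds (p q : List Letter) : Prop := Satisfies (ReesMonoid wordSet) (word p, word q)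

/-- The isoterm principle: a factor of V is alone in its congruence class. Everything extracted from
an identity that holds comes from this. -/
theorem Holds.flatMap_eq {p q : List Letter} (h : Holds p q) (θ : Letter → List Letter)
    (hp : IsFactorWord (p.flatMap θ)) : p.flatMap θ = q.flatMap θ :=
  (satisfies_iff.1 h θ).resolve_right fun h => h.1 hp

theorem Holds.symm {p q : List Letter} (h : Holds p q) : Holds q p := fun θ => (h θ).symm

theorem Holds.trans {p q r : List Letter} (h : Holds p q) (h' : Holds q r) : Holds p r :=
  fun θ => (h θ).trans (h' θ)

theorem Holds.flatMap {p q : List Letter} (h : Holds p q) (θ : Letter → List Letter) :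
    Holds (p.flatMap θ) (q.flatMap θ) := by
  refine satisfies_iff.2 fun φ => ?_
  simpa only [List.flatMap_assoc] using satisfies_iff.1 h fun c => (θ c).flatMap φ

theorem filter_eq_flatMap (p : Letter → Bool) (l : List Letter) :
    l.filter p = l.flatMap fun c => if p c then [c] else [] := by
  induction l with
  | nil => rfl
  | cons c l ih => by_cases h : p c <;> simp [h, ih]

theorem Holds.filter {p q : List Letter} (h : Holds p q) (k : Letter → Bool) :
    Holds (p.filter k) (q.filter k) := by
  rw [filter_eq_flatMap, filter_eq_flatMap]
  exact h.flatMap _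

/-! ### Chains -/

/-- `Chain n C m D`: the word `m` is `X₁ X₀ X₂ X₁ ⋯ Xₙ Xₙ₋₁` with `X₀ = C` and `Xₙ = D`. -/
inductive Chain {α : Type*} : ℕ → List α → List α → List α → Prop
  | nil (C : List α) : Chain 0 C [] C
  | cons {n : ℕ} {P m D : List α} (C : List α) (h : Chain n P m D) :
      Chain (n + 1) C (P ++ (C ++ m)) D

/-- The word obtained from `X₀ z₁ ps z₂ (X₁ X₀) ⋯ (Xₙ Xₙ₋₁) z₁ ps z₂ Xₙ`. -/
def linked (Z B X : List Letter) (m D : List Letter) (Z' : List Letter) : List Letter :=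
  X ++ (Z ++ B ++ Z') ++ m ++ (Z ++ B ++ Z') ++ D

theorem chain_flatMap (X : ℕ → List Letter) (n k : ℕ) :
    Chain n (X k) ((List.range' k n).flatMap fun i => X (i + 1) ++ X i) (X (k + n)) := by
  induction n generalizing k with
  | zero => exact Chain.nil _
  | succ n ih =>
    have := Chain.cons (X k) (ih (k + 1))
    rw [List.range'_succ, List.flatMap_cons, List.append_assoc]
    rwa [show k + 1 + n = k + (n + 1) by omega] at this

/-- Converse of `chain_flatMap`: the blocks can be read back from a chain, so chains are exactly the
substitution instances of x₁x₀x₂x₁⋯xₙxₙ₋₁. -/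
theorem Chain.exists_flatMap {n : ℕ} {C m D : List Letter} (h : Chain n C m D) (k : ℕ) :
    ∃ X : ℕ → List Letter, X k = C ∧ X (k + n) = D ∧
      m = (List.range' k n).flatMap fun i => X (i + 1) ++ X i := by
  induction h generalizing k with
  | nil C => exact ⟨fun _ => C, rfl, rfl, rfl⟩
  | @cons n P m D C h ih =>
    obtain ⟨X, hP, hD, hm⟩ := ih (k + 1)
    refine ⟨fun i => if i = k then C else X i, by simp, ?_, ?_⟩
    · have : k + (n + 1) ≠ k := by omega
      simp only [this, if_false, ← hD]
      congr 1
      omega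
    · rw [List.range'_succ, List.flatMap_cons, hm, List.append_assoc]
      simp only [Nat.succ_ne_self, if_false, if_true, hP]
      congr 2
      apply List.flatMap_congr
      intro i hi
      rw [List.mem_range'_1] at hi
      rw [if_neg (by omega), if_neg (by omega)]

/-- The list of letters of `chainWord p q n`. -/
def chainList (p q : Letter) (n : ℕ) : List Letter :=
  [.xsub 0, .zsub 1, p, q, .zsub 2] ++
    (List.range n).flatMap (fun i => [.xsub (i + 1), .xsub i]) ++
    [.zsub 1, p, q, .zsub 2, .xsub n]

theorem chainList_flatMap (θ : Letter → List Letter) (p q : Letter) (n : ℕ) :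
    ∃ m, Chain n (θ (.xsub 0)) m (θ (.xsub n)) ∧ (chainList p q n).flatMap θ =
      linked (θ (.zsub 1)) (θ p ++ θ q) (θ (.xsub 0)) m (θ (.xsub n)) (θ (.zsub 2)) := by
  have := chain_flatMap (fun i => θ (.xsub i)) n 0
  rw [Nat.zero_add] at this
  refine ⟨_, this, ?_⟩
  simp [chainList, linked, List.flatMap_assoc, List.range_eq_range']

theorem exists_chainList_flatMap {n : ℕ} {C m D : List Letter} (h : Chain n C m D)
    (Z Z' X Y : List Letter) : ∃ θ : Letter → List Letter,
      (chainList .x .y n).flatMap θ = linked Z (X ++ Y) C m D Z' ∧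
      (chainList .y .x n).flatMap θ = linked Z (Y ++ X) C m D Z' := by
  obtain ⟨W, hC, hD, hm⟩ := h.exists_flatMap 0
  rw [Nat.zero_add] at hD
  refine ⟨fun
    | .x => X
    | .y => Y
    | .zsub 1 => Z
    | .zsub 2 => Z'
    | .xsub i => W i
    | _ => [], ?_, ?_⟩
  all_goals simp [chainList, linked, List.flatMap_assoc, List.range_eq_range', hC, hD, hm]


/-! ### The identities hold in the monoid -/

/-- A boolean test for `∃ n, Chain n C m D`, for words `m` of length at most the first argument. -/
def chainCheck : ℕ → List Letter → List Letter → List Letter → Bool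
  | 0, C, m, D => m.isEmpty && C == D
  | k + 1, C, m, D => (m.isEmpty && C == D) || (List.range (m.length + 1)).any fun i =>
      (!(i == 0 && C.isEmpty)) && C.isPrefixOf (m.drop i) &&
        chainCheck k (m.take i) (m.drop (i + C.length)) D

/-- Only this direction of the test is needed. A chain step whose two blocks are both empty leaves m
unchanged and is skipped; any other step shortens m, so the length of m is enough fuel. -/
theorem Chain.chainCheck {n : ℕ} {C m D : List Letter} (h : Chain n C m D) (k : ℕ)
    (hk : m.length ≤ k) : chainCheck k C m D = true := by
  induction h generalizing k with
  | nil C => cases k <;> simp [Irredundant.chainCheck]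
  | @cons n P m D C h ih =>
    by_cases hPC : P = [] ∧ C = []
    · obtain ⟨rfl, rfl⟩ := hPC
      exact ih k hk
    · simp only [List.length_append] at hk
      obtain _ | k := k
      · simp only [nonpos_iff_eq_zero, Nat.add_eq_zero_iff, List.length_eq_zero_iff] at hk
        exact absurd ⟨hk.1, hk.2.1⟩ hPC
      · rw [Irredundant.chainCheck, Bool.or_eq_true, List.any_eq_true]
        refine Or.inr ⟨P.length, by simp, ?_⟩
        have h1 : ((P ++ (C ++ m)).drop P.length) = C ++ m := by simp
        have h2 : ((P ++ (C ++ m)).take P.length) = P := by simp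
        have h3 : ((P ++ (C ++ m)).drop (P.length + C.length)) = m := by
          rw [← List.drop_drop, h1, List.drop_left]
        rw [h1, h2, h3, ih k]
        · simp only [Bool.and_true, Bool.and_eq_true, List.isPrefixOf_iff_prefix,
            List.prefix_append, and_true]
          rw [not_and_or] at hPC
          simpa using hPC
        · by_contra hlt
          have : P.length = 0 ∧ C.length = 0 := by omega
          simp only [List.length_eq_zero_iff] at this
          exact hPC this

/-- A boolean test for: the word `v` has no subword `X B m B Y` with `B` of length at least two and
`Chain n X m Y`. -/
def linkedFree (v : List Letter) : Bool :=
  (List.range v.length).all fun i => (List.range v.length).all fun l =>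
    (List.range v.length).all fun d =>
      (!(((v.drop (i + (l + 2) + d)).take (l + 2)).length == l + 2 &&
        (v.drop i).take (l + 2) == (v.drop (i + (l + 2) + d)).take (l + 2))) ||
      (List.range (i + 1)).all fun a => (List.range (v.length + 1)).all fun b =>
        !chainCheck d ((v.take i).drop a) ((v.drop (i + (l + 2))).take d)
          ((v.drop (i + (l + 2) + d + (l + 2))).take b)

/-- The finite verification behind the soundness of all w_n ≈ w_n' at once. -/
theorem linkedFree_wordList : ∀ v ∈ wordList, linkedFree v = true := by
  decide +kernel

theorem not_chain_of_linkedFree {v : List Letter} (hv : linkedFree v = true)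
    {r C B m D s : List Letter} (h : v = r ++ C ++ B ++ m ++ B ++ D ++ s) (hB : 2 ≤ B.length)
    (n : ℕ) : ¬ Chain n C m D := by
  intro hc
  obtain ⟨l, hl⟩ : ∃ l, B.length = l + 2 := ⟨B.length - 2, by omega⟩
  have hlen : v.length = r.length + C.length + B.length + m.length + B.length + D.length +
      s.length := by
    simp only [h, List.length_append]
  have d1 : v.take (r.length + C.length) = r ++ C := by
    rw [h]
    simp only [List.append_assoc]
    rw [← List.append_assoc, ← List.length_append, List.take_left]
  have d2 : v.drop (r.length + C.length) = B ++ (m ++ (B ++ (D ++ s))) := by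
    rw [h]
    simp only [List.append_assoc]
    rw [← List.append_assoc, ← List.length_append, List.drop_left]
  have d3 : v.drop (r.length + C.length + (l + 2)) = m ++ (B ++ (D ++ s)) := by
    rw [← List.drop_drop, d2, ← hl, List.drop_left]
  have d4 : v.drop (r.length + C.length + (l + 2) + m.length) = B ++ (D ++ s) := by
    rw [← List.drop_drop, d3, List.drop_left]
  have d5 : v.drop (r.length + C.length + (l + 2) + m.length + (l + 2)) = D ++ s := by
    rw [← List.drop_drop, d4, ← hl, List.drop_left]
  unfold linkedFree at hv
  simp only [List.all_eq_true, List.mem_range, Bool.or_eq_true] at hv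
  obtain hv | hv := hv (r.length + C.length) (by omega) l (by omega) m.length (by omega)
  · rw [d4, d2, ← hl] at hv
    simp at hv
  · have := hv r.length (by omega) D.length (by omega)
    rw [d1, d3, d5, List.drop_left, List.take_left, List.take_left,
      hc.chainCheck _ le_rfl] at this
    exact absurd this (by decide)

theorem not_isFactorWord_linked {n : ℕ} {C m D : List Letter} (h : Chain n C m D)
    (Z Z' : List Letter) {P Q : List Letter} (hP : P ≠ []) (hQ : Q ≠ []) :
    ¬ IsFactorWord (linked Z (P ++ Q) C m D Z') := by
  rintro ⟨v, hv, r, s, h'⟩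
  refine not_chain_of_linkedFree (linkedFree_wordList v hv) (r := r) (s := s) (C := C) (m := m)
    (D := D) (B := Z ++ (P ++ Q) ++ Z') ?_ ?_ n h
  · rw [← h', linked]
    simp only [List.append_assoc]
  · have := List.length_pos_iff.2 hP
    have := List.length_pos_iff.2 hQ
    simp only [List.length_append]
    omega

/-- If x or y is erased, the two sides have the same image. Otherwise the repeated word Z X Y Z' has
length at least 2 and both images lie in the ideal. -/
theorem holds_chainList (n : ℕ) : Holds (chainList .x .y n) (chainList .y .x n) := by
  refine satisfies_iff.2 fun θ => ?_
  by_cases hx : θ .x = []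
  · left
    simp [chainList, hx]
  by_cases hy : θ .y = []
  · left
    simp [chainList, hy]
  right
  obtain ⟨m, hm, h⟩ := chainList_flatMap θ .x .y n
  obtain ⟨m', hm', h'⟩ := chainList_flatMap θ .y .x n
  rw [h, h']
  exact ⟨not_isFactorWord_linked hm _ _ hx hy, not_isFactorWord_linked hm' _ _ hy hx⟩

theorem IsFactorWord.count_le {l : List Letter} (h : IsFactorWord l) (c : Letter) :
    l.count c ≤ 2 := by
  obtain ⟨v, hv, h⟩ := h
  refine (h.sublist.count_le c).trans ?_
  have key : ∀ v ∈ wordList, ∀ c ∈ v, v.count c ≤ 2 := by decide +kernel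
  by_cases hc : c ∈ v
  · exact key v hv c hc
  · rw [List.count_eq_zero_of_not_mem hc]
    exact Nat.zero_le _

theorem count_le_count_flatMap (θ : Letter → List Letter) {c d : Letter} (h : d ∈ θ c)
    (l : List Letter) : l.count c ≤ (l.flatMap θ).count d := by
  induction l with
  | nil => exact le_rfl
  | cons b l ih =>
    rw [List.flatMap_cons, List.count_append, List.count_cons]
    split_ifs with hb
    · have : b = c := by simpa using hb
      have := List.count_pos_iff.2 h
      subst b
      omega
    · omega

theorem not_isFactorWord_of_count (θ : Letter → List Letter) {c : Letter} (h : θ c ≠ [])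
    {l : List Letter} (hl : 3 ≤ l.count c) : ¬ IsFactorWord (l.flatMap θ) := by
  intro hf
  obtain ⟨d, hd⟩ := List.exists_mem_of_ne_nil _ h
  have := count_le_count_flatMap θ hd l
  have := hf.count_le d
  omega

/-- Erasing c makes the sides equal; not erasing it puts some letter at least three times into both
images, and factors of V contain no letter three times. -/
theorem holds_of_count {p q : List Letter} (c : Letter) (hp : 3 ≤ p.count c) (hq : 3 ≤ q.count c)
    (h : p.filter (fun b => b ≠ c) = q.filter (fun b => b ≠ c)) : Holds p q := by
  refine satisfies_iff.2 fun θ => ?_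
  by_cases hc : θ c = []
  · left
    have key : ∀ l : List Letter, l.flatMap θ = (l.filter (fun b => b ≠ c)).flatMap θ := by
      intro l
      induction l with
      | nil => rfl
      | cons b l ih =>
        by_cases hb : b = c
        · simp [hb, hc, ih]
        · simp [hb, ih]
    rw [key p, key q, h]
  · exact Or.inr ⟨not_isFactorWord_of_count θ hc hp, not_isFactorWord_of_count θ hc hq⟩

theorem satisfies_of_mem {p : Identity} (hp : p ∈ identitySystem) :
    Satisfies (ReesMonoid wordSet) p := by
  rcases hp with ⟨n, _, rfl⟩ | rfl | rfl | rfl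
  · exact holds_chainList n
  all_goals exact holds_of_count .x (by decide) (by decide) (by decide)

theorem DerivesList.holds {u v : List Letter} (h : DerivesList identitySystem u v) : Holds u v :=
  Derives.satisfies (fun _ => satisfies_of_mem) h

/-! ### Size of the word set, of the monoid and of the identity system -/

theorem ncard_wordSet : wordSet.ncard = 37 := by
  classical
  have hnd : (wordList.map word).Nodup :=
    List.Nodup.map word_injective (by decide +kernel)
  have : wordSet = ((wordList.map word).toFinset : Set Word) := by
    ext u
    rw [Finset.mem_coe, List.mem_toFinset]
    rfl
  rw [this, Set.ncard_coe_finset, List.toFinset_card_of_nodup hnd]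
  rfl

theorem finite_reesMonoid : Finite (ReesMonoid wordSet) := by
  let T : Finset (List Letter) := (wordList.flatMap fun v => v.tails.flatMap List.inits).toFinset
  have hT : ∀ l, IsFactorWord l → l ∈ T := by
    rintro l ⟨v, hv, r, s, h⟩
    simp only [T, List.mem_toFinset, List.mem_flatMap]
    refine ⟨v, hv, l ++ s, ?_, ?_⟩
    · rw [List.mem_tails, ← h, List.append_assoc]
      exact List.suffix_append _ _
    · rw [List.mem_inits]
      exact List.prefix_append _ _
  -- A representative of the zero class; every other class is a single factor.
  obtain ⟨z, hz⟩ : ∃ z : List Letter, ¬ IsFactorWord z :=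
    ⟨[.x, .x, .x], fun h => absurd (h.count_le .x) (by decide)⟩
  refine Finite.of_surjective
    (fun o : Option T => ((word (o.elim z fun l => l.1) : Word) : ReesMonoid wordSet)) ?_
  intro a
  induction a using Con.induction_on with
  | H u =>
    by_cases hu : IsFactorWord (FreeMonoid.toList u)
    · exact ⟨some ⟨_, hT _ hu⟩, rfl⟩
    · refine ⟨none, (Con.eq _).2 (Or.inr ⟨?_, ?_⟩)⟩
      · exact fun h => hz (word_mem_factorialClosure.1 h)
      · exact fun h => hu (word_mem_factorialClosure.1 h)

theorem length_chainList (p q : Letter) (n : ℕ) : (chainList p q n).length = 2 * n + 10 := by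
  simp [chainList]
  omega

theorem infinite_identitySystem : identitySystem.Infinite := by
  refine Set.infinite_of_injective_forall_mem
    (f := fun n : ℕ => ((w (n + 2), w' (n + 2)) : Identity)) ?_
    (fun n => Or.inl ⟨n + 2, by omega, rfl⟩)
  intro m n h
  have := congrArg (fun p : Identity => (FreeMonoid.toList p.1).length) h
  change (chainList _ _ _).length = (chainList _ _ _).length at this
  rw [length_chainList, length_chainList] at this
  omega


/-! ### Isoterms -/

theorem DerivationStep.exists_list {S : Set Identity} {u : List Letter} {v : Word}
    (h : DerivationStep S (word u) v) :
    ∃ p q : List Letter, ((word p, word q) ∈ S ∨ (word q, word p) ∈ S) ∧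
      ∃ (θ : Letter → List Letter) (r s : List Letter),
        u = r ++ p.flatMap θ ++ s ∧ v = word (r ++ q.flatMap θ ++ s) := by
  obtain ⟨⟨p, q⟩, hp, θ, r, s, ⟨h1, h2⟩ | ⟨h1, h2⟩⟩ := h
  · have e1 := lift_word_word θ p
    have e2 := lift_word_word θ q
    exact ⟨p, q, Or.inl hp, θ, r, s, h1.trans (congrArg (fun t : Word => r * t * s) e1),
      h2.trans (congrArg (fun t : Word => r * t * s) e2)⟩
  · have e1 := lift_word_word θ p
    have e2 := lift_word_word θ q
    exact ⟨q, p, Or.inr hp, θ, r, s, h1.trans (congrArg (fun t : Word => r * t * s) e2),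
      h2.trans (congrArg (fun t : Word => r * t * s) e1)⟩

theorem not_derives_of_isoterm {S : Set Identity} {u v : List Letter}
    (h : ∀ v, DerivationStep S (word u) v → v = word u) (huv : u ≠ v) :
    ¬ Derives S (word u, word v) := by
  intro hd
  have key : ∀ a b : Word, Relation.ReflTransGen (DerivationStep S) a b → a = word u →
      b = word u := by
    intro a b hab ha
    induction hab with
    | refl => exact ha
    | tail _ hbc ih => exact h _ (ih ▸ hbc)
  exact huv (key _ _ hd rfl).symm

theorem chainList_flatMap_comm {θ : Letter → List Letter} (h : θ .x = [] ∨ θ .y = []) (k : ℕ) :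
    (chainList .x .y k).flatMap θ = (chainList .y .x k).flatMap θ := by
  rcases h with h | h <;> simp [chainList, h]

/-! ### Symmetries of chains -/

theorem Chain.snoc {n : ℕ} {C m P : List Letter} (h : Chain n C m P) (D : List Letter) :
    Chain (n + 1) C (m ++ (D ++ P)) D := by
  induction h with
  | nil C => simpa using Chain.cons C (Chain.nil D)
  | cons C h ih => simpa only [List.append_assoc] using Chain.cons C ih

theorem Chain.reverse {n : ℕ} {C m D : List Letter} (h : Chain n C m D) :
    Chain n D.reverse m.reverse C.reverse := by
  induction h with
  | nil C => exact Chain.nil _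
  | cons C h ih =>
    simpa only [List.reverse_append, List.append_assoc] using ih.snoc C.reverse

/-- Each of X₀, …, Xₙ appears exactly twice in X₀ m Xₙ. -/
theorem Chain.even_count {n : ℕ} {C m D : List Letter} (h : Chain n C m D) (c : Letter) :
    Even (C.count c + m.count c + D.count c) := by
  induction h with
  | nil C => exact ⟨C.count c, by simp⟩
  | cons C h ih =>
    obtain ⟨t, ht⟩ := ih
    refine ⟨t + C.count c, ?_⟩
    simp only [List.count_append]
    omega

/-- The first nonempty block would appear twice in m unless it is the last one, and then it is all
of m. -/
theorem Chain.eq_of_nil_left {n : ℕ} {m D : List Letter} (h : Chain n [] m D) {c : Letter}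
    (hc : m.head? = some c) (h1 : m.count c = 1) : D = m := by
  generalize hC : ([] : List Letter) = C at h
  induction h with
  | nil C => simp at hc
  | @cons n P m D C h ih =>
    subst hC
    rw [List.nil_append] at *
    cases P with
    | nil => exact ih hc h1 rfl
    | cons b P =>
      obtain rfl : b = c := by simpa using hc
      cases h with
      | nil => simp
      | cons => simp only [List.count_append, List.count_cons_self] at h1; omega

/-- When there are at least two steps, X₁ appears twice in m, so a head letter of m that occurs only
once cannot lie in X₁. As it is not in X₀ either, both blocks are empty and `Chain.eq_of_nil_left`
applies. -/
theorem Chain.eq_of_count_head {n : ℕ} {C m D : List Letter} (h : Chain n C m D) (hn : 2 ≤ n)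
    {c : Letter} (hc : m.head? = some c) (h1 : m.count c = 1) (hC : c ∉ C) : D = m := by
  cases h with
  | nil => omega
  | @cons n P m D C h =>
    cases P with
    | nil =>
      cases C with
      | nil => exact h.eq_of_nil_left hc h1
      | cons b C =>
        obtain rfl : b = c := by simpa using hc
        simp at hC
    | cons b P =>
      obtain rfl : b = c := by simpa using hc
      cases h with
      | nil => omega
      | cons => simp only [List.count_append, List.count_cons_self] at h1; omega

theorem Chain.eq_of_count_getLast {n : ℕ} {C m D : List Letter} (h : Chain n C m D) (hn : 2 ≤ n)
    {c : Letter} (hc : m.getLast? = some c) (h1 : m.count c = 1) (hD : c ∉ D) : C = m := by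
  have := h.reverse.eq_of_count_head hn (c := c) (by simpa using hc) (by simpa using h1)
    (by simpa using hD)
  simpa using this

/-! ### The words `w_n` are isoterms for the other identities -/

/-- The word `x_{i+1} x_i x_{i+2} x_{i+1} ⋯ x_{i+d} x_{i+d-1}`. -/
def ladder (i d : ℕ) : List Letter :=
  (List.range' i d).flatMap fun j => [.xsub (j + 1), .xsub j]

theorem chainList_eq (p q : Letter) (n : ℕ) : chainList p q n =
    [.xsub 0, .zsub 1, p, q, .zsub 2] ++ ladder 0 n ++ [.zsub 1, p, q, .zsub 2, .xsub n] := by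
  rw [chainList, ladder, List.range_eq_range']

theorem ladder_succ (i d : ℕ) :
    ladder i (d + 1) = .xsub (i + 1) :: .xsub i :: ladder (i + 1) d := by
  simp [ladder, List.range'_succ]

theorem length_ladder (i d : ℕ) : (ladder i d).length = 2 * d := by
  induction d generalizing i with
  | zero => rfl
  | succ d ih => rw [ladder_succ, List.length_cons, List.length_cons, ih]; omega

theorem count_ladder (i d a : ℕ) : (ladder i d).count (.xsub a) =
    (if i ≤ a ∧ a < i + d then 1 else 0) + (if i < a ∧ a ≤ i + d then 1 else 0) := by
  induction d generalizing i with
  | zero =>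
    rw [if_neg (by omega), if_neg (by omega)]
    rfl
  | succ d ih =>
    rw [ladder_succ, List.count_cons, List.count_cons, ih]
    simp only [beq_iff_eq, Letter.xsub.injEq]
    split_ifs <;> omega

theorem ladder_getElem? (i d k : ℕ) (h : k < 2 * d) :
    (ladder i d)[k]? = some (.xsub (if k % 2 = 0 then i + k / 2 + 1 else i + k / 2)) := by
  induction d generalizing i k with
  | zero => omega
  | succ d ih =>
    rw [ladder_succ]
    match k with
    | 0 => simp
    | 1 => simp
    | k + 2 =>
      rw [List.getElem?_cons_succ, List.getElem?_cons_succ, ih (i + 1) k (by omega)]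
      congr 2
      split_ifs <;> omega

/-- The block [xᵢ] must reappear directly after X₁, and xᵢ occurs in the ladder only in second
place. So X₁ is the single letter xᵢ₊₁, and induction goes on from there. -/
theorem Chain.length_eq_of_ladder {k i d : ℕ}
    (h : Chain k [.xsub i] (ladder i d) [.xsub (i + d)]) : k = d := by
  induction d generalizing k i with
  | zero =>
    cases h' : k with
    | zero => rfl
    | succ k =>
      subst h'
      generalize hm : ladder i 0 = m at h
      cases h with
      | cons C h => simp [ladder] at hm
  | succ d ih =>
    generalize hm : ladder i (d + 1) = m at h
    cases h with
    | @cons k P m _ _ h =>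
      rw [ladder_succ] at hm
      match P with
      | [] => simp at hm
      | [b] =>
        simp only [List.cons_append, List.nil_append, List.cons.injEq] at hm
        obtain ⟨rfl, -, rfl⟩ := hm
        have : k = d := ih (by rwa [show i + 1 + d = i + (d + 1) by omega])
        rw [this]
      | b :: b' :: P =>
        simp only [List.cons_append, List.cons.injEq] at hm
        have := congrArg (List.count (.xsub i)) hm.2.2
        rw [count_ladder, if_neg (by omega), if_neg (by omega)] at this
        simp at this

/-- The letter of `chainList .x .y n` in position `i`. -/
def chainLetter (n i : ℕ) : Letter :=
  if i = 0 then .xsub 0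
  else if i = 1 ∨ i = 2 * n + 5 then .zsub 1
  else if i = 2 ∨ i = 2 * n + 6 then .x
  else if i = 3 ∨ i = 2 * n + 7 then .y
  else if i = 4 ∨ i = 2 * n + 8 then .zsub 2
  else if i = 2 * n + 9 then .xsub n
  else .xsub (if i % 2 = 1 then (i - 5) / 2 + 1 else (i - 5) / 2)

theorem chainList_getElem? (n i : ℕ) (h : i < 2 * n + 10) :
    (chainList .x .y n)[i]? = some (chainLetter n i) := by
  rw [chainList_eq]
  by_cases h5 : i < 5
  · rw [List.append_assoc, List.getElem?_append_left (by simpa using h5)]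
    unfold chainLetter
    interval_cases i <;> simp
  · by_cases hn : i < 2 * n + 5
    · rw [List.getElem?_append_left (by simp [length_ladder]; omega),
        List.getElem?_append_right (by simp; omega), List.length_cons, List.length_cons,
        List.length_cons, List.length_cons, List.length_cons, List.length_nil,
        ladder_getElem? _ _ _ (by omega)]
      rw [chainLetter, if_neg (show ¬ i = 0 by omega),
        if_neg (show ¬ (i = 1 ∨ i = 2 * n + 5) by omega),
        if_neg (show ¬ (i = 2 ∨ i = 2 * n + 6) by omega),
        if_neg (show ¬ (i = 3 ∨ i = 2 * n + 7) by omega),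
        if_neg (show ¬ (i = 4 ∨ i = 2 * n + 8) by omega), if_neg (show ¬ i = 2 * n + 9 by omega),
        Option.some.injEq, Letter.xsub.injEq]
      split_ifs <;> omega
    · obtain ⟨j, rfl⟩ : ∃ j, i = 2 * n + 5 + j := ⟨i - (2 * n + 5), by omega⟩
      rw [List.getElem?_append_right (by simp [length_ladder])]
      have : 2 * n + 5 + j - ([Letter.xsub 0, .zsub 1, .x, .y, .zsub 2] ++ ladder 0 n).length
          = j := by
        simp [length_ladder]
      rw [this]
      have hj : j < 5 := by omega
      unfold chainLetter
      interval_cases j <;> simp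

/-- A numbering of the letters that occur in the words `w_n`. -/
def letterCode : Letter → ℕ
  | .zsub 1 => 1
  | .x => 2
  | .y => 3
  | .zsub 2 => 4
  | .xsub a => a + 5
  | _ => 0

/-- Numbering the letters turns equality of letters of w_n into linear arithmetic on their
positions. -/
theorem letterCode_chainLetter {n i : ℕ} (h : i < 2 * n + 10) :
    (i = 0 ∧ letterCode (chainLetter n i) = 5) ∨
    ((i = 1 ∨ i = 2 * n + 5) ∧ letterCode (chainLetter n i) = 1) ∨
    ((i = 2 ∨ i = 2 * n + 6) ∧ letterCode (chainLetter n i) = 2) ∨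
    ((i = 3 ∨ i = 2 * n + 7) ∧ letterCode (chainLetter n i) = 3) ∨
    ((i = 4 ∨ i = 2 * n + 8) ∧ letterCode (chainLetter n i) = 4) ∨
    (i = 2 * n + 9 ∧ letterCode (chainLetter n i) = n + 5) ∨
    (∃ k < n, i = 2 * k + 5 ∧ letterCode (chainLetter n i) = k + 6) ∨
    (∃ k < n, i = 2 * k + 6 ∧ letterCode (chainLetter n i) = k + 5) := by
  unfold chainLetter
  split_ifs with h1 h2 h3 h4 h5 h6 h7
  · exact Or.inl ⟨h1, rfl⟩
  · exact Or.inr (Or.inl ⟨h2, rfl⟩)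
  · exact Or.inr (Or.inr (Or.inl ⟨h3, rfl⟩))
  · exact Or.inr (Or.inr (Or.inr (Or.inl ⟨h4, rfl⟩)))
  · exact Or.inr (Or.inr (Or.inr (Or.inr (Or.inl ⟨h5, rfl⟩))))
  · exact Or.inr (Or.inr (Or.inr (Or.inr (Or.inr (Or.inl ⟨h6, rfl⟩)))))
  · exact Or.inr (Or.inr (Or.inr (Or.inr (Or.inr (Or.inr (Or.inl
      ⟨(i - 5) / 2, by omega, by omega, rfl⟩))))))
  · exact Or.inr (Or.inr (Or.inr (Or.inr (Or.inr (Or.inr (Or.inr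
      ⟨(i - 5) / 2, by omega, by omega, rfl⟩))))))

/-- Letters of the block z₁xyz₂ return at distance 2n + 4 and inner letters of the ladder at
distance 3; the remaining cases are x₀ and xₙ. -/
theorem chainLetter_eq {n i j : ℕ} (hij : i < j) (hj : j < 2 * n + 10)
    (h : chainLetter n i = chainLetter n j) :
    (1 ≤ i ∧ i ≤ 4 ∧ j = i + 2 * n + 4) ∨ (i = 0 ∧ j = 6) ∨ (i = 0 ∧ n = 0 ∧ j = 9) ∨
      (5 ≤ i ∧ i % 2 = 1 ∧ j = i + 3 ∧ j < 2 * n + 5) ∨ (i = 2 * n + 3 ∧ j = 2 * n + 9) := by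
  have h := congrArg letterCode h
  rcases letterCode_chainLetter (hij.trans hj) with h1 | h1 | h1 | h1 | h1 | h1 | ⟨k, h1⟩ | ⟨k, h1⟩
  all_goals
    rcases letterCode_chainLetter hj with h2 | h2 | h2 | h2 | h2 | h2 | ⟨l, h2⟩ | ⟨l, h2⟩ <;> omega

/-- Of two consecutive positions in the ladder only one carries a letter that returns at distance 3
to the right. So a factor of length two that is repeated lies inside z₁xyz₂. -/
theorem chainLetter_eq_succ {n i j : ℕ} (hn : 2 ≤ n) (hij : i < j) (hj : j + 1 < 2 * n + 10)
    (h : chainLetter n i = chainLetter n j) (h' : chainLetter n (i + 1) = chainLetter n (j + 1)) :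
    1 ≤ i ∧ i ≤ 3 ∧ j = i + 2 * n + 4 := by
  have h1 := chainLetter_eq hij (by omega) h
  have h2 := chainLetter_eq (by omega) hj h'
  omega

theorem count_chainList_le (n : ℕ) (c : Letter) : (chainList .x .y n).count c ≤ 2 := by
  rw [chainList_eq, List.count_append, List.count_append]
  cases c with
  | xsub a =>
    rw [count_ladder]
    simp only [List.count_cons, List.count_nil, beq_iff_eq, reduceCtorEq, Letter.xsub.injEq,
      ↓reduceIte]
    split_ifs <;> omega
  | _ =>
    rw [List.count_eq_zero_of_not_mem (a := _) (l := ladder 0 n) (by simp [ladder])]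
    simp only [List.count_cons, List.count_nil, beq_iff_eq, reduceCtorEq, Letter.zsub.injEq,
      ↓reduceIte]
    try split_ifs
    all_goals omega

/-- The repeated word B lies inside z₁xyz₂. Were it a proper part, the chain would begin or end with
a letter of z₁xyz₂, which is too rare in it. So B is the whole block, m is the whole ladder, and the
ladder determines its number of steps. -/
theorem eq_of_linked_isInfix_chainList {n k : ℕ} (hn : 2 ≤ n) (hk : 2 ≤ k)
    {C m D : List Letter} (h : Chain k C m D) (Z Z' : List Letter) {P Q : List Letter}
    (hP : P ≠ []) (hQ : Q ≠ []) {r s : List Letter}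
    (hw : chainList .x .y n = r ++ linked Z (P ++ Q) C m D Z' ++ s) : k = n := by
  obtain ⟨B, hB⟩ : ∃ B, B = Z ++ (P ++ Q) ++ Z' := ⟨_, rfl⟩
  have hB2 : 2 ≤ B.length := by
    have := List.length_pos_iff.2 hP
    have := List.length_pos_iff.2 hQ
    simp only [hB, List.length_append]
    omega
  rw [linked, ← hB] at hw
  have hlen := congrArg List.length hw
  rw [length_chainList] at hlen
  simp only [List.length_append] at hlen
  have hcount : ∀ c, r.count c + C.count c + B.count c + m.count c + B.count c + D.count c +
      s.count c ≤ 2 := by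
    intro c
    have := count_chainList_le n c
    rw [hw] at this
    simp only [List.count_append] at this
    omega
  obtain ⟨i, hi⟩ : ∃ i, i = r.length + C.length := ⟨_, rfl⟩
  obtain ⟨b, hb⟩ : ∃ b, b = B.length := ⟨_, rfl⟩
  have e1 : chainList .x .y n = (r ++ C) ++ (B ++ (m ++ (B ++ (D ++ s)))) := by
    rw [hw]; simp only [List.append_assoc]
  have e2 : chainList .x .y n = (r ++ C ++ B) ++ (m ++ (B ++ (D ++ s))) := by
    rw [hw]; simp only [List.append_assoc]
  have e3 : chainList .x .y n = (r ++ C ++ B ++ m) ++ (B ++ (D ++ s)) := by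
    rw [hw]; simp only [List.append_assoc]
  have e4 : chainList .x .y n = (r ++ C ++ B ++ m ++ B) ++ (D ++ s) := by
    rw [hw]; simp only [List.append_assoc]
  have f1 : ∀ t, t < b → some (chainLetter n (i + t)) = B[t]? := by
    intro t ht
    rw [← chainList_getElem? n _ (by omega), e1,
      List.getElem?_append_right (by simp only [List.length_append]; omega),
      List.getElem?_append_left (by simp only [List.length_append]; omega)]
    congr 1
    simp only [List.length_append]
    omega
  have f3 : ∀ t, t < b → some (chainLetter n (i + b + m.length + t)) = B[t]? := by
    intro t ht
    rw [← chainList_getElem? n _ (by omega), e3,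
      List.getElem?_append_right (by simp only [List.length_append]; omega),
      List.getElem?_append_left (by simp only [List.length_append]; omega)]
    congr 1
    simp only [List.length_append]
    omega
  have f : ∀ t, t < b → chainLetter n (i + t) = chainLetter n (i + b + m.length + t) :=
    fun t ht => Option.some.inj ((f1 t ht).trans (f3 t ht).symm)
  obtain ⟨h1, h3, hm⟩ := chainLetter_eq_succ hn (i := i) (j := i + b + m.length) (by omega)
    (by omega) (f 0 (by omega)) (f 1 (by omega))
  obtain ⟨-, h4, -⟩ := chainLetter_eq_succ hn (i := i + (b - 2))
    (j := i + b + m.length + (b - 2)) (by omega) (by omega) (f _ (by omega))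
    (by simpa only [show i + (b - 2) + 1 = i + (b - 1) by omega,
      show i + b + m.length + (b - 2) + 1 = i + b + m.length + (b - 1) by omega]
      using f (b - 1) (by omega))
  have hm' : 0 < m.length := by omega
  have hsame : ∀ t, 1 ≤ t → t ≤ 4 → chainLetter n (t + 2 * n + 4) = chainLetter n t := by
    intro t h1 h4
    unfold chainLetter
    interval_cases t
    · simp [show 1 + 2 * n + 4 = 2 * n + 5 by omega]
    · simp [show 2 + 2 * n + 4 = 2 * n + 6 by omega]
    · simp [show 3 + 2 * n + 4 = 2 * n + 7 by omega]
    · simp [show 4 + 2 * n + 4 = 2 * n + 8 by omega]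
  -- If B stops early, the next letter c of z₁xyz₂ heads m and follows the second B as well. Since c
  -- occurs at most twice in w_n, it is single in m and absent from C, so D = m, which is too long
  -- to fit.
  have hend : i + b = 5 := by
    by_contra hne
    obtain ⟨c, hc⟩ : ∃ c, m.head? = some c :=
      ⟨m.head (List.length_pos_iff.1 hm'), List.head?_eq_some_head _⟩
    have c1 : chainLetter n (i + b) = c := by
      have := chainList_getElem? n (i + b) (by omega)
      rw [e2, List.getElem?_append_right (by simp only [List.length_append]; omega)] at this
      rw [show i + b - (r ++ C ++ B).length = 0 by simp only [List.length_append]; omega,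
        List.getElem?_append_left hm', ← List.head?_eq_getElem?, hc] at this
      exact (Option.some.inj this).symm
    have c2 : c ∈ D ++ s := by
      have := chainList_getElem? n (i + b + 2 * n + 4) (by omega)
      rw [hsame _ (by omega) (by omega), c1, e4,
        List.getElem?_append_right (by simp only [List.length_append]; omega)] at this
      exact List.mem_of_getElem? this
    have c3 := List.count_pos_iff.2 c2
    have c4 := List.count_pos_iff.2 (List.mem_of_mem_head? hc)
    rw [List.count_append] at c3
    have c5 := hcount c
    have := h.eq_of_count_head hk hc (by omega) (List.count_eq_zero.1 (by omega))
    have := congrArg List.length this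
    omega
  -- The mirror image, with the last letter of m.
  have hstart : i = 1 := by
    by_contra hne
    obtain ⟨c, hc⟩ : ∃ c, m.getLast? = some c :=
      ⟨m.getLast (List.length_pos_iff.1 hm'), List.getLast?_eq_some_getLast _⟩
    have c1 : chainLetter n ((i - 1) + 2 * n + 4) = c := by
      have := chainList_getElem? n ((i - 1) + 2 * n + 4) (by omega)
      rw [e2, List.getElem?_append_right (by simp only [List.length_append]; omega)] at this
      rw [show (i - 1) + 2 * n + 4 - (r ++ C ++ B).length = m.length - 1 by
          simp only [List.length_append]; omega,
        List.getElem?_append_left (by omega), ← List.getLast?_eq_getElem?, hc] at this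
      exact (Option.some.inj this).symm
    have c2 : c ∈ r ++ C := by
      have := chainList_getElem? n (i - 1) (by omega)
      rw [← hsame _ (by omega) (by omega), c1, e1,
        List.getElem?_append_left (by simp only [List.length_append]; omega)] at this
      exact List.mem_of_getElem? this
    have c3 := List.count_pos_iff.2 c2
    have c4 := List.count_pos_iff.2 (List.mem_of_getLast? hc)
    rw [List.count_append] at c3
    have c5 := hcount c
    have := h.eq_of_count_getLast hk hc (by omega) (List.count_eq_zero.1 (by omega))
    have := congrArg List.length this
    omega
  rw [chainList_eq] at e4
  have g1 : ([Letter.xsub 0, .zsub 1, .x, .y, .zsub 2] ++ ladder 0 n ++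
      [.zsub 1, .x, .y, .zsub 2]) ++ [.xsub n] = (r ++ C ++ B ++ m ++ B) ++ (D ++ s) := by
    rw [← e4]; simp
  obtain ⟨g2, gD⟩ := List.append_inj g1 (by
    simp only [List.length_append, length_ladder, List.length_cons, List.length_nil]; omega)
  obtain ⟨g3, -⟩ := List.append_inj g2 (by
    simp only [List.length_append, length_ladder, List.length_cons, List.length_nil]; omega)
  obtain ⟨g4, gm⟩ := List.append_inj g3 (by
    simp only [List.length_append, List.length_cons, List.length_nil]; omega)
  have g5 : [Letter.xsub 0] ++ [.zsub 1, .x, .y, .zsub 2] = (r ++ C) ++ B := g4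
  obtain ⟨gC, -⟩ := List.append_inj g5 (by
    simp only [List.length_append, List.length_cons, List.length_nil]; omega)
  subst gm
  have hC : C = [.xsub 0] := by
    rcases List.append_eq_singleton_iff.1 gC.symm with ⟨-, h'⟩ | ⟨-, h'⟩
    · exact h'
    · subst h'
      -- The letter x₀ occurs once in the ladder, so by parity it also occurs in C or D, and D has
      -- no room for it. The same argument with xₙ determines D.
      have e := h.even_count (.xsub 0)
      rw [count_ladder, if_pos (by omega), if_neg (by omega)] at e
      have d0 : D.count (.xsub 0) = 0 := by
        refine List.count_eq_zero.2 fun hd => ?_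
        have : Letter.xsub 0 ∈ [Letter.xsub n] := by
          rw [gD]; exact List.mem_append_left _ hd
        simp at this
        omega
      rw [d0] at e
      simp at e
  have hD : D = [.xsub n] := by
    rcases List.append_eq_singleton_iff.1 gD.symm with ⟨h', -⟩ | ⟨h', -⟩
    · subst h'
      have e := h.even_count (.xsub n)
      rw [count_ladder, if_neg (by omega), if_pos (by omega), hC] at e
      have d0 : [Letter.xsub 0].count (.xsub n) = 0 := by
        refine List.count_eq_zero.2 fun hd => ?_
        simp at hd
        omega
      rw [d0] at e
      simp at e
    · exact h'
  subst hC hD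
  exact Chain.length_eq_of_ladder (i := 0) (by simpa using h)


/-! ### Irredundance -/

theorem mem_identitySystem {p q : List Letter} :
    (word p, word q) ∈ identitySystem ↔
      (∃ n, 2 ≤ n ∧ p = chainList .x .y n ∧ q = chainList .y .x n) ∨
      (p = [.x, .tsub 1, .x, .tsub 2, .x] ∧ q = [.x, .x, .x, .tsub 1, .tsub 2]) ∨
      (p = [.x, .x, .x, .tsub 1, .tsub 2] ∧ q = [.tsub 1, .tsub 2, .x, .x, .x]) ∨
      (p = [.x, .x, .x] ∧ q = [.x, .x, .x, .x]) := by
  have key : ∀ p' q' : List Letter, (word p, word q) = (word p', word q') ↔ p = p' ∧ q = q' :=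
    fun p' q' => ⟨fun h => ⟨congrArg Prod.fst h, congrArg Prod.snd h⟩,
      fun h => by rw [h.1, h.2]⟩
  constructor
  · rintro (⟨n, hn, h⟩ | h | h | h)
    · exact Or.inl ⟨n, hn, (key _ _).1 h⟩
    · exact Or.inr (Or.inl ((key _ _).1 h))
    · exact Or.inr (Or.inr (Or.inl ((key _ _).1 h)))
    · exact Or.inr (Or.inr (Or.inr ((key _ _).1 h)))
  · rintro (⟨n, hn, h⟩ | h | h | h)
    · exact Or.inl ⟨n, hn, (key _ _).2 h⟩
    · exact Or.inr (Or.inl ((key _ _).2 h))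
    · exact Or.inr (Or.inr (Or.inl ((key _ _).2 h)))
    · exact Or.inr (Or.inr (Or.inr ((key _ _).2 h)))

theorem flatMap_eq_of_count {θ : Letter → List Letter} {c : Letter} {l r s u : List Letter}
    (hl : 3 ≤ l.count c) (hu : ∀ d, u.count d ≤ 2) (h : u = r ++ l.flatMap θ ++ s) :
    θ c = [] := by
  by_contra hc
  obtain ⟨d, hd⟩ := List.exists_mem_of_ne_nil _ hc
  have h1 := count_le_count_flatMap θ hd l
  have h2 := hu d
  rw [h, List.count_append, List.count_append] at h2
  omega

/-- The word w_n is an isoterm for all the other identities, since by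
`eq_of_linked_isInfix_chainList` only its own index could change it. -/
theorem not_derives_chain {n : ℕ} (hn : 2 ≤ n) :
    ¬ Derives (identitySystem \ {(w n, w' n)}) (w n, w' n) := by
  refine not_derives_of_isoterm (u := chainList .x .y n) (v := chainList .y .x n) ?_
    (by simp [chainList])
  intro v hv
  obtain ⟨p, q, hpq, θ, r, s, hu, rfl⟩ := hv.exists_list
  have hθ : p.flatMap θ = q.flatMap θ → word (r ++ q.flatMap θ ++ s) = word (chainList .x .y n) :=
    fun h => by rw [hu, h]
  apply hθ
  -- A cube identity fits into w_n, where no letter occurs three times, only with x erased, and then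
  -- it changes nothing.
  have h3 : ∀ {l : List Letter}, 3 ≤ l.count .x → chainList .x .y n = r ++ l.flatMap θ ++ s →
      θ .x = [] := fun hl h => flatMap_eq_of_count hl (count_chainList_le n) h
  rcases hpq with ⟨h, hne⟩ | ⟨h, hne⟩
  all_goals rcases mem_identitySystem.1 h with ⟨k, hk, rfl, rfl⟩ | ⟨rfl, rfl⟩ | ⟨rfl, rfl⟩ | ⟨rfl, rfl⟩
  · by_cases hxy : θ .x = [] ∨ θ .y = []
    · exact chainList_flatMap_comm hxy k
    · push Not at hxy
      obtain ⟨m, hm, hw⟩ := chainList_flatMap θ .x .y k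
      obtain rfl := eq_of_linked_isInfix_chainList hn hk hm _ _ hxy.1 hxy.2 (hw ▸ hu)
      exact absurd rfl hne
  · simp [h3 (by decide) hu]
  · simp [h3 (by decide) hu]
  · simp [h3 (by decide) hu]
  · by_cases hxy : θ .x = [] ∨ θ .y = []
    · exact (chainList_flatMap_comm hxy k).symm
    · push Not at hxy
      obtain ⟨m, hm, hw⟩ := chainList_flatMap θ .y .x k
      obtain rfl := eq_of_linked_isInfix_chainList hn hk hm _ _ hxy.2 hxy.1 (hw ▸ hu)
      exact absurd rfl hne
  · simp [h3 (by decide) hu]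
  · simp [h3 (by decide) hu]
  · simp [h3 (by decide) hu]

/-- The word `x t₁ x t₂ x`. -/
def spreadCube : List Letter := [.x, .tsub 1, .x, .tsub 2, .x]

theorem eq_of_two_le_count_spreadCube {d : Letter} (h : 2 ≤ spreadCube.count d) : d = .x := by
  by_contra hd
  have hmem : d ∈ spreadCube := List.count_pos_iff.1 (by omega)
  have key : ∀ d ∈ spreadCube, d ≠ .x → spreadCube.count d < 2 := by decide
  have := key d hmem hd
  omega

/-- A repeated B can consist only of the letter x, the one letter that occurs twice; two copies of
length at least 2 would need four of them. -/
theorem spreadCube_ne_of_square {r B m s : List Letter} (hB : 2 ≤ B.length) :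
    spreadCube ≠ r ++ B ++ m ++ B ++ s := by
  intro h
  have hx : ∀ d ∈ B, d = .x := by
    intro d hd
    have := List.count_pos_iff.2 hd
    refine eq_of_two_le_count_spreadCube ?_
    rw [h]
    simp only [List.count_append]
    omega
  have h3 : spreadCube.count .x = 3 := by decide
  rw [h] at h3
  simp only [List.count_append] at h3
  have : B.count .x = B.length := List.count_eq_length.2 fun d hd => (hx d hd).symm
  omega

/-- Again X is a power of x, and no two occurrences of x are adjacent. -/
theorem eq_nil_of_cube_isInfix_spreadCube {r X s : List Letter}
    (h : spreadCube = r ++ (X ++ X ++ X) ++ s) : X = [] := by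
  have hx : ∀ d ∈ X, d = .x := by
    intro d hd
    have := List.count_pos_iff.2 hd
    refine eq_of_two_le_count_spreadCube ?_
    rw [h]
    simp only [List.count_append]
    omega
  obtain ⟨k, rfl⟩ : ∃ k, X = List.replicate k .x := ⟨_, List.eq_replicate_of_mem hx⟩
  obtain _ | k := k
  · rfl
  have key : ¬ [Letter.x, .x] <:+: spreadCube := by decide
  refine absurd ⟨r ++ List.replicate k .x, List.replicate k .x ++ List.replicate (k + 1) .x ++ s,
    ?_⟩ key
  rw [h]
  conv_rhs => rw [List.append_assoc (List.replicate (k + 1) Letter.x)]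
  conv_rhs =>
    enter [1, 2, 1]
    rw [List.replicate_succ']
  simp [List.replicate_succ]

theorem not_derives_spreadCube :
    ¬ Derives (identitySystem \
        {(word [.x, .tsub 1, .x, .tsub 2, .x], word [.x, .x, .x, .tsub 1, .tsub 2])})
      (word [.x, .tsub 1, .x, .tsub 2, .x], word [.x, .x, .x, .tsub 1, .tsub 2]) := by
  refine not_derives_of_isoterm (u := spreadCube) ?_ (by decide)
  intro v hv
  obtain ⟨p, q, hpq, θ, r, s, hu, rfl⟩ := hv.exists_list
  have hθ : p.flatMap θ = q.flatMap θ → word (r ++ q.flatMap θ ++ s) = word spreadCube :=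
    fun h => by rw [hu, h]
  apply hθ
  have hcube : ∀ a b : List Letter, p.flatMap θ = a ++ (θ .x ++ θ .x ++ θ .x) ++ b →
      θ .x = [] := by
    intro a b h
    refine eq_nil_of_cube_isInfix_spreadCube (r := r ++ a) (s := b ++ s) ?_
    rw [hu, h]
    simp only [List.append_assoc]
  have hchain : ∀ (P Q : Letter) (k : ℕ), θ P ≠ [] → θ Q ≠ [] → p ≠ chainList P Q k := by
    rintro P Q k hP hQ rfl
    obtain ⟨m, -, hw⟩ := chainList_flatMap θ P Q k
    refine spreadCube_ne_of_square (r := r ++ θ (.xsub 0)) (m := m) (s := θ (.xsub k) ++ s)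
      (B := θ (.zsub 1) ++ (θ P ++ θ Q) ++ θ (.zsub 2)) ?_ ?_
    · have := List.length_pos_iff.2 hP
      have := List.length_pos_iff.2 hQ
      simp only [List.length_append]
      omega
    · rw [hu, hw, linked]
      simp only [List.append_assoc]
  rcases hpq with ⟨h, hne⟩ | ⟨h, hne⟩
  all_goals rcases mem_identitySystem.1 h with ⟨k, hk, rfl, rfl⟩ | ⟨rfl, rfl⟩ | ⟨rfl, rfl⟩ | ⟨rfl, rfl⟩
  · by_cases hxy : θ .x = [] ∨ θ .y = []
    · exact chainList_flatMap_comm hxy k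
    · push Not at hxy
      exact absurd rfl (hchain _ _ _ hxy.1 hxy.2)
  · exact absurd rfl hne
  · simp [hcube [] (θ (.tsub 1) ++ θ (.tsub 2)) (by simp)]
  · simp [hcube [] [] (by simp)]
  · by_cases hxy : θ .x = [] ∨ θ .y = []
    · exact (chainList_flatMap_comm hxy k).symm
    · push Not at hxy
      exact absurd rfl (hchain _ _ _ hxy.2 hxy.1)
  · exact absurd rfl hne
  · simp [hcube (θ (.tsub 1) ++ θ (.tsub 2)) [] (by simp)]
  · simp [hcube [] (θ .x) (by simp)]

/-- The monoid `{0, 1, e, t}` with `ee = e`, `te = t`, `et = tt = 0`. -/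
inductive FourMonoid : Type
  | zero | one | e | t
  deriving DecidableEq

namespace FourMonoid

/-- The multiplication of `{0, 1, e, t}`. -/
def mul : FourMonoid → FourMonoid → FourMonoid
  | one, b => b
  | a, one => a
  | e, e => e
  | t, e => t
  | _, _ => zero

instance : Monoid FourMonoid where
  mul := mul
  one := one
  mul_assoc a b c := by cases a <;> cases b <;> cases c <;> rfl
  one_mul a := by cases a <;> rfl
  mul_one a := by cases a <;> rfl

/-- The elements 1 and e commute, and two occurrences of 0 or t in a product give 0, whatever stands
between them. -/
theorem commute_or (a : FourMonoid) :
    (a = one ∨ a = e) ∨ ∀ u v w : FourMonoid, u * (a * (v * (a * w))) = zero := by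
  cases a
  · exact Or.inr fun u v w => by cases u <;> cases v <;> cases w <;> rfl
  · exact Or.inl (Or.inl rfl)
  · exact Or.inl (Or.inr rfl)
  · exact Or.inr fun u v w => by cases u <;> cases v <;> cases w <;> rfl

/-- So w_n ≈ w_n' holds here: either the images of x and y commute, or one of them annihilates both
sides. -/
theorem swap_eq (a b u v w : FourMonoid) :
    u * (a * (b * (v * (a * (b * w))))) = u * (b * (a * (v * (b * (a * w))))) := by
  have assoc1 : ∀ a b : FourMonoid, u * (a * (b * (v * (a * (b * w))))) =
      u * (a * ((b * v) * (a * (b * w)))) := fun a b => by simp only [mul_assoc]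
  have assoc2 : ∀ a b : FourMonoid, u * (a * (b * (v * (a * (b * w))))) =
      (u * a) * (b * ((v * a) * (b * w))) := fun a b => by simp only [mul_assoc]
  rcases commute_or a with ha | ha
  · rcases commute_or b with hb | hb
    · have hab : a * b = b * a := by
        rcases ha with rfl | rfl <;> rcases hb with rfl | rfl <;> rfl
      have : ∀ c, a * (b * c) = b * (a * c) := fun c => by rw [← mul_assoc, hab, mul_assoc]
      rw [this, this]
    · rw [assoc2 a b, assoc1 b a, hb, hb]
  · rw [assoc1 a b, assoc2 b a, ha, ha]

end FourMonoid

theorem satisfies_of_forall_list {M : Type*} [Monoid M] {S : Set Identity}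
    (h : ∀ p q : List Letter, (word p, word q) ∈ S → ∀ φ : Letter → M,
      (p.map φ).prod = (q.map φ).prod) : ∀ p ∈ S, Satisfies M p := by
  rintro ⟨p, q⟩ hp φ
  exact (lift_word φ p).trans ((h p q hp φ).trans (lift_word φ q).symm)

/-- With x = e, t₁ = t and the other letters 1, the sides become et = 0 and te = t. -/
theorem not_derives_cube_central :
    ¬ Derives (identitySystem \
        {(word [.x, .x, .x, .tsub 1, .tsub 2], word [.tsub 1, .tsub 2, .x, .x, .x])})
      (word [.x, .x, .x, .tsub 1, .tsub 2], word [.tsub 1, .tsub 2, .x, .x, .x]) := by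
  intro h
  have hs := h.satisfies (M := FourMonoid) ?_ fun
    | .x => .e
    | .tsub 1 => .t
    | _ => .one
  · rw [lift_word, lift_word] at hs
    exact absurd hs (by decide)
  refine satisfies_of_forall_list ?_
  rintro p q ⟨hpq, hne⟩ φ
  have hpq' := mem_identitySystem.1 hpq
  rcases hpq' with ⟨k, hk, rfl, rfl⟩ | ⟨rfl, rfl⟩ | ⟨rfl, rfl⟩ | ⟨rfl, rfl⟩
  · have := FourMonoid.swap_eq (φ .x) (φ .y) (φ (.xsub 0) * φ (.zsub 1))
      (φ (.zsub 2) * (((ladder 0 k).map φ).prod * φ (.zsub 1))) (φ (.zsub 2) * φ (.xsub k))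
    simpa [chainList_eq, mul_assoc] using this
  · simp only [List.map_cons, List.map_nil, List.prod_cons, List.prod_nil]
    generalize φ .x = a
    generalize φ (.tsub 1) = b
    generalize φ (.tsub 2) = c
    cases a <;> cases b <;> cases c <;> rfl
  · exact absurd rfl hne
  · simp only [List.map_cons, List.map_nil, List.prod_cons, List.prod_nil]
    generalize φ .x = a
    cases a <;> rfl

/-- The other identities preserve the number of occurrences of each letter, so they hold in every
commutative monoid. -/
theorem not_derives_cube_fourth :
    ¬ Derives (identitySystem \ {(word [.x, .x, .x], word [.x, .x, .x, .x])})
      (word [.x, .x, .x], word [.x, .x, .x, .x]) := by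
  intro h
  have hs := h.satisfies (M := Multiplicative ℕ) ?_ fun _ => Multiplicative.ofAdd 1
  · rw [lift_word, lift_word] at hs
    exact absurd hs (by decide)
  refine satisfies_of_forall_list ?_
  rintro p q ⟨hpq, hne⟩ φ
  have hpq' := mem_identitySystem.1 hpq
  refine (List.Perm.map φ (List.perm_iff_count.2 fun c => ?_)).prod_eq
  rcases hpq' with ⟨k, hk, rfl, rfl⟩ | ⟨rfl, rfl⟩ | ⟨rfl, rfl⟩ | ⟨rfl, rfl⟩
  · simp only [chainList_eq, List.count_append, List.count_cons, List.count_nil]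
    omega
  · simp only [List.count_cons, List.count_nil]
    omega
  · simp only [List.count_cons, List.count_nil]
    omega
  · exact absurd rfl hne

theorem isIrredundant_identitySystem : IsIrredundant identitySystem := by
  rintro p (⟨n, hn, rfl⟩ | rfl | rfl | rfl)
  · exact not_derives_chain hn
  · exact not_derives_spreadCube
  · exact not_derives_cube_central
  · exact not_derives_cube_fourth


/-! ### Positions of letters around two occurrences of a block -/

/-- A word of length `N` over `α`, in which no letter occurs more than twice, with two occurrences of
a block of two letters, at the positions `i` and `j`. The letter in position `t` is `L t`, and the
first and last positions of the letter `a` are `f a` and `g a`. The fields `no_p_q_r` say that the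
word has no letters `a, b, …` such that the word obtained by deleting all others except for the
block is `p` followed by the block, `q`, the block and `r`. -/
structure Layout {α : Type*} (L : ℕ → α) (f g : α → ℕ) (N i j : ℕ) : Prop where
  eq_or : ∀ t < N, t = f (L t) ∨ t = g (L t)
  le : ∀ t < N, f (L t) ≤ g (L t)
  L_f : ∀ a, f a < g a → L (f a) = a
  L_g : ∀ a, f a < g a → L (g a) = a
  g_lt : ∀ a, f a < g a → g a < N
  i_lt : i + 2 ≤ j
  j_lt : j + 2 ≤ N
  L_j : L j = L i
  L_j_succ : L (j + 1) = L (i + 1)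
  f_i : f (L i) = i
  g_i : g (L i) = j
  f_i_succ : f (L (i + 1)) = i + 1
  g_i_succ : g (L (i + 1)) = j + 1
  no__t_ : ∀ t, ¬ (f t = g t ∧ i + 2 ≤ f t ∧ f t < j)
  no_a_bcab_c : ∀ a b c, ¬ (f a < i ∧ i + 2 ≤ f b ∧ f b < f c ∧ f c < g a ∧ g a < g b ∧ g b < j
    ∧ j + 2 ≤ g c)
  no_ab_acbd_cd : ∀ a b c d, ¬ (f a < f b ∧ f b < i ∧ i + 2 ≤ g a ∧ g a < f c ∧ f c < g b ∧
    g b < f d ∧ f d < j ∧ j + 2 ≤ g c ∧ g c < g d)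
  no__abcadbecde_ : ∀ a b c d e, ¬ (i + 2 ≤ f a ∧ f a < f b ∧ f b < f c ∧ f c < g a ∧ g a < f d
    ∧ f d < g b ∧ g b < f e ∧ f e < g c ∧ g c < g d ∧ g d < g e ∧ g e < j)
  no__dcdabcaebe_ : ∀ a b c d e, ¬ (i + 2 ≤ f d ∧ f d < f c ∧ f c < g d ∧ g d < f a ∧ f a < f b
    ∧ f b < g c ∧ g c < g a ∧ g a < f e ∧ f e < g b ∧ g b < g e ∧ g e < j)
  no_d_cdabcaeb_e : ∀ a b c d e, ¬ (f d < i ∧ i + 2 ≤ f c ∧ f c < g d ∧ g d < f a ∧ f a < f b ∧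
    f b < g c ∧ g c < g a ∧ g a < f e ∧ f e < g b ∧ g b < j ∧ j + 2 ≤ g e)
  no__abba_ : ∀ a b, ¬ (i + 2 ≤ f a ∧ f a < f b ∧ f b < g b ∧ g b < g a ∧ g a < j)
  no_at_a_ : ∀ a t, ¬ (f t = g t ∧ f a < f t ∧ f t < i ∧ i + 2 ≤ g a ∧ g a < j)
  no__a_ta : ∀ a t, ¬ (f t = g t ∧ i + 2 ≤ f a ∧ f a < j ∧ j + 2 ≤ f t ∧ f t < g a)
  no_aba_b_ : ∀ a b, ¬ (f a < f b ∧ f b < g a ∧ g a < i ∧ i + 2 ≤ g b ∧ g b < j)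
  no__b_aba : ∀ a b, ¬ (i + 2 ≤ f b ∧ f b < j ∧ j + 2 ≤ f a ∧ f a < g b ∧ g b < g a)
  no_ab_a_b : ∀ a b, ¬ (f a < f b ∧ f b < i ∧ i + 2 ≤ g a ∧ g a < j ∧ j + 2 ≤ g b)
  no_b_a_ba : ∀ a b, ¬ (f b < i ∧ i + 2 ≤ f a ∧ f a < j ∧ j + 2 ≤ g b ∧ g b < g a)
  no_abb_a_ : ∀ a b, ¬ (f a < f b ∧ f b < g b ∧ g b < i ∧ i + 2 ≤ g a ∧ g a < j)
  no__a_bba : ∀ a b, ¬ (i + 2 ≤ f a ∧ f a < j ∧ j + 2 ≤ f b ∧ f b < g b ∧ g b < g a)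
  no_ab_ba_ : ∀ a b, ¬ (f a < f b ∧ f b < i ∧ i + 2 ≤ g b ∧ g b < g a ∧ g a < j)
  no__ab_ba : ∀ a b, ¬ (i + 2 ≤ f a ∧ f a < f b ∧ f b < j ∧ j + 2 ≤ g b ∧ g b < g a)
  no_ab_acbc_ : ∀ a b c, ¬ (f a < f b ∧ f b < i ∧ i + 2 ≤ g a ∧ g a < f c ∧ f c < g b ∧
    g b < g c ∧ g c < j)
  no__cbca_ba : ∀ a b c, ¬ (i + 2 ≤ f c ∧ f c < f b ∧ f b < g c ∧ g c < f a ∧ f a < j ∧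
    j + 2 ≤ g b ∧ g b < g a)
  no_a_bcbac_ : ∀ a b c, ¬ (f a < i ∧ i + 2 ≤ f b ∧ f b < f c ∧ f c < g b ∧ g b < g a ∧
    g a < g c ∧ g c < j)
  no__cabcb_a : ∀ a b c, ¬ (i + 2 ≤ f c ∧ f c < f a ∧ f a < f b ∧ f b < g c ∧ g c < g b ∧
    g b < j ∧ j + 2 ≤ g a)
  no_a_bbcac_ : ∀ a b c, ¬ (f a < i ∧ i + 2 ≤ f b ∧ f b < g b ∧ g b < f c ∧ f c < g a ∧
    g a < g c ∧ g c < j)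
  no__cacbb_a : ∀ a b c, ¬ (i + 2 ≤ f c ∧ f c < f a ∧ f a < g c ∧ g c < f b ∧ f b < g b ∧
    g b < j ∧ j + 2 ≤ g a)
  no_a_bbacc_ : ∀ a b c, ¬ (f a < i ∧ i + 2 ≤ f b ∧ f b < g b ∧ g b < g a ∧ g a < f c ∧
    f c < g c ∧ g c < j)
  no__ccabb_a : ∀ a b c, ¬ (i + 2 ≤ f c ∧ f c < g c ∧ g c < f a ∧ f a < f b ∧ f b < g b ∧
    g b < j ∧ j + 2 ≤ g a)
  no_a_bbac_c : ∀ a b c, ¬ (f a < i ∧ i + 2 ≤ f b ∧ f b < g b ∧ g b < g a ∧ g a < f c ∧ f c < j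
    ∧ j + 2 ≤ g c)
  no_c_cabb_a : ∀ a b c, ¬ (f c < i ∧ i + 2 ≤ g c ∧ g c < f a ∧ f a < f b ∧ f b < g b ∧ g b < j
    ∧ j + 2 ≤ g a)
  no_a_bcabdc_d : ∀ a b c d, ¬ (f a < i ∧ i + 2 ≤ f b ∧ f b < f c ∧ f c < g a ∧ g a < g b ∧
    g b < f d ∧ f d < g c ∧ g c < j ∧ j + 2 ≤ g d)
  no_d_cdbacb_a : ∀ a b c d, ¬ (f d < i ∧ i + 2 ≤ f c ∧ f c < g d ∧ g d < f b ∧ f b < f a ∧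
    f a < g c ∧ g c < g b ∧ g b < j ∧ j + 2 ≤ g a)
  no_ab_acbdd_c : ∀ a b c d, ¬ (f a < f b ∧ f b < i ∧ i + 2 ≤ g a ∧ g a < f c ∧ f c < g b ∧
    g b < f d ∧ f d < g d ∧ g d < j ∧ j + 2 ≤ g c)
  no_c_ddbca_ba : ∀ a b c d, ¬ (f c < i ∧ i + 2 ≤ f d ∧ f d < g d ∧ g d < f b ∧ f b < g c ∧
    g c < f a ∧ f a < j ∧ j + 2 ≤ g b ∧ g b < g a)
  no_a_bcabdcd_ : ∀ a b c d, ¬ (f a < i ∧ i + 2 ≤ f b ∧ f b < f c ∧ f c < g a ∧ g a < g b ∧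
    g b < f d ∧ f d < g c ∧ g c < g d ∧ g d < j)
  no__dcdbacb_a : ∀ a b c d, ¬ (i + 2 ≤ f d ∧ f d < f c ∧ f c < g d ∧ g d < f b ∧ f b < f a ∧
    f a < g c ∧ g c < g b ∧ g b < j ∧ j + 2 ≤ g a)
  no_d_cdabcaebe_ : ∀ a b c d e, ¬ (f d < i ∧ i + 2 ≤ f c ∧ f c < g d ∧ g d < f a ∧ f a < f b ∧
    f b < g c ∧ g c < g a ∧ g a < f e ∧ f e < g b ∧ g b < g e ∧ g e < j)
  no__ebeacbadc_d : ∀ a b c d e, ¬ (i + 2 ≤ f e ∧ f e < f b ∧ f b < g e ∧ g e < f a ∧ f a < f c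
    ∧ f c < g b ∧ g b < g a ∧ g a < f d ∧ f d < g c ∧ g c < j ∧ j + 2 ≤ g d)

/-! ### Reversal of layouts and the cuts around the blocks -/

namespace Layout

variable {α : Type*} {L : ℕ → α} {f g : α → ℕ} {N i j : ℕ}

/-- The layout of the reversed word. -/
theorem reverse (S : Layout L f g N i j) : Layout (fun t => L (N - 1 - t)) (fun a => N - 1 - g a)
    (fun a => N - 1 - f a) N (N - 2 - j) (N - 2 - i) where
  eq_or t ht := by
    have := S.eq_or (N - 1 - t) (by omega)
    omega
  le t ht := by
    have := S.le (N - 1 - t) (by omega)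
    omega
  L_f a h := by
    have := S.g_lt a (by omega)
    rw [show N - 1 - (N - 1 - g a) = g a by omega]
    exact S.L_g a (by omega)
  L_g a h := by
    have := S.g_lt a (by omega)
    rw [show N - 1 - (N - 1 - f a) = f a by omega]
    exact S.L_f a (by omega)
  g_lt a h := by omega
  i_lt := by have := S.i_lt; have := S.j_lt; omega
  j_lt := by have := S.i_lt; have := S.j_lt; omega
  L_j := by
    have := S.i_lt; have := S.j_lt
    rw [show N - 1 - (N - 2 - i) = i + 1 by omega, show N - 1 - (N - 2 - j) = j + 1 by omega,
      S.L_j_succ]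
  L_j_succ := by
    have := S.i_lt; have := S.j_lt
    rw [show N - 1 - (N - 2 - i + 1) = i by omega, show N - 1 - (N - 2 - j + 1) = j by omega,
      S.L_j]
  f_i := by
    have := S.i_lt; have := S.j_lt
    rw [show N - 1 - (N - 2 - j) = j + 1 by omega, S.L_j_succ, S.g_i_succ]
    omega
  g_i := by
    have := S.i_lt; have := S.j_lt
    rw [show N - 1 - (N - 2 - j) = j + 1 by omega, S.L_j_succ, S.f_i_succ]
    omega
  f_i_succ := by
    have := S.i_lt; have := S.j_lt
    rw [show N - 1 - (N - 2 - j + 1) = j by omega, S.L_j, S.g_i]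
    omega
  g_i_succ := by
    have := S.i_lt; have := S.j_lt
    rw [show N - 1 - (N - 2 - j + 1) = j by omega, S.L_j, S.f_i]
    omega
  no__t_ t := by
    have := S.no__t_ t
    have := S.g_lt t
    omega
  no_a_bcab_c a b c := by
    -- A self-dual pattern is its own reverse after renaming; the others are exchanged with their
    -- mirror images. The bounds `g_lt` keep the truncated subtractions exact.
    have := S.no_a_bcab_c c b a
    have := S.g_lt a
    have := S.g_lt b
    have := S.g_lt c
    omega
  no_ab_acbd_cd a b c d := by
    have := S.no_ab_acbd_cd d c b a
    have := S.g_lt a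
    have := S.g_lt b
    have := S.g_lt c
    have := S.g_lt d
    omega
  no__abcadbecde_ a b c d e := by
    have := S.no__abcadbecde_ e d c b a
    have := S.g_lt a
    have := S.g_lt b
    have := S.g_lt c
    have := S.g_lt d
    have := S.g_lt e
    omega
  no__dcdabcaebe_ a b c d e := by
    have := S.no__dcdabcaebe_ a c b e d
    have := S.g_lt a
    have := S.g_lt b
    have := S.g_lt c
    have := S.g_lt d
    have := S.g_lt e
    omega
  no_d_cdabcaeb_e a b c d e := by
    have := S.no_d_cdabcaeb_e a c b e d
    have := S.g_lt a
    have := S.g_lt b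
    have := S.g_lt c
    have := S.g_lt d
    have := S.g_lt e
    omega
  no__abba_ a b := by
    have := S.no__abba_ a b
    have := S.g_lt a
    have := S.g_lt b
    omega
  no_at_a_ a t := by
    have := S.no__a_ta a t
    have := S.g_lt a
    have := S.g_lt t
    omega
  no__a_ta a t := by
    have := S.no_at_a_ a t
    have := S.g_lt a
    have := S.g_lt t
    omega
  no_aba_b_ a b := by
    have := S.no__b_aba a b
    have := S.g_lt a
    have := S.g_lt b
    omega
  no__b_aba a b := by
    have := S.no_aba_b_ a b
    have := S.g_lt a
    have := S.g_lt b
    omega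
  no_ab_a_b a b := by
    have := S.no_b_a_ba a b
    have := S.g_lt a
    have := S.g_lt b
    omega
  no_b_a_ba a b := by
    have := S.no_ab_a_b a b
    have := S.g_lt a
    have := S.g_lt b
    omega
  no_abb_a_ a b := by
    have := S.no__a_bba a b
    have := S.g_lt a
    have := S.g_lt b
    omega
  no__a_bba a b := by
    have := S.no_abb_a_ a b
    have := S.g_lt a
    have := S.g_lt b
    omega
  no_ab_ba_ a b := by
    have := S.no__ab_ba a b
    have := S.g_lt a
    have := S.g_lt b
    omega
  no__ab_ba a b := by
    have := S.no_ab_ba_ a b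
    have := S.g_lt a
    have := S.g_lt b
    omega
  no_ab_acbc_ a b c := by
    have := S.no__cbca_ba a b c
    have := S.g_lt a
    have := S.g_lt b
    have := S.g_lt c
    omega
  no__cbca_ba a b c := by
    have := S.no_ab_acbc_ a b c
    have := S.g_lt a
    have := S.g_lt b
    have := S.g_lt c
    omega
  no_a_bcbac_ a b c := by
    have := S.no__cabcb_a a b c
    have := S.g_lt a
    have := S.g_lt b
    have := S.g_lt c
    omega
  no__cabcb_a a b c := by
    have := S.no_a_bcbac_ a b c
    have := S.g_lt a
    have := S.g_lt b
    have := S.g_lt c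
    omega
  no_a_bbcac_ a b c := by
    have := S.no__cacbb_a a b c
    have := S.g_lt a
    have := S.g_lt b
    have := S.g_lt c
    omega
  no__cacbb_a a b c := by
    have := S.no_a_bbcac_ a b c
    have := S.g_lt a
    have := S.g_lt b
    have := S.g_lt c
    omega
  no_a_bbacc_ a b c := by
    have := S.no__ccabb_a a b c
    have := S.g_lt a
    have := S.g_lt b
    have := S.g_lt c
    omega
  no__ccabb_a a b c := by
    have := S.no_a_bbacc_ a b c
    have := S.g_lt a
    have := S.g_lt b
    have := S.g_lt c
    omega
  no_a_bbac_c a b c := by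
    have := S.no_c_cabb_a a b c
    have := S.g_lt a
    have := S.g_lt b
    have := S.g_lt c
    omega
  no_c_cabb_a a b c := by
    have := S.no_a_bbac_c a b c
    have := S.g_lt a
    have := S.g_lt b
    have := S.g_lt c
    omega
  no_a_bcabdc_d a b c d := by
    have := S.no_d_cdbacb_a a b c d
    have := S.g_lt a
    have := S.g_lt b
    have := S.g_lt c
    have := S.g_lt d
    omega
  no_d_cdbacb_a a b c d := by
    have := S.no_a_bcabdc_d a b c d
    have := S.g_lt a
    have := S.g_lt b
    have := S.g_lt c
    have := S.g_lt d
    omega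
  no_ab_acbdd_c a b c d := by
    have := S.no_c_ddbca_ba a b c d
    have := S.g_lt a
    have := S.g_lt b
    have := S.g_lt c
    have := S.g_lt d
    omega
  no_c_ddbca_ba a b c d := by
    have := S.no_ab_acbdd_c a b c d
    have := S.g_lt a
    have := S.g_lt b
    have := S.g_lt c
    have := S.g_lt d
    omega
  no_a_bcabdcd_ a b c d := by
    have := S.no__dcdbacb_a a b c d
    have := S.g_lt a
    have := S.g_lt b
    have := S.g_lt c
    have := S.g_lt d
    omega
  no__dcdbacb_a a b c d := by
    have := S.no_a_bcabdcd_ a b c d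
    have := S.g_lt a
    have := S.g_lt b
    have := S.g_lt c
    have := S.g_lt d
    omega
  no_d_cdabcaebe_ a b c d e := by
    have := S.no__ebeacbadc_d a b c d e
    have := S.g_lt a
    have := S.g_lt b
    have := S.g_lt c
    have := S.g_lt d
    have := S.g_lt e
    omega
  no__ebeacbadc_d a b c d e := by
    have := S.no_d_cdabcaebe_ a b c d e
    have := S.g_lt a
    have := S.g_lt b
    have := S.g_lt c
    have := S.g_lt d
    have := S.g_lt e
    omega

theorem ne {a b : α} (S : Layout L f g N i j) (ha : f a < g a) (hb : f b < g b) (hab : a ≠ b) :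
    f a ≠ f b ∧ g a ≠ g b ∧ f a ≠ g b ∧ g a ≠ f b := by
  refine ⟨fun h => hab ?_, fun h => hab ?_, fun h => hab ?_, fun h => hab ?_⟩
  · rw [← S.L_f a ha, ← S.L_f b hb, h]
  · rw [← S.L_g a ha, ← S.L_g b hb, h]
  · rw [← S.L_f a ha, ← S.L_g b hb, h]
  · rw [← S.L_g a ha, ← S.L_f b hb, h]

/-- A letter of the word between the blocks occurs twice, and is not a letter of the blocks. -/
theorem mid (S : Layout L f g N i j) {t : ℕ} (h1 : i + 2 ≤ t) (h2 : t < j) :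
    f (L t) < g (L t) ∧ (t = f (L t) ∨ t = g (L t)) ∧ (f (L t) < i ∨ i + 2 ≤ f (L t)) ∧
      (g (L t) < j ∨ j + 2 ≤ g (L t)) := by
  have hj := S.j_lt
  have h0 := S.eq_or t (by omega)
  have hle := S.le t (by omega)
  have hlin := S.no__t_ (L t)
  have hlt : f (L t) < g (L t) := by omega
  have hf := S.L_f _ hlt
  have hg := S.L_g _ hlt
  refine ⟨hlt, h0, ?_, ?_⟩
  · by_contra hc
    have : f (L t) = i ∨ f (L t) = i + 1 := by omega
    rcases this with h | h
    · have e := S.f_i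
      have e' := S.g_i
      rw [← h, hf] at e e'
      omega
    · have e := S.f_i_succ
      have e' := S.g_i_succ
      rw [← h, hf] at e e'
      omega
  · by_contra hc
    have : g (L t) = j ∨ g (L t) = j + 1 := by omega
    rcases this with h | h
    · have e := S.f_i
      have e' := S.g_i
      rw [← S.L_j, ← h, hg] at e e'
      omega
    · have e := S.f_i_succ
      have e' := S.g_i_succ
      rw [← S.L_j_succ, ← h, hg] at e e'
      omega

theorem exists_run_left (P : ℕ → Prop) (n : ℕ) :
    ∃ k ≤ n, (∀ t, k ≤ t → t < n → P t) ∧ (k = 0 ∨ ¬ P (k - 1)) := by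
  induction n with
  | zero => exact ⟨0, le_rfl, fun t h1 h2 => by omega, Or.inl rfl⟩
  | succ n ih =>
    by_cases h : P n
    · obtain ⟨k, hk, hP, h0⟩ := ih
      refine ⟨k, by omega, fun t h1 h2 => ?_, h0⟩
      rcases Nat.lt_succ_iff_lt_or_eq.1 h2 with h' | rfl
      · exact hP t h1 h'
      · exact h
    · exact ⟨n + 1, le_rfl, fun t h1 h2 => by omega, Or.inr h⟩

theorem exists_run_right (P : ℕ → Prop) {k n : ℕ} (hk : k ≤ n) :
    ∃ l, k ≤ l ∧ l ≤ n ∧ (∀ t, k ≤ t → t < l → P t) ∧ (l = n ∨ ¬ P l) := by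
  obtain ⟨d, rfl⟩ := Nat.exists_eq_add_of_le hk
  clear hk
  induction d generalizing k with
  | zero => exact ⟨k, le_rfl, le_rfl, fun t h1 h2 => by omega, Or.inl rfl⟩
  | succ d ih =>
    by_cases h : P k
    · obtain ⟨l, h1, h2, h3, h4⟩ := ih (k := k + 1)
      refine ⟨l, by omega, by omega, fun t h5 h6 => ?_, ?_⟩
      · rcases Nat.eq_or_lt_of_le h5 with rfl | h'
        · exact h
        · exact h3 t h' h6
      · rwa [show k + (d + 1) = k + 1 + d by omega]
    · exact ⟨k, le_rfl, by omega, fun t h1 h2 => by omega, Or.inr h⟩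

/-- Cut off, from the left part, the letters that occur once there and once between the blocks, and
from these the longest word that is repeated at the end of the middle part. -/
theorem exists_left_cut (S : Layout L f g N i j) : ∃ α β δ : ℕ, α ≤ β ∧ β ≤ i ∧ i + 2 ≤ δ ∧ δ ≤ j ∧
    (∀ t, α ≤ t → t < i → t = f (L t) ∧ i + 2 ≤ g (L t) ∧ g (L t) < j) ∧
    (∀ a, f a < i → i + 2 ≤ g a → g a < j → α ≤ f a ∧ (β ≤ f a ↔ δ ≤ g a)) ∧
    (∀ t, δ ≤ t → t < j → t = g (L t) ∧ f (L t) < i) ∧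
    (i + 2 < δ → i + 2 ≤ f (L (δ - 1))) := by
  have hij := S.i_lt
  have hjN := S.j_lt
  -- α starts the longest run, ending at the first block, of letters that occur once on the left and
  -- once in the middle. δ starts the longest run, ending at the second block, of last occurrences
  -- of left letters. β starts the run of letters before the first block that return at or after δ.
  obtain ⟨α, hα, hα1, hα2⟩ :=
    exists_run_left (fun t => t = f (L t) ∧ i + 2 ≤ g (L t) ∧ g (L t) < j) i
  obtain ⟨δ, hδ, hδ1, hδ2⟩ :=
    exists_run_left (fun t => i + 2 ≤ t ∧ t = g (L t) ∧ f (L t) < i) j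
  obtain ⟨β, hβ, hβ1, hβ2⟩ := exists_run_left (fun t => α ≤ t ∧ δ ≤ g (L t)) i
  -- If such a letter a starts before α, the letter b at α - 1 stands between a and the block. Then
  -- b is single, or occurs twice on the left, or returns after the second block; each case is a
  -- forbidden pattern.
  have hαf : ∀ a, f a < i → i + 2 ≤ g a → g a < j → α ≤ f a := by
    intro a h1 h2 h3
    by_contra hlt
    have hne : ¬ (α - 1 = f (L (α - 1)) ∧ i + 2 ≤ g (L (α - 1)) ∧ g (L (α - 1)) < j) :=
      hα2.resolve_left (by omega)
    have hLa := S.L_f a (by omega)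
    have hab : a ≠ L (α - 1) := by
      intro hab
      have := S.eq_or (α - 1) (by omega)
      rw [← hab] at this hne
      omega
    have hb0 := S.eq_or (α - 1) (by omega)
    have hb1 := S.le (α - 1) (by omega)
    have hfa : f a ≠ α - 1 := fun h => hab (by rw [← h, hLa])
    generalize L (α - 1) = b at *
    by_cases hlin : f b = g b
    · have := S.no_at_a_ a b
      omega
    have hne' := S.ne (a := a) (b := b) (by omega) (by omega) hab
    have hbg := S.L_g b (by omega)
    have hgb : ¬ (g b = i ∨ g b = i + 1 ∨ g b = j ∨ g b = j + 1) := by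
      rintro (h | h | h | h)
      · have := S.f_i
        have := S.g_i
        rw [← h, hbg] at this
        omega
      · have := S.g_i_succ
        rw [← h, hbg] at this
        omega
      · have e := S.f_i
        rw [← S.L_j, ← h, hbg] at e
        have := S.g_i
        omega
      · have e := S.f_i_succ
        rw [← S.L_j_succ, ← h, hbg] at e
        omega
    have p1 := S.no_aba_b_ b a
    have p2 := S.no_abb_a_ a b
    have p3 := S.no_ab_a_b a b
    omega
  have hδi : i + 2 ≤ δ := by
    rcases Nat.lt_or_ge δ j with h | h
    · exact (hδ1 δ le_rfl h).1
    · omega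
  have hαβ : α ≤ β := by
    rcases Nat.lt_or_ge β i with h | h
    · exact (hβ1 β le_rfl h).1
    · omega
  refine ⟨α, β, δ, hαβ, hβ, hδi, hδ, hα1, fun a h1 h2 h3 => ⟨hαf a h1 h2 h3, ?_, ?_⟩,
    fun t h1 h2 => (hδ1 t h1 h2).2, ?_⟩
  · intro h
    have := (hβ1 (f a) h h1).2
    rwa [S.L_f a (by omega)] at this
  · intro h
    -- The letter at β - 1 returns before δ although a, which stands before it, returns after δ:
    -- this is the pattern ab|ba|.
    by_contra hlt
    have hαa := hαf a h1 h2 h3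
    have hne : ¬ (α ≤ β - 1 ∧ δ ≤ g (L (β - 1))) := hβ2.resolve_left (by omega)
    have hb := hα1 (β - 1) (by omega) (by omega)
    by_cases hab : a = L (β - 1)
    · rw [← hab] at hne
      omega
    have := S.ne (a := a) (b := L (β - 1)) (by omega) (by omega) hab
    have := S.no_ab_ba_ a (L (β - 1))
    omega
  · intro h
    have hne := hδ2.resolve_left (by omega)
    have hm := S.mid (t := δ - 1) (by omega) (by omega)
    omega

end Layout


/-- A layout in which the left part has been cut at `A` and `B`, the middle part at `C` and `D`, and
the right part at `E` and `F`. The word from `B` to `i` reappears from `D` to `j`, and the word from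
`i + 2` to `C` reappears from `j + 2` to `E`. -/
structure Frame {α : Type*} (L : ℕ → α) (f g : α → ℕ) (N i j A B C D E F : ℕ) : Prop
    extends Layout L f g N i j where
  A_le : A ≤ B
  B_le : B ≤ i
  le_C : i + 2 ≤ C
  C_le : C ≤ D
  D_le : D ≤ j
  le_E : j + 2 ≤ E
  E_le : E ≤ F
  F_le : F ≤ N
  left : ∀ t, A ≤ t → t < i → t = f (L t) ∧ i + 2 ≤ g (L t) ∧ g (L t) < j
  left_mem : ∀ a, f a < i → i + 2 ≤ g a → g a < j → A ≤ f a ∧ (B ≤ f a ↔ D ≤ g a)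
  mid_right : ∀ t, D ≤ t → t < j → t = g (L t) ∧ f (L t) < i
  left_end : i + 2 < D → i + 2 ≤ f (L (D - 1))
  right : ∀ t, j + 2 ≤ t → t < F → t = g (L t) ∧ i + 2 ≤ f (L t) ∧ f (L t) < j
  right_mem : ∀ a, i + 2 ≤ f a → f a < j → j + 2 ≤ g a → g a < F ∧ (g a < E ↔ f a < C)
  mid_left : ∀ t, i + 2 ≤ t → t < C → t = f (L t) ∧ j + 2 ≤ g (L t)
  right_start : C < j → g (L C) < j

/-- The left cut is made in the word and in its reverse. Letter positions reverse as t ↦ N - 1 - t,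
cut points between letters as t ↦ N - t. -/
theorem Layout.exists_frame {α : Type*} {L : ℕ → α} {f g : α → ℕ} {N i j : ℕ}
    (S : Layout L f g N i j) : ∃ A B C D E F, Frame L f g N i j A B C D E F := by
  have hij := S.i_lt
  have hjN := S.j_lt
  obtain ⟨A, B, D, h1, h2, h3, h4, h5, h6, h7, h8⟩ := S.exists_left_cut
  obtain ⟨A', B', D', r1, r2, r3, r4, r5, r6, r7, r8⟩ := S.reverse.exists_left_cut
  have hright : ∀ t, j + 2 ≤ t → t < N - A' → t = g (L t) ∧ i + 2 ≤ f (L t) ∧ f (L t) < j := by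
    intro t ht1 ht2
    have := r5 (N - 1 - t) (by omega) (by omega)
    rw [show N - 1 - (N - 1 - t) = t by omega] at this
    have := S.eq_or t (by omega)
    omega
  have hml : ∀ t, i + 2 ≤ t → t < N - D' → t = f (L t) ∧ j + 2 ≤ g (L t) := by
    intro t ht1 ht2
    have := r7 (N - 1 - t) (by omega) (by omega)
    rw [show N - 1 - (N - 1 - t) = t by omega] at this
    have := S.mid (t := t) ht1 (by omega)
    omega
  refine ⟨A, B, N - D', D, N - B', N - A', S, h1, h2, by omega, ?_, h4, by omega, by omega,
    by omega, h5, h6, h7, h8, hright, ?_, hml, ?_⟩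
  -- If the cuts crossed, the letter at D would have a last occurrence starting on the left and also
  -- a first occurrence there.
  · by_contra hlt
    have e1 := h7 D le_rfl (by omega)
    have e2 := hml D (by omega) (by omega)
    omega
  · intro a a1 a2 a3
    have := S.g_lt a (by omega)
    have := r6 a (by omega) (by omega) (by omega)
    omega
  · intro h
    have hm := S.mid (t := N - D') (by omega) h
    have := r8 (by omega)
    rw [show N - 1 - (D' - 1) = N - D' by omega] at this
    omega

/-! ### The queue discipline of the reduced middle part -/

namespace Frame

variable {α : Type*} {L : ℕ → α} {f g : α → ℕ} {N i j A B C D E F : ℕ}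

/-- The run of returning left letters stops at D because the letter at D - 1 has its first
occurrence in the middle. This letter prevents a left letter that returns earlier from belonging to
the run, and it completes forbidden patterns. -/
theorem exists_obstacle_left (S : Frame L f g N i j A B C D E F) {a : α} (h1 : f a < i)
    (h2 : i + 2 ≤ g a) (h3 : g a < D) : ∃ b, f b < g b ∧ i + 2 ≤ f b ∧
      ((g a < f b ∧ f b < j) ∨ (g a < g b ∧ g b < j)) := by
  have hD := S.D_le
  have hb := S.left_end (by omega)
  have hm := S.mid (t := D - 1) (by omega) (by omega)
  have hab : a ≠ L (D - 1) := by
    intro h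
    rw [← h] at hb
    omega
  have := S.ne (a := a) (by omega) hm.1 hab
  exact ⟨L (D - 1), hm.1, hb, by omega⟩

theorem exists_obstacle_right (S : Frame L f g N i j A B C D E F) {a : α} (h1 : C ≤ f a)
    (h2 : f a < j) (h3 : j + 2 ≤ g a) : ∃ b, f b < g b ∧ g b < j ∧
      ((g b < f a ∧ i + 2 ≤ g b) ∨ (f b < f a ∧ i + 2 ≤ f b)) := by
  have hC := S.le_C
  have hb := S.right_start (by omega)
  have hm := S.mid (t := C) (by omega) (by omega)
  have hab : a ≠ L C := by
    intro h
    rw [← h] at hb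
    omega
  have := S.ne (a := a) (by omega) hm.1 hab
  exact ⟨L C, hm.1, hb, by omega⟩

/-- The letters of the reduced middle part, from `C` to `D`. -/
def Core (f g : α → ℕ) (i j C D : ℕ) (a : α) : Prop :=
  f a < g a ∧ ((f a < i ∧ C ≤ g a ∧ g a < D) ∨ (C ≤ f a ∧ g a < D) ∨
    (C ≤ f a ∧ f a < D ∧ j + 2 ≤ g a))

/-- Letters with an occurrence in one of the trimmed segments have their other occurrence outside
the middle part, so they cannot appear between C and D. -/
theorem core_of_mem (S : Frame L f g N i j A B C D E F) {t : ℕ} (h1 : C ≤ t) (h2 : t < D) :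
    Core f g i j C D (L t) ∧ (t = f (L t) ∨ t = g (L t)) := by
  have hC := S.le_C
  have hD := S.D_le
  have hm := S.mid (t := t) (by omega) (by omega)
  refine ⟨⟨hm.1, ?_⟩, hm.2.1⟩
  have hf : i + 2 ≤ f (L t) → f (L t) < C → j + 2 ≤ g (L t) := by
    intro h3 h4
    have := (S.mid_left _ h3 h4).2
    rwa [S.L_f _ hm.1] at this
  have hg : D ≤ g (L t) → g (L t) < j → f (L t) < i := by
    intro h3 h4
    have := (S.mid_right _ h3 h4).2
    rwa [S.L_g _ hm.1] at this
  have hg' : g (L t) < C → i + 2 ≤ g (L t) → g (L t) = f (L t) := by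
    intro h3 h4
    have := (S.mid_left _ h4 h3).1
    rwa [S.L_g _ hm.1] at this
  have hf' : D ≤ f (L t) → f (L t) < j → f (L t) = g (L t) := by
    intro h3 h4
    have := (S.mid_right _ h3 h4).1
    rwa [S.L_f _ hm.1] at this
  omega

/-- The first occurrences of the core letters are in the same order as the last occurrences. -/
theorem lt_of_lt (S : Frame L f g N i j A B C D E F) {a b : α} (ha : Core f g i j C D a)
    (hb : Core f g i j C D b) (h : f a < f b) : g a < g b := by
  have hC := S.le_C
  have hCD := S.C_le
  have hD := S.D_le
  obtain ⟨ha0, ha⟩ := ha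
  obtain ⟨hb0, hb⟩ := hb
  have hab : a ≠ b := by
    rintro rfl
    omega
  by_contra hlt
  have hlt : g b < g a := by
    have := S.ne ha0 hb0 hab
    omega
  -- A nested pair whose two first occurrences lie on the same side of the first block, and whose
  -- last ones lie on the same side of the second, is itself forbidden. If the first block separates
  -- a from b, an obstacle letter c is needed; the patterns then depend on its place relative to a
  -- and b.
  by_cases hL : f a < i ∧ i + 2 ≤ f b
  · obtain ⟨c, hc0, hc1, hc2⟩ := S.exists_obstacle_left hL.1 (by omega) (by omega)
    have hac : a ≠ c := by
      rintro rfl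
      omega
    have hbc : b ≠ c := by
      rintro rfl
      omega
    by_cases hcj : g c < j
    · by_cases h1 : g a < f c
      · have := S.no_a_bbacc_ a b c
        omega
      · have q1 := (S.ne ha0 hc0 hac).2.2.2
        have q2 := S.ne hb0 hc0 hbc
        by_cases h2 : f c < f b
        · have := S.no__abba_ c b
          omega
        · by_cases h3 : f c < g b
          · have := S.no_a_bcbac_ a b c
            omega
          · have := S.no_a_bbcac_ a b c
            omega
    · have := S.mid (t := f c) (by omega) (by omega)
      rw [S.L_f c hc0] at this
      have := S.no_a_bbac_c a b c
      omega
  · by_cases hR : j + 2 ≤ g a ∧ g b < j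
    · obtain ⟨c, hc0, hc1, hc2⟩ := S.exists_obstacle_right (a := a) (by omega) (by omega) hR.1
      have hac : a ≠ c := by
        rintro rfl
        omega
      have hbc : b ≠ c := by
        rintro rfl
        omega
      by_cases hci : i + 2 ≤ f c
      · by_cases h1 : g c < f a
        · have := S.no__ccabb_a a b c
          omega
        · have q1 := (S.ne ha0 hc0 hac).2.2.1
          have q2 := S.ne hb0 hc0 hbc
          by_cases h2 : g b < g c
          · have := S.no__abba_ c b
            omega
          · by_cases h3 : f b < g c
            · have := S.no__cabcb_a a b c
              omega
            · have := S.no__cacbb_a a b c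
              omega
      · have := S.mid (t := g c) (by omega) (by omega)
        rw [S.L_g c hc0] at this
        have := S.no_c_cabb_a a b c
        omega
    · have p1 := S.no_ab_ba_ a b
      have p2 := S.no__ab_ba a b
      have p3 := S.no__abba_ a b
      omega

theorem lt_iff_lt (S : Frame L f g N i j A B C D E F) {a b : α} (ha : Core f g i j C D a)
    (hb : Core f g i j C D b) : f a < f b ↔ g a < g b := by
  refine ⟨S.lt_of_lt ha hb, fun h => ?_⟩
  by_contra hlt
  have hab : a ≠ b := by
    rintro rfl
    omega
  have := S.ne ha.1 hb.1 hab
  have := S.lt_of_lt hb ha (by omega)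
  omega

/-! ### Configurations that cannot occur -/

/-- A waiting letter `b` is not separated from later letters by the end of the middle part. -/
theorem no_split_end (S : Frame L f g N i j A B C D E F) {b c e : α} (hb : Core f g i j C D b)
    (hc : Core f g i j C D c) (he : Core f g i j C D e) (h1 : f b < g e) (h2 : g e < f c)
    (h3 : j + 2 ≤ g b) : False := by
  have hC := S.le_C
  have hCD := S.C_le
  have hD := S.D_le
  have hbc := S.lt_iff_lt hb hc
  have heb := S.lt_iff_lt he hb
  obtain ⟨hb0, hb⟩ := hb
  obtain ⟨hc0, hc⟩ := hc
  obtain ⟨he0, he⟩ := he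
  have p1 := S.no__cbca_ba c b e
  -- If e is pushed in the middle, e, b, c already form |ebec|bc. If e comes from the left, b needs
  -- an obstacle on the right.
  by_cases hei : f e < i
  · obtain ⟨d, hd0, hd1, hd2⟩ := S.exists_obstacle_right (a := b) (by omega) (by omega) h3
    have hdb : d ≠ b := by
      rintro rfl
      omega
    have hde : d ≠ e := by
      rintro rfl
      omega
    have hdc : d ≠ c := by
      rintro rfl
      omega
    have q1 := S.ne hd0 hb0 hdb
    have q2 := S.ne hd0 he0 hde
    have q3 := S.ne hd0 hc0 hdc
    by_cases hg : g d < f b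
    · have hm := S.mid (t := g d) (by omega) (by omega)
      rw [S.L_g d hd0] at hm
      have p2 := S.no_ab_ba_ e d
      have p3 := S.no_ab_acbd_cd d e b c
      have p4 := S.no_c_ddbca_ba c b e d
      omega
    · have p5 := S.no__cbca_ba c b d
      have p6 := S.no_a_bcab_c e d b
      omega
  · omega

/-- The letters `a` and `b` of a layer are not separated when they reappear. -/
theorem no_split_layer (S : Frame L f g N i j A B C D E F) {a b c d e : α}
    (ha : Core f g i j C D a) (hb : Core f g i j C D b) (hc : Core f g i j C D c)
    (hd : Core f g i j C D d) (he : Core f g i j C D e) (h1 : f b < g e) (h2 : g e < f c)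
    (h3 : f c < g a) (h4 : g a < f d) (h5 : f d < g b) : False := by
  have hC := S.le_C
  have hCD := S.C_le
  have hD := S.D_le
  have hab := S.lt_iff_lt ha hb
  have hea := S.lt_iff_lt he ha
  have hbc := S.lt_iff_lt hb hc
  have hcd := S.lt_iff_lt hc hd
  obtain ⟨ha0, ha⟩ := ha
  obtain ⟨hb0, hb⟩ := hb
  obtain ⟨hc0, hc⟩ := hc
  obtain ⟨hd0, hd⟩ := hd
  obtain ⟨he0, he⟩ := he
  by_cases hei : f e < i
  · by_cases hai : f a < i
    · have p1 := S.no_ab_acbc_ e a c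
      have p2 := S.no_ab_acbd_cd e a c d
      omega
    · have p1 := S.no_a_bcab_c e a b
      have p2 := S.no_a_bcabdcd_ e a b d
      have p3 := S.no_a_bcabdc_d e a b d
      omega
  · by_cases hbj : g b < j
    · by_cases hcj : g c < j
      · have p1 := S.no__abcadbecde_ e a b c d
        have p2 := S.no__dcdbacb_a d c b e
        omega
      · have p1 := S.no__cbca_ba d c a
        omega
    · have p1 := S.no__cbca_ba c b e
      omega

/-- The letters `a` and `b` of the left part are not separated when they reappear. -/
theorem no_split_start (S : Frame L f g N i j A B C D E F) {a b d : α}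
    (ha : Core f g i j C D a) (hb : Core f g i j C D b) (hd : Core f g i j C D d)
    (h1 : f b < i) (h4 : g a < f d) (h5 : f d < g b) : False := by
  have hC := S.le_C
  have hCD := S.C_le
  have hD := S.D_le
  have hab := S.lt_iff_lt ha hb
  have hbd := S.lt_iff_lt hb hd
  obtain ⟨ha0, ha⟩ := ha
  obtain ⟨hb0, hb⟩ := hb
  obtain ⟨hd0, hd⟩ := hd
  -- If d returns in the middle, a, b, d form the pattern ab|acbc|. If d leaves on the right, the
  -- obstacle for the left letter b completes a longer one.
  by_cases hdj : g d < j
  · have p1 := S.no_ab_acbc_ a b d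
    omega
  · obtain ⟨c, hc0, hc1, hc2⟩ := S.exists_obstacle_left h1 (by omega) (by omega)
    have hcb : c ≠ b := by
      rintro rfl
      omega
    have hcd : c ≠ d := by
      rintro rfl
      omega
    have q1 := S.ne hc0 hb0 hcb
    have q2 := S.ne hc0 hd0 hcd
    by_cases hcj : g c < j
    · have p1 := S.no_a_bcab_c b c d
      have p2 := S.no_ab_acbc_ a b c
      have p3 := S.no_ab_acbdd_c a b d c
      by_cases f c < f d <;> omega
    · have hm := S.mid (t := f c) (by omega) (by omega)
      rw [S.L_f c hc0] at hm
      have p1 := S.no__ab_ba d c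
      have p2 := S.no_ab_acbd_cd a b d c
      omega

/-- If `a` waits, `b` and `c` are added to it at once, and `a` and `b` reappear at once, then `c`
reappears with them: here the letters are separated by the borders of the middle part or by the
letters `e` and `d`. -/
theorem no_split_pair (S : Frame L f g N i j A B C D E F) {a b c : α}
    (ha : Core f g i j C D a) (hb : Core f g i j C D b) (hc : Core f g i j C D c)
    (h1 : f b < f c) (h2 : f c < g a) (h3 : g a < g b)
    (hE : (f a < i ∧ i + 2 ≤ f b) ∨ ∃ e, Core f g i j C D e ∧ f a < g e ∧ g e < f b)
    (hD' : (g b < j ∧ j + 2 ≤ g c) ∨ ∃ d, Core f g i j C D d ∧ g b < f d ∧ f d < g c) : False := by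
  have hC := S.le_C
  have hCD := S.C_le
  have hD := S.D_le
  have hab := S.lt_iff_lt ha hb
  obtain ⟨ha0, ha'⟩ := ha
  obtain ⟨hb0, hb'⟩ := hb
  obtain ⟨hc0, hc'⟩ := hc
  by_cases hai : f a < i
  · rcases hE with hE | ⟨e, he, hE⟩
    all_goals rcases hD' with hD' | ⟨d, hd, hD'⟩
    · have p1 := S.no_a_bcab_c a b c
      omega
    · have hcd := S.lt_iff_lt ⟨hc0, hc'⟩ hd
      obtain ⟨hd0, hd⟩ := hd
      have p1 := S.no_a_bcab_c a b c
      have p2 := S.no_a_bcabdcd_ a b c d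
      have p3 := S.no_a_bcabdc_d a b c d
      by_cases g c < j <;> omega
    · obtain ⟨he0, he⟩ := he
      have p1 := S.no_a_bcab_c a b c
      omega
    · have hcd := S.lt_iff_lt ⟨hc0, hc'⟩ hd
      obtain ⟨he0, he⟩ := he
      obtain ⟨hd0, hd⟩ := hd
      have p1 := S.no_a_bcab_c a b c
      have p2 := S.no_a_bcabdcd_ a b c d
      have p3 := S.no_a_bcabdc_d a b c d
      by_cases g c < j <;> omega
  · obtain ⟨e, he, hE⟩ := hE.resolve_left (by omega)
    have hea := S.lt_iff_lt he ⟨ha0, ha'⟩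
    obtain ⟨he0, he⟩ := he
    by_cases hcj : g c < j
    · obtain ⟨d, hd, hD'⟩ := hD'.resolve_left (by omega)
      have hcd := S.lt_iff_lt ⟨hc0, hc'⟩ hd
      obtain ⟨hd0, hd⟩ := hd
      have p1 := S.no__dcdabcaebe_ b c a e d
      have p2 := S.no_d_cdabcaebe_ b c a e d
      have p3 := S.no__ebeacbadc_d b a c d e
      have p4 := S.no_d_cdabcaeb_e b c a e d
      by_cases f e < i <;> by_cases g d < j <;> omega
    · have hbj : g b < j := by
        rcases hD' with hD' | ⟨d, ⟨hd0, hd⟩, hD'⟩ <;> omega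
      have p1 := S.no__dcdbacb_a c b a e
      have p2 := S.no_d_cdbacb_a c b a e
      by_cases f e < i <;> omega

end Frame


/-! ### Segments of a word -/

/-- The letters of the word `L` from position `s` to position `e - 1`. -/
def seg {α : Type*} (L : ℕ → α) (s e : ℕ) : List α := (List.range' s (e - s)).map L

section Seg

variable {α : Type*} {L : ℕ → α}

theorem mem_seg {s e : ℕ} {a : α} : a ∈ seg L s e ↔ ∃ t, s ≤ t ∧ t < e ∧ L t = a := by
  simp only [seg, List.mem_map, List.mem_range'_1]
  exact ⟨fun ⟨t, h, h'⟩ => ⟨t, by omega, by omega, h'⟩, fun ⟨t, h, h', h''⟩ => ⟨t, by omega, h''⟩⟩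

theorem seg_append {s m e : ℕ} (h : s ≤ m) (h' : m ≤ e) : seg L s m ++ seg L m e = seg L s e := by
  have := List.range'_append_1 (s := s) (m := m - s) (n := e - m)
  rw [show s + (m - s) = m by omega, show m - s + (e - m) = e - s by omega] at this
  rw [seg, seg, seg, ← List.map_append, this]

theorem seg_self (s : ℕ) : seg L s s = [] := by
  simp [seg]

theorem pairwise_seg {h : α → ℕ} {s e : ℕ} (hs : ∀ t, s ≤ t → t < e → t = h (L t)) :
    (seg L s e).Pairwise fun a b => h a < h b := by
  rw [seg, List.pairwise_map]
  refine List.Pairwise.imp_of_mem ?_ List.pairwise_lt_range'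
  intro a b ha hb hab
  rw [List.mem_range'_1] at ha hb
  rw [← hs a (by omega) (by omega), ← hs b (by omega) (by omega)]
  exact hab

/-- A strictly increasing list is determined by its members. This turns statements about which
letters are pushed or popped into equalities of blocks. -/
theorem eq_of_pairwise_lt {h : α → ℕ} {l l' : List α} (hl : l.Pairwise fun a b => h a < h b)
    (hl' : l'.Pairwise fun a b => h a < h b) (hmem : ∀ a, a ∈ l ↔ a ∈ l') : l = l' := by
  have : IsTrans α fun a b => h a < h b := ⟨fun _ _ _ => lt_trans⟩
  have : Std.Asymm fun a b : α => h a < h b := ⟨fun _ _ h h' => lt_asymm h h'⟩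
  exact hl.eq_of_mem_iff hl' hmem

end Seg

/-! ### Reading the chain off the queue -/

namespace Frame

variable {α : Type*} {L : ℕ → α} {f g : α → ℕ} {N i j A B C D E F : ℕ}

theorem mem_seg_first (S : Frame L f g N i j A B C D E F) {k l : ℕ} (hk : C ≤ k) (hl : l ≤ D)
    (h : ∀ t, k ≤ t → t < l → t = f (L t)) {a : α} :
    a ∈ seg L k l ↔ Core f g i j C D a ∧ k ≤ f a ∧ f a < l := by
  rw [mem_seg]
  constructor
  · rintro ⟨t, h1, h2, rfl⟩
    have := h t h1 h2
    exact ⟨(S.core_of_mem (by omega) (by omega)).1, by omega, by omega⟩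
  · rintro ⟨h1, h2, h3⟩
    exact ⟨f a, h2, h3, S.L_f a h1.1⟩

theorem mem_seg_last (S : Frame L f g N i j A B C D E F) {k l : ℕ} (hk : C ≤ k) (hl : l ≤ D)
    (h : ∀ t, k ≤ t → t < l → t = g (L t)) {a : α} :
    a ∈ seg L k l ↔ Core f g i j C D a ∧ k ≤ g a ∧ g a < l := by
  rw [mem_seg]
  constructor
  · rintro ⟨t, h1, h2, rfl⟩
    have := h t h1 h2
    exact ⟨(S.core_of_mem (by omega) (by omega)).1, by omega, by omega⟩
  · rintro ⟨h1, h2, h3⟩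
    exact ⟨g a, h2, h3, S.L_g a h1.1⟩

/-- The remainder of the reduced middle part, from position `k`, is a chain: `Q` is the list of the
letters that have occurred once before `k`, in the order of these occurrences. -/
theorem exists_chain_from (S : Frame L f g N i j A B C D E F) {R : List α}
    (hR : R.Pairwise fun a b => f a < f b)
    (hRmem : ∀ a, a ∈ R ↔ Core f g i j C D a ∧ f a < D ∧ D ≤ g a)
    {k : ℕ} (hCk : C ≤ k) (hkD : k ≤ D) {Q : List α} (hQ : Q.Pairwise fun a b => f a < f b)
    (hQmem : ∀ a, a ∈ Q ↔ Core f g i j C D a ∧ f a < k ∧ k ≤ g a)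
    (hstate : k = C ∨ k = D ∨ Q = [] ∨ (k = f (L k) ∧ ∃ e, Core f g i j C D e ∧ g e < k ∧
      ∀ c ∈ Q, f c < g e)) : ∃ n, Chain n Q (seg L k D) R := by
  have hiC := S.le_C
  have hDj := S.D_le
  obtain ⟨d, hd⟩ : ∃ d, d = D - k := ⟨_, rfl⟩
  -- The invariant `hstate`: away from the ends of the segment, a nonempty queue Q is a closed
  -- batch. Some letter e was popped after all of Q had been pushed, and a new push begins at k.
  induction d using Nat.strong_induction_on generalizing k Q with
  | _ d ih =>
  rcases Nat.eq_or_lt_of_le hkD with rfl | hlt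
  · rw [seg_self, eq_of_pairwise_lt hQ hR fun a => (hQmem a).trans (hRmem a).symm]
    exact ⟨0, Chain.nil _⟩
  -- The next maximal run of pushes is [k, k1), and the run of pops after it is [k1, k2).
  obtain ⟨k1, hkk1, hk1D, hpush, hk1⟩ := Layout.exists_run_right (fun t => t = f (L t)) hkD
  obtain ⟨k2, hk12, hk2D, hpop, hk2⟩ := Layout.exists_run_right (fun t => t = g (L t)) hk1D
  have hk1' : k1 < D → k1 < k2 := by
    intro h
    have := (S.core_of_mem (t := k1) (by omega) h).2
    rcases Nat.eq_or_lt_of_le hk12 with rfl | h'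
    · omega
    · exact h'
  have hk2' : k2 < D → k2 = f (L k2) := by
    intro h
    have := (S.core_of_mem (t := k2) (by omega) h).2
    omega
  have hkk2 : k < k2 := by
    rcases Nat.eq_or_lt_of_le hk1D with h | h
    · omega
    · have := hk1' h
      omega
  have memP : ∀ {a}, a ∈ seg L k k1 ↔ Core f g i j C D a ∧ k ≤ f a ∧ f a < k1 :=
    S.mem_seg_first hCk hk1D hpush
  have memT : ∀ {a}, a ∈ seg L k1 k2 ↔ Core f g i j C D a ∧ k1 ≤ g a ∧ g a < k2 :=
    S.mem_seg_last (by omega) hk2D hpop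
  have sortP : (seg L k k1).Pairwise fun a b => f a < f b := pairwise_seg hpush
  have sortT : (seg L k1 k2).Pairwise fun a b => g a < g b := pairwise_seg hpop
  have notpop : ∀ a, Core f g i j C D a → k ≤ g a → k1 ≤ g a := by
    intro a ha h
    by_contra hlt
    have := hpush (g a) h (by omega)
    rw [S.L_g a ha.1] at this
    have := ha.1
    omega
  have notpush : ∀ a, Core f g i j C D a → k1 ≤ f a → k2 ≤ f a := by
    intro a ha h
    by_contra hlt
    have := hpop (f a) h (by omega)
    rw [S.L_f a ha.1] at this
    have := ha.1
    omega
  have sort_g : ∀ {l : List α}, (∀ a ∈ l, Core f g i j C D a) →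
      l.Pairwise (fun a b => f a < f b) → l.Pairwise fun a b => g a < g b :=
    fun hl h => h.imp_of_mem fun ha hb hab => S.lt_of_lt (hl _ ha) (hl _ hb) hab
  have coreP : ∀ a ∈ seg L k k1, Core f g i j C D a := fun a ha => (memP.1 ha).1
  have coreQ : ∀ a ∈ Q, Core f g i j C D a := fun a ha => ((hQmem a).1 ha).1
  have e1 : seg L k D = seg L k k1 ++ (seg L k1 k2 ++ seg L k2 D) := by
    rw [seg_append hk12 hk2D, seg_append hkk1 hk1D]
  -- From an empty queue, the pops remove an initial part [k, k3) of the batch just pushed, because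
  -- the queue is first-in-first-out.
  by_cases hQ0 : Q = []
  · subst hQ0
    have hno : ∀ a, Core f g i j C D a → k ≤ g a → k ≤ f a := by
      intro a ha h
      by_contra hlt
      exact absurd ((hQmem a).2 ⟨ha, by omega, h⟩) (List.not_mem_nil)
    obtain ⟨k3, hkk3, hk3k1, hlow, hk3⟩ :=
      Layout.exists_run_right (fun t => g (L t) < k2) hkk1
    have hhigh : ∀ a, Core f g i j C D a → k3 ≤ f a → f a < k1 → k2 ≤ g a := by
      intro a ha h1 h2
      have hk3' := hk3.resolve_left (by omega)
      have h3 := S.core_of_mem (t := k3) (by omega) (by omega)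
      have h4 := hpush k3 hkk3 (by omega)
      have := S.lt_iff_lt ha h3.1
      by_contra hlt
      omega
    have hlow' : ∀ a, Core f g i j C D a → k ≤ f a → f a < k3 → g a < k2 := by
      intro a ha h1 h2
      have := hlow (f a) h1 h2
      rwa [S.L_f a ha.1] at this
    have memP1 : ∀ {a}, a ∈ seg L k k3 ↔ Core f g i j C D a ∧ k ≤ f a ∧ f a < k3 :=
      S.mem_seg_first hCk (by omega) fun t h1 h2 => hpush t h1 (by omega)
    have memP2 : ∀ {a}, a ∈ seg L k3 k1 ↔ Core f g i j C D a ∧ k3 ≤ f a ∧ f a < k1 :=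
      S.mem_seg_first (by omega) hk1D fun t h1 h2 => hpush t (by omega) h2
    have hT : seg L k k3 = seg L k1 k2 := by
      refine eq_of_pairwise_lt (h := g) (sort_g (fun a ha => (memP1.1 ha).1)
        (pairwise_seg fun t h1 h2 => hpush t h1 (by omega))) sortT fun a => ?_
      rw [memP1, memT]
      constructor
      · rintro ⟨ha, h1, h2⟩
        exact ⟨ha, notpop a ha (by have := ha.1; omega), hlow' a ha h1 h2⟩
      · rintro ⟨ha, h1, h2⟩
        have h3 := hno a ha (by omega)
        refine ⟨ha, h3, ?_⟩
        by_contra hge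
        have := hhigh a ha (by omega) (by
          by_contra h
          have := notpush a ha (by omega)
          have := ha.1
          omega)
        omega
    obtain ⟨n, hn⟩ := ih (D - k2) (by omega) (k := k2) (Q := seg L k3 k1) (by omega) hk2D
      (pairwise_seg fun t h1 h2 => hpush t (by omega) h2) (by
        intro a
        rw [memP2]
        constructor
        · rintro ⟨ha, h1, h2⟩
          exact ⟨ha, by omega, hhigh a ha h1 h2⟩
        · rintro ⟨ha, h1, h2⟩
          have h3 := hno a ha (by omega)
          have h4 : f a < k1 := by
            by_contra h
            have := notpush a ha (by omega)
            omega
          refine ⟨ha, ?_, h4⟩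
          by_contra h
          have := hlow' a ha h3 (by omega)
          omega) (by
        rcases Nat.eq_or_lt_of_le hk2D with h | h
        · exact Or.inr (Or.inl h)
        · refine Or.inr (Or.inr (Or.inr ⟨hk2' h, L (k2 - 1), ?_⟩))
          have h1 : k1 < k2 := hk1' (by omega)
          have h2 := hpop (k2 - 1) (by omega) (by omega)
          refine ⟨(S.core_of_mem (by omega) (by omega)).1, by omega, fun c hc => ?_⟩
          have := memP2.1 hc
          omega) rfl
    refine ⟨n + 1 + 1, ?_⟩
    -- Two chain steps: the batch splits into X₁ = [k, k3), pushed over the empty block X₀, and X₂ =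
    -- [k3, k1), pushed before X₁ is popped.
    have e2 : seg L k D = seg L k k3 ++ ([] ++ (seg L k3 k1 ++ (seg L k k3 ++ seg L k2 D))) := by
      rw [hT, ← List.append_assoc (seg L k3 k1), ← hT, List.nil_append, ← List.append_assoc,
        ← List.append_assoc, seg_append hkk3 hk3k1, hT, List.append_assoc, ← e1]
    rw [e2]
    exact Chain.cons _ (Chain.cons _ hn)
  obtain ⟨a0, ha0⟩ := List.exists_mem_of_ne_nil _ hQ0
  have hstart : k = C → ∀ a ∈ Q, f a < i := by
    intro hkC a ha
    have h := (hQmem a).1 ha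
    have := h.1.2
    omega
  have hD2 : ∀ a, Core f g i j C D a → D ≤ g a → j + 2 ≤ g a := by
    intro a ha h
    have := ha.2
    omega
  -- The whole old queue leaves in this run of pops. A letter b left behind would be split from its
  -- batch: at the start of the segment, at its end, or by a push that follows the pops.
  have hpopped : ∀ b ∈ Q, g b < k2 := by
    intro b hb
    have hb' := (hQmem b).1 hb
    by_contra hge
    have key : k2 < D → ∃ a, Core f g i j C D a ∧ k1 ≤ g a ∧ g a < f (L k2) ∧
        Core f g i j C D (L k2) ∧ f (L k2) < g b := by
      intro h
      have h1 : k1 < k2 := hk1' (by omega)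
      have h2 := hpop k1 le_rfl h1
      have h3 := hk2' h
      have h4 := S.core_of_mem (t := k2) (by omega) h
      have h5 : b ≠ L k2 := by
        rintro rfl
        omega
      have := S.ne hb'.1.1 h4.1.1 h5
      exact ⟨L k1, (S.core_of_mem (by omega) (by omega)).1, by omega, by omega, h4.1, by omega⟩
    by_cases hkC : k = C
    · have hbi := hstart hkC b hb
      have hgb : g b < D := by
        have := hb'.1.2
        omega
      obtain ⟨a, ha, -, h2, h3, h4⟩ := key (by omega)
      exact S.no_split_start ha hb'.1 h3 hbi h2 h4
    · obtain ⟨hkf, e, he, hek, heQ⟩ :=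
        ((hstate.resolve_left hkC).resolve_left (by omega)).resolve_left hQ0
      have hc := (S.core_of_mem hCk hlt).1
      rcases Nat.eq_or_lt_of_le hk2D with h | h
      · exact S.no_split_end hb'.1 hc he (heQ b hb) (by omega) (hD2 b hb'.1 (by omega))
      · obtain ⟨a, ha, h1, h2, h3, h4⟩ := key h
        refine S.no_split_layer ha hb'.1 hc h3 he (heQ b hb) (by omega) ?_ h2 h4
        have : k < k1 := by
          rcases Nat.eq_or_lt_of_le hkk1 with h' | h'
          · have := hk1.resolve_left (by omega)
            rw [← h'] at this
            omega
          · exact h'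
        omega
  -- Of the batch pushed last, the same run of pops removes all or nothing. The separators required
  -- by `no_split_pair` are the blocks xy, or the pop before k and the push at k2.
  have hpair : ∀ b ∈ seg L k k1, g b < k2 → ∀ c ∈ seg L k k1, g c < k2 := by
    intro b hb hbk c hc
    by_contra hge
    obtain ⟨hb1, hb2, hb3⟩ := memP.1 hb
    obtain ⟨hc1, hc2, hc3⟩ := memP.1 hc
    obtain ⟨ha1, ha2, ha3⟩ := (hQmem a0).1 ha0
    have hk1a := notpop a0 ha1 ha3
    refine S.no_split_pair ha1 hb1 hc1 ((S.lt_iff_lt hb1 hc1).2 (by omega)) (by omega)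
      ((S.lt_iff_lt ha1 hb1).1 (by omega)) ?_ ?_
    · by_cases hkC : k = C
      · exact Or.inl ⟨hstart hkC a0 ha0, by omega⟩
      · obtain ⟨hkf, e, he, hek, heQ⟩ :=
          ((hstate.resolve_left hkC).resolve_left (by omega)).resolve_left hQ0
        exact Or.inr ⟨e, he, heQ a0 ha0, by omega⟩
    · rcases Nat.eq_or_lt_of_le hk2D with h | h
      · exact Or.inl ⟨by omega, hD2 c hc1 (by omega)⟩
      · have h3 := hk2' h
        have h4 := S.core_of_mem (t := k2) (by omega) h
        have h5 : c ≠ L k2 := by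
          rintro rfl
          omega
        have := S.ne hc1.1 h4.1.1 h5
        exact Or.inr ⟨L k2, h4.1, by omega, by omega⟩
  have hk12' : k1 < k2 := by
    have := hpopped a0 ha0
    have h := (hQmem a0).1 ha0
    have := notpop a0 h.1 h.2.2
    omega
  -- The last letter popped, at k2 - 1, witnesses that the new queue is a closed batch.
  have hstate2 : ∀ Q' : List α, (∀ c ∈ Q', f c < k1) → (k2 = C ∨ k2 = D ∨ Q' = [] ∨
      (k2 = f (L k2) ∧ ∃ e, Core f g i j C D e ∧ g e < k2 ∧ ∀ c ∈ Q', f c < g e)) := by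
    intro Q' hQ'
    rcases Nat.eq_or_lt_of_le hk2D with h | h
    · exact Or.inr (Or.inl h)
    · refine Or.inr (Or.inr (Or.inr ⟨hk2' h, L (k2 - 1), ?_⟩))
      have h2 := hpop (k2 - 1) (by omega) (by omega)
      refine ⟨(S.core_of_mem (by omega) (by omega)).1, by omega, fun c hc => ?_⟩
      have := hQ' c hc
      omega
  by_cases hex : ∃ b ∈ seg L k k1, g b < k2
  · obtain ⟨b, hb, hbk⟩ := hex
    have hall := hpair b hb hbk
    have hT : Q ++ seg L k k1 = seg L k1 k2 := by
      have hcore : ∀ a ∈ Q ++ seg L k k1, Core f g i j C D a := by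
        intro a ha
        rcases List.mem_append.1 ha with ha | ha
        · exact coreQ a ha
        · exact coreP a ha
      refine eq_of_pairwise_lt (h := g) (sort_g hcore ?_) sortT fun a => ?_
      · refine List.pairwise_append.2 ⟨hQ, sortP, fun a ha b hb => ?_⟩
        have := (hQmem a).1 ha
        have := memP.1 hb
        omega
      · rw [List.mem_append, memT]
        constructor
        · rintro (ha | ha)
          · have h := (hQmem a).1 ha
            exact ⟨h.1, notpop a h.1 h.2.2, hpopped a ha⟩
          · have h := memP.1 ha
            exact ⟨h.1, notpop a h.1 (by have := h.1.1; omega), hall a ha⟩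
        · rintro ⟨ha, h1, h2⟩
          by_cases h3 : f a < k
          · exact Or.inl ((hQmem a).2 ⟨ha, h3, by omega⟩)
          · refine Or.inr (memP.2 ⟨ha, by omega, ?_⟩)
            by_contra h
            have := notpush a ha (by omega)
            have := ha.1
            omega
    obtain ⟨n, hn⟩ := ih (D - k2) (by omega) (k := k2) (Q := []) (by omega) hk2D
      List.Pairwise.nil (by
        intro a
        refine ⟨fun h => absurd h List.not_mem_nil, ?_⟩
        rintro ⟨ha, h1, h2⟩
        have h3 : f a < k1 := by
          by_contra h
          have := notpush a ha (by omega)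
          omega
        by_cases h4 : f a < k
        · have := hpopped a ((hQmem a).2 ⟨ha, h4, by omega⟩)
          omega
        · have := hall a (memP.2 ⟨ha, by omega, h3⟩)
          omega) (Or.inr (Or.inr (Or.inl rfl))) rfl
    refine ⟨n + 1 + 1, ?_⟩
    rw [e1, ← hT, List.append_assoc]
    -- The new batch leaves together with Q, so the block pushed between the two pops is empty.
    exact Chain.cons _ (Chain.cons (P := []) _ hn)
  · push Not at hex
    have hT : Q = seg L k1 k2 := by
      refine eq_of_pairwise_lt (h := g) (sort_g coreQ hQ) sortT fun a => ?_
      rw [memT]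
      constructor
      · intro ha
        have h := (hQmem a).1 ha
        exact ⟨h.1, notpop a h.1 h.2.2, hpopped a ha⟩
      · rintro ⟨ha, h1, h2⟩
        refine (hQmem a).2 ⟨ha, ?_, by omega⟩
        by_contra h3
        have h4 : f a < k1 := by
          by_contra h
          have := notpush a ha (by omega)
          have := ha.1
          omega
        have := hex a (memP.2 ⟨ha, by omega, h4⟩)
        omega
    obtain ⟨n, hn⟩ := ih (D - k2) (by omega) (k := k2) (Q := seg L k k1) (by omega) hk2D sortP (by
        intro a
        rw [memP]
        constructor
        · rintro ⟨ha, h1, h2⟩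
          exact ⟨ha, by omega, hex a (memP.2 ⟨ha, h1, h2⟩)⟩
        · rintro ⟨ha, h1, h2⟩
          have h3 : f a < k1 := by
            by_contra h
            have := notpush a ha (by omega)
            omega
          refine ⟨ha, ?_, h3⟩
          by_contra h4
          have := hpopped a ((hQmem a).2 ⟨ha, by omega, by omega⟩)
          omega) (hstate2 _ fun c hc => (memP.1 hc).2.2) rfl
    refine ⟨n + 1, ?_⟩
    rw [e1, ← hT]
    -- Exactly Q leaves and the new batch becomes the queue: one ordinary step of the chain.
    exact Chain.cons _ hn

/-- The queue starts with the left letters that return before D, and ends with the letters found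
between E and F. -/
theorem exists_chain (S : Frame L f g N i j A B C D E F) :
    ∃ n, Chain n (seg L A B) (seg L C D) (seg L E F) := by
  have hA := S.A_le
  have hB := S.B_le
  have hC := S.le_C
  have hD := S.D_le
  have hE := S.le_E
  have hN := S.F_le
  have hEF := S.E_le
  have hCD := S.C_le
  have sortR : (seg L E F).Pairwise fun a b => g a < g b :=
    pairwise_seg fun t h1 h2 => (S.right t (by omega) h2).1
  have memR : ∀ a, a ∈ seg L E F ↔ Core f g i j C D a ∧ f a < D ∧ D ≤ g a := by
    intro a
    rw [mem_seg]
    constructor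
    · rintro ⟨t, h1, h2, rfl⟩
      have h3 := S.right t (by omega) h2
      have h4 := S.right_mem (L t) h3.2.1 h3.2.2 (by omega)
      have h5 : f (L t) < D := by
        by_contra h
        have h6 := S.mid_right (f (L t)) (by omega) h3.2.2
        rw [S.L_f _ (by omega)] at h6
        omega
      exact ⟨⟨by omega, Or.inr (Or.inr ⟨by omega, h5, by omega⟩)⟩, h5, by omega⟩
    · rintro ⟨ha, h1, h2⟩
      have h0 := ha.1
      have h3 := ha.2
      have h4 := S.right_mem a (by omega) (by omega) (by omega)
      exact ⟨g a, by omega, by omega, S.L_g a h0⟩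
  have sortR' : (seg L E F).Pairwise fun a b => f a < f b :=
    sortR.imp_of_mem fun ha hb hab =>
      (S.lt_iff_lt ((memR _).1 ha).1 ((memR _).1 hb).1).2 hab
  refine S.exists_chain_from sortR' memR le_rfl S.C_le
    (pairwise_seg fun t h1 h2 => (S.left t h1 (by omega)).1) ?_ (Or.inl rfl)
  intro a
  rw [mem_seg]
  constructor
  · rintro ⟨t, h1, h2, rfl⟩
    have h3 := S.left t h1 (by omega)
    have h4 := S.left_mem (L t) (by omega) h3.2.1 h3.2.2
    have h5 : C ≤ g (L t) := by
      by_contra h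
      have h6 := S.mid_left (g (L t)) h3.2.1 (by omega)
      rw [S.L_g _ (by omega)] at h6
      omega
    exact ⟨⟨by omega, Or.inl ⟨by omega, h5, by omega⟩⟩, by omega, h5⟩
  · rintro ⟨ha, h1, h2⟩
    have h0 := ha.1
    have h3 := ha.2
    have h4 := S.left_mem a (by omega) (by omega) (by omega)
    exact ⟨f a, by omega, by omega, S.L_f a h0⟩

/-- Both segments carry the same letters by the choice of the cuts, and in the same order because
ab|ba| is forbidden. -/
theorem seg_left_eq (S : Frame L f g N i j A B C D E F) : seg L B i = seg L D j := by
  have hA := S.A_le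
  have hB := S.B_le
  have hC := S.le_C
  have hCD := S.C_le
  have hjN := S.j_lt
  have hleft : ∀ t, B ≤ t → t < i → t = f (L t) ∧ i + 2 ≤ g (L t) ∧ g (L t) < j :=
    fun t h1 h2 => S.left t (by omega) h2
  refine eq_of_pairwise_lt (h := g) ?_ (pairwise_seg fun t h1 h2 => (S.mid_right t h1 h2).1) ?_
  · refine (pairwise_seg fun t h1 h2 => (hleft t h1 h2).1).imp_of_mem fun {a b} ha hb hab => ?_
    obtain ⟨s, s1, s2, rfl⟩ := mem_seg.1 ha
    obtain ⟨t, t1, t2, rfl⟩ := mem_seg.1 hb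
    have h1 := hleft s s1 s2
    have h2 := hleft t t1 t2
    by_contra hlt
    have hne : L s ≠ L t := by
      intro h
      rw [h] at hab
      omega
    have := S.ne (a := L s) (b := L t) (by omega) (by omega) hne
    have := S.no_ab_ba_ (L s) (L t)
    omega
  · intro a
    rw [mem_seg, mem_seg]
    constructor
    · rintro ⟨t, h1, h2, rfl⟩
      have h3 := hleft t h1 h2
      have h4 := S.left_mem (L t) (by omega) h3.2.1 h3.2.2
      exact ⟨g (L t), by omega, by omega, S.L_g _ (by omega)⟩
    · rintro ⟨t, h1, h2, rfl⟩
      have h3 := S.mid_right t h1 h2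
      have h4 := S.left_mem (L t) h3.2 (by omega) (by omega)
      exact ⟨f (L t), by omega, by omega, S.L_f _ (by omega)⟩

theorem seg_right_eq (S : Frame L f g N i j A B C D E F) :
    seg L (i + 2) C = seg L (j + 2) E := by
  have hE := S.le_E
  have hEF := S.E_le
  have hCD := S.C_le
  have hD := S.D_le
  have hright : ∀ t, j + 2 ≤ t → t < E → t = g (L t) ∧ i + 2 ≤ f (L t) ∧ f (L t) < j :=
    fun t h1 h2 => S.right t h1 (by omega)
  refine eq_of_pairwise_lt (h := f) (pairwise_seg fun t h1 h2 => (S.mid_left t h1 h2).1) ?_ ?_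
  · refine (pairwise_seg fun t h1 h2 => (hright t h1 h2).1).imp_of_mem fun {a b} ha hb hab => ?_
    obtain ⟨s, s1, s2, rfl⟩ := mem_seg.1 ha
    obtain ⟨t, t1, t2, rfl⟩ := mem_seg.1 hb
    have h1 := hright s s1 s2
    have h2 := hright t t1 t2
    by_contra hlt
    have hne : L s ≠ L t := by
      intro h
      rw [h] at hab
      omega
    have := S.ne (a := L s) (b := L t) (by omega) (by omega) hne
    have := S.no__ab_ba (L t) (L s)
    omega
  · intro a
    rw [mem_seg, mem_seg]
    constructor
    · rintro ⟨t, h1, h2, rfl⟩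
      have h3 := S.mid_left t h1 h2
      have h4 := S.right_mem (L t) (by omega) (by omega) h3.2
      exact ⟨g (L t), by omega, by omega, S.L_g _ (by omega)⟩
    · rintro ⟨t, h1, h2, rfl⟩
      have h3 := hright t h1 h2
      have h4 := S.right_mem (L t) h3.2.1 h3.2.2 (by omega)
      exact ⟨f (L t), by omega, by omega, S.L_f _ (by omega)⟩

end Frame


open scoped List

/-! ### First and last positions of a letter in a list -/

/-- The position of the first occurrence of `a` in `u`. -/
def firstPos (u : List Letter) (a : Letter) : ℕ := u.idxOf a

/-- The position of the last occurrence of `a` in `u`. -/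
def lastPos (u : List Letter) (a : Letter) : ℕ := u.length - 1 - u.reverse.idxOf a

theorem getElem?_firstPos {u : List Letter} {a : Letter} (h : a ∈ u) :
    u[firstPos u a]? = some a := by
  have := List.idxOf_lt_length_of_mem h
  rw [firstPos, List.getElem?_eq_getElem this, List.getElem_idxOf this]

theorem lastPos_lt {u : List Letter} {a : Letter} (h : a ∈ u) : lastPos u a < u.length := by
  have := List.length_pos_of_mem h
  unfold lastPos
  omega

theorem getElem?_lastPos {u : List Letter} {a : Letter} (h : a ∈ u) :
    u[lastPos u a]? = some a := by
  have h1 : u.reverse.idxOf a < u.reverse.length := List.idxOf_lt_length_of_mem (by simpa using h)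
  have h2 := List.getElem_idxOf h1
  rw [List.getElem_reverse] at h2
  rw [List.getElem?_eq_getElem (lastPos_lt h)]
  exact congrArg some h2

theorem mem_of_firstPos_lt {u : List Letter} {a : Letter} (h : firstPos u a < u.length) : a ∈ u :=
  List.idxOf_lt_length_iff.1 h

/-- For an absent letter `firstPos` is the length of the word, so an inequality between positions
also gives membership. -/
theorem mem_of_firstPos_lt_lastPos {u : List Letter} {a : Letter}
    (h : firstPos u a < lastPos u a) : a ∈ u := by
  refine mem_of_firstPos_lt (h.trans_le ?_)
  unfold lastPos
  omega

theorem firstPos_le {u : List Letter} {a : Letter} {t : ℕ} (h : u[t]? = some a) :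
    firstPos u a ≤ t := by
  induction u generalizing t with
  | nil => simp at h
  | cons b u ih =>
    unfold firstPos
    by_cases hab : b = a
    · rw [hab, List.idxOf_cons_self]
      exact Nat.zero_le _
    · rw [List.idxOf_cons_ne _ hab]
      cases t with
      | zero => simp [hab] at h
      | succ t => exact Nat.succ_le_succ (ih (by simpa using h))

theorem le_lastPos {u : List Letter} {a : Letter} {t : ℕ} (h : u[t]? = some a) :
    t ≤ lastPos u a := by
  obtain ⟨ht, h'⟩ := List.getElem?_eq_some_iff.1 h
  have : u.reverse[u.length - 1 - t]? = some a := by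
    rw [List.getElem?_reverse (by omega), show u.length - 1 - (u.length - 1 - t) = t by omega, h]
  have := firstPos_le this
  unfold firstPos at this
  unfold lastPos
  omega

theorem firstPos_le_lastPos {u : List Letter} {a : Letter} (h : a ∈ u) :
    firstPos u a ≤ lastPos u a :=
  le_lastPos (getElem?_firstPos h)

theorem sublist_of_positions {u : List Letter} {ps : List ℕ} {l : List Letter}
    (hps : ps.Pairwise (· < ·)) (h : List.Forall₂ (fun t a => u[t]? = some a) ps l) : l <+ u := by
  -- Generalized to the word after position k, so that the induction can drop the letters already
  -- used.
  suffices ∀ k, (∀ t ∈ ps, k ≤ t) → l <+ u.drop k from by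
    simpa using this 0 fun _ _ => Nat.zero_le _
  induction h with
  | nil => exact fun k _ => List.nil_sublist _
  | @cons t a ps l ht _ ih =>
    intro k hk
    rw [List.pairwise_cons] at hps
    obtain ⟨ht', rfl⟩ := List.getElem?_eq_some_iff.1 ht
    have h1 : u[t] :: l <+ u.drop t := by
      rw [List.drop_eq_getElem_cons ht']
      exact (ih hps.2 (t + 1) fun s hs => hps.1 s hs).cons_cons _
    have h2 : u.drop t <+ u.drop k := by
      have := hk t (List.mem_cons_self)
      rw [show t = k + (t - k) by omega, ← List.drop_drop]
      exact List.drop_sublist _ _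
    exact h1.trans h2

theorem eq_firstPos_or_lastPos {u : List Letter} {a : Letter} (hu : u.count a ≤ 2) {t : ℕ}
    (h : u[t]? = some a) : t = firstPos u a ∨ t = lastPos u a := by
  by_contra hne
  have h1 := firstPos_le h
  have h2 := le_lastPos h
  have ha := List.mem_of_getElem? h
  have : [a, a, a] <+ u := by
    refine sublist_of_positions (ps := [firstPos u a, t, lastPos u a]) ?_
      (.cons (getElem?_firstPos ha) (.cons h (.cons (getElem?_lastPos ha) .nil)))
    simp
    omega
  have := this.count_le a
  simp at this
  omega

theorem count_le_one_of_firstPos_eq {u : List Letter} {a : Letter}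
    (h : firstPos u a = lastPos u a) : u.count a ≤ 1 := by
  by_contra hlt
  have h2 : [a, a] <+ u := by
    have := List.replicate_sublist_iff.2 (show 2 ≤ u.count a by omega)
    simpa [List.replicate] using this
  obtain ⟨r, s, rfl, hr, hs⟩ := List.cons_sublist_iff.1 h2
  have h1 : firstPos (r ++ s) a < r.length := by
    rw [firstPos, List.idxOf_append_of_mem hr]
    exact List.idxOf_lt_length_of_mem hr
  have hs' : a ∈ s := by simpa using hs
  have h3 : (r ++ s)[r.length + firstPos s a]? = some a := by
    rw [List.getElem?_append_right (by omega), Nat.add_sub_cancel_left]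
    exact getElem?_firstPos hs'
  have := le_lastPos h3
  omega

theorem pair_sublist_iff {u : List Letter} {a b : Letter} (ha : a ∈ u) (hb : b ∈ u) :
    [a, b] <+ u ↔ firstPos u a < lastPos u b := by
  constructor
  · intro h
    obtain ⟨r, s, rfl, hr, hs⟩ := List.cons_sublist_iff.1 h
    have h1 : firstPos (r ++ s) a < r.length := by
      rw [firstPos, List.idxOf_append_of_mem hr]
      exact List.idxOf_lt_length_of_mem hr
    have hs' : b ∈ s := by simpa using hs
    have h3 : (r ++ s)[r.length + firstPos s b]? = some b := by
      rw [List.getElem?_append_right (by omega), Nat.add_sub_cancel_left]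
      exact getElem?_firstPos hs'
    have := le_lastPos h3
    omega
  · intro h
    exact sublist_of_positions (ps := [firstPos u a, lastPos u b]) (by simpa using h)
      (.cons (getElem?_firstPos ha) (.cons (getElem?_lastPos hb) .nil))

theorem positions_ne {u : List Letter} {a b : Letter} (ha : a ∈ u) (hb : b ∈ u) (hab : a ≠ b) :
    firstPos u a ≠ firstPos u b ∧ lastPos u a ≠ lastPos u b ∧ firstPos u a ≠ lastPos u b ∧
      lastPos u a ≠ firstPos u b := by
  refine ⟨fun h => hab ?_, fun h => hab ?_, fun h => hab ?_, fun h => hab ?_⟩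
  · have h' := getElem?_firstPos ha
    rw [h, getElem?_firstPos hb] at h'
    exact (Option.some.inj h').symm
  · have h' := getElem?_lastPos ha
    rw [h, getElem?_lastPos hb] at h'
    exact (Option.some.inj h').symm
  · have h' := getElem?_firstPos ha
    rw [h, getElem?_lastPos hb] at h'
    exact (Option.some.inj h').symm
  · have h' := getElem?_lastPos ha
    rw [h, getElem?_firstPos hb] at h'
    exact (Option.some.inj h').symm

/-! ### Projections to two letters -/

/-- The word obtained from `u` by deleting all letters except `a` and `b`. -/
def proj (a b : Letter) (u : List Letter) : List Letter := u.filter fun c => c = a ∨ c = b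

theorem proj_comm (a b : Letter) (u : List Letter) : proj a b u = proj b a u := by
  unfold proj
  congr 1
  funext c
  simp [or_comm]

theorem count_proj (a b : Letter) (u : List Letter) : (proj a b u).count a = u.count a :=
  List.count_filter (by simp)

theorem firstPos_lt_iff_proj (a b : Letter) (u : List Letter) :
    firstPos u a < firstPos u b ↔ firstPos (proj a b u) a < firstPos (proj a b u) b := by
  unfold firstPos proj
  induction u with
  | nil => exact Iff.rfl
  | cons c u ih =>
    by_cases hca : c = a
    · by_cases hcb : c = b
      · subst hca hcb
        simp
      · subst hca
        simp [List.idxOf_cons_ne _ hcb]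
    · by_cases hcb : c = b
      · subst hcb
        simp
      · rw [List.idxOf_cons_ne _ hca, List.idxOf_cons_ne _ hcb, List.filter_cons_of_neg (by simp [hca, hcb])]
        simpa using ih

theorem mem_proj_left {a b : Letter} {u : List Letter} : a ∈ proj a b u ↔ a ∈ u := by
  simp [proj]

theorem mem_proj_right {a b : Letter} {u : List Letter} : b ∈ proj a b u ↔ b ∈ u := by
  simp [proj]

theorem lastPos_lt_iff {a b : Letter} {u : List Letter} (ha : a ∈ u) (hb : b ∈ u) :
    lastPos u a < lastPos u b ↔ firstPos u.reverse b < firstPos u.reverse a := by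
  have h1 : u.reverse.idxOf a < u.reverse.length := List.idxOf_lt_length_of_mem (by simpa using ha)
  have h2 : u.reverse.idxOf b < u.reverse.length := List.idxOf_lt_length_of_mem (by simpa using hb)
  rw [List.length_reverse] at h1 h2
  unfold lastPos firstPos
  omega

theorem lastPos_lt_iff_proj {a b : Letter} {u : List Letter} (ha : a ∈ u) (hb : b ∈ u) :
    lastPos u a < lastPos u b ↔ lastPos (proj a b u) a < lastPos (proj a b u) b := by
  rw [lastPos_lt_iff ha hb, lastPos_lt_iff (mem_proj_left.2 ha) (mem_proj_right.2 hb),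
    firstPos_lt_iff_proj b a, proj_comm, proj, List.filter_reverse]
  rfl

theorem firstPos_lt_lastPos_iff_proj {a b : Letter} {u : List Letter} (ha : a ∈ u) (hb : b ∈ u) :
    firstPos u a < lastPos u b ↔ firstPos (proj a b u) a < lastPos (proj a b u) b := by
  rw [← pair_sublist_iff ha hb, ← pair_sublist_iff (mem_proj_left.2 ha) (mem_proj_right.2 hb)]
  constructor
  · intro h
    simpa [proj] using h.filter fun c => c = a ∨ c = b
  · exact fun h => h.trans List.filter_sublist

/-- The relative order of the positions of `a` and `b` is determined by the projection. -/
theorem order_of_proj_eq {a b : Letter} {u v : List Letter} (h : proj a b u = proj a b v)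
    (ha : a ∈ u) (hb : b ∈ u) (hab : a ≠ b) :
    (firstPos u a < firstPos u b ↔ firstPos v a < firstPos v b) ∧
    (firstPos u a < lastPos u b ↔ firstPos v a < lastPos v b) ∧
    (lastPos u a < firstPos u b ↔ lastPos v a < firstPos v b) ∧
    (lastPos u a < lastPos u b ↔ lastPos v a < lastPos v b) := by
  have ha' : a ∈ v := mem_proj_left.1 (h ▸ mem_proj_left.2 ha)
  have hb' : b ∈ v := mem_proj_right.1 (h ▸ mem_proj_right.2 hb)
  have h1 := positions_ne ha hb hab
  have h2 := positions_ne ha' hb' hab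
  have h3 : firstPos u b < lastPos u a ↔ firstPos v b < lastPos v a := by
    rw [firstPos_lt_lastPos_iff_proj hb ha, firstPos_lt_lastPos_iff_proj hb' ha', proj_comm, h,
      proj_comm]
  refine ⟨?_, ?_, by omega, ?_⟩
  · rw [firstPos_lt_iff_proj, h, ← firstPos_lt_iff_proj]
  · rw [firstPos_lt_lastPos_iff_proj ha hb, h, ← firstPos_lt_lastPos_iff_proj ha' hb']
  · rw [lastPos_lt_iff_proj ha hb, h, ← lastPos_lt_iff_proj ha' hb']

theorem order_of_proj_eq_cross {a b : Letter} {u : List Letter} (h : proj a b u = [a, b, a, b])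
    (hab : a ≠ b) : a ∈ u ∧ b ∈ u ∧ firstPos u a < firstPos u b ∧ firstPos u b < lastPos u a ∧
      lastPos u a < lastPos u b := by
  have ha : a ∈ u := by
    rw [← mem_proj_left (b := b), h]
    simp
  have hb : b ∈ u := by
    rw [← mem_proj_right (a := a), h]
    simp
  refine ⟨ha, hb, ?_, ?_, ?_⟩
  · rw [firstPos_lt_iff_proj, h]
    simp [firstPos, List.idxOf_cons_ne _ hab]
  · rw [firstPos_lt_lastPos_iff_proj hb ha, proj_comm, h]
    simp [firstPos, lastPos, List.idxOf_cons_ne _ hab, List.idxOf_cons_ne _ hab.symm]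
  · rw [lastPos_lt_iff_proj ha hb, h]
    simp [lastPos, List.idxOf_cons_ne _ hab.symm]

/-- A word is determined by its projections to two letters. -/
theorem eq_of_proj_eq {u v : List Letter} (h : ∀ a b, proj a b u = proj a b v) : u = v := by
  induction u generalizing v with
  | nil =>
    cases v with
    | nil => rfl
    | cons b v => simpa [proj] using h b b
  | cons a u ih =>
    cases v with
    | nil => simpa [proj] using h a a
    | cons b v =>
      obtain rfl : a = b := by
        have := h a b
        simp only [proj, true_or, decide_true, List.filter_cons_of_pos, or_true,
          List.cons.injEq] at this
        exact this.1
      rw [ih fun c d => ?_]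
      have := h c d
      by_cases hcd : a = c ∨ a = d
      · simpa [proj, hcd] using this
      · simpa [proj, hcd] using this


open scoped List

/-! ### Consequences of an identity that holds in the monoid -/

/-- A two-letter pattern is coded by booleans. The six pairs are pairs of letters in words of V that
together realize every pattern except the two crossing ones. -/
theorem isFactorWord_of_bool (l : List Bool) (h : l.count true ≤ 2) (h' : l.count false ≤ 2) :
    l = [true, false, true, false] ∨ l = [false, true, false, true] ∨
      ∃ pq ∈ [(Letter.x, Letter.y), (.y, .x), (.y, .z), (.z, .y), (.a, .b), (.b, .a)],
        IsFactorWord (l.map fun t : Bool => if t then pq.1 else pq.2) := by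
  have hlen : l.count true + l.count false = l.length := List.count_true_add_count_false l
  match l with
  | [] => exact Or.inr (Or.inr (by decide))
  | [a] =>
    clear hlen
    revert a
    decide
  | [a, b] =>
    clear hlen
    revert a b
    decide
  | [a, b, c] =>
    clear hlen
    revert a b c
    decide
  | [a, b, c, d] =>
    clear hlen
    revert a b c d
    decide
  | a :: b :: c :: d :: e :: l =>
    simp only [List.length_cons] at hlen
    omega

theorem count_map_decide_le {a b : Letter} {u : List Letter} (hu : ∀ c, u.count c ≤ 2) :
    ((proj a b u).map fun c => decide (c = a)).count true ≤ 2 ∧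
      ((proj a b u).map fun c => decide (c = a)).count false ≤ 2 := by
  have h1 := hu a
  have h2 := hu b
  rw [List.count_eq_countP] at h1 h2
  rw [List.count_eq_countP, List.count_eq_countP, List.countP_map, List.countP_map, proj,
    List.countP_filter, List.countP_filter]
  refine ⟨le_trans (List.countP_mono_left fun c _ hc => ?_) h1,
    le_trans (List.countP_mono_left fun c _ hc => ?_) h2⟩
  · simp at hc
    simp [hc]
  · simp at hc
    rcases hc with ⟨h, h' | h'⟩
    · exact absurd h' h
    · simp [h']

theorem map_proj_decide (a b : Letter) (u : List Letter) :
    ((proj a b u).map fun c => decide (c = a)).map (fun t : Bool => if t then a else b) =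
      proj a b u := by
  rw [List.map_map]
  conv_rhs => rw [← List.map_id (proj a b u)]
  refine List.map_congr_left fun c hc => ?_
  have : c = a ∨ c = b := by simpa [proj] using (List.mem_filter.1 hc).2
  by_cases h : c = a
  · simp [h]
  · obtain rfl := this.resolve_left h
    simp [h]

theorem flatMap_proj (a b p q : Letter) (u : List Letter) :
    u.flatMap (fun c => if c = a then [p] else if c = b then [q] else []) =
      ((proj a b u).map fun c => decide (c = a)).map fun t : Bool => if t then p else q := by
  induction u with
  | nil => rfl
  | cons c u ih =>
    rw [List.flatMap_cons, ih]
    by_cases hca : c = a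
    · simp [proj, hca]
    · by_cases hcb : c = b
      · subst hcb
        simp [proj, hca]
      · simp [proj, hca, hcb]

/-- If an identity of 2-limited words holds, then both sides have the same projection to any two
letters `a`, `b`, or the projections are `abab` and `baba`. -/
theorem Holds.proj_eq {u v : List Letter} (h : Holds u v) (hu : ∀ c, u.count c ≤ 2)
    (hv : ∀ c, v.count c ≤ 2) (a b : Letter) : proj a b u = proj a b v ∨
      (proj a b u = [a, b, a, b] ∧ proj a b v = [b, a, b, a]) ∨
      (proj a b u = [b, a, b, a] ∧ proj a b v = [a, b, a, b]) := by
  have h1 := isFactorWord_of_bool _ (count_map_decide_le (a := a) (b := b) hu).1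
    (count_map_decide_le hu).2
  have h2 := isFactorWord_of_bool _ (count_map_decide_le (a := a) (b := b) hv).1
    (count_map_decide_le hv).2
  have key : ∀ {u v : List Letter}, Holds u v →
      (∃ pq ∈ [(Letter.x, Letter.y), (.y, .x), (.y, .z), (.z, .y), (.a, .b), (.b, .a)], IsFactorWord
        (((proj a b u).map fun c => decide (c = a)).map fun t : Bool => if t then pq.1 else pq.2)) →
      proj a b u = proj a b v := by
    rintro u v h ⟨⟨p, q⟩, hpq, hf⟩
    have hne : p ≠ q := by
      simp at hpq
      rcases hpq with h | h | h | h | h | h <;> rw [h.1, h.2] <;> decide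
    rw [← flatMap_proj] at hf
    have e := h.flatMap_eq _ hf
    rw [flatMap_proj, flatMap_proj] at e
    have hinj : Function.Injective fun t : Bool => if t then p else q := by
      intro s t hst
      cases s <;> cases t <;> simp_all
    rw [← map_proj_decide, List.map_injective_iff.2 hinj e, map_proj_decide]
  rw [← map_proj_decide a b u, ← map_proj_decide a b v]
  rcases h1 with h1 | h1 | h1
  · rcases h2 with h2 | h2 | h2
    · simp [h1, h2]
    · simp [h1, h2]
    · rw [map_proj_decide, map_proj_decide]
      exact Or.inl (key h.symm h2).symm
  · rcases h2 with h2 | h2 | h2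
    · simp [h1, h2]
    · simp [h1, h2]
    · rw [map_proj_decide, map_proj_decide]
      exact Or.inl (key h.symm h2).symm
  · rw [map_proj_decide, map_proj_decide]
    exact Or.inl (key h h1)

theorem flatMap_filter_of_nil {θ : Letter → List Letter} {k : Letter → Bool}
    (h : ∀ c, k c = false → θ c = []) (u : List Letter) : (u.filter k).flatMap θ = u.flatMap θ := by
  induction u with
  | nil => rfl
  | cons c u ih =>
    by_cases hc : k c = true
    · simp [hc, ih]
    · simp only [Bool.not_eq_true] at hc
      simp [hc, ih, h c hc]

/-- If the 2-limited word `u` contains, up to renaming, a word whose subwords are isoterms, and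
`u ≈ v` holds, then no crossing pair of letters of that word is swapped in `v`. -/
theorem Holds.not_sublist {u v : List Letter} (h : Holds u v) {w : List Letter}
    (hw : IsFactorWord w) (σ : Letter → Letter) (hcount : ∀ l ∈ w, u.count (σ l) ≤ w.count l)
    {p q : Letter} (hpq : p ≠ q) (hproj : proj p q w = [p, q, p, q])
    (hv : proj (σ p) (σ q) v = [σ q, σ p, σ q, σ p]) : ¬ w.map σ <+ u := by
  intro hsub
  have hmap : ∀ l ∈ w, w.count l ≤ (w.map σ).count (σ l) := by
    intro l _
    rw [List.count_eq_countP, List.count_eq_countP, List.countP_map]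
    refine List.countP_mono_left fun c _ hc => ?_
    have : c = l := by simpa using hc
    simp [this]
  -- If σ identified two letters of w, the image of w would contain σ l more often than w contains
  -- l, but u does not.
  have hinj : ∀ l ∈ w, ∀ l' ∈ w, σ l = σ l' → l = l' := by
    intro l hl l' hl' hll
    by_contra hne
    have h1 : (w.filter fun c => c = l) <+ w.filter fun c => σ c = σ l := by
      have : (w.filter fun c => c = l) = (w.filter fun c => σ c = σ l).filter fun c => c = l := by
        rw [List.filter_filter]
        congr 1
        funext c
        by_cases hc : c = l <;> simp [hc]
      rw [this]
      exact List.filter_sublist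
    have h2 : (w.map σ).count (σ l) = (w.filter fun c => σ c = σ l).length := by
      rw [List.count_eq_countP, List.countP_map, List.countP_eq_length_filter]
      congr 2
    have h3 : w.count l = (w.filter fun c => c = l).length := by
      rw [List.count_eq_countP, List.countP_eq_length_filter]
      congr 2
    have h4 := (hsub.count_le (σ l)).trans (hcount l hl)
    rw [h2, h3] at h4
    have h5 := h1.eq_of_length_le h4
    have : l' ∈ w.filter fun c => c = l := by
      rw [h5]
      simp [hl', hll]
    simp at this
    exact hne this.2.symm
  classical
  -- Undo the renaming and erase all other letters, so that u becomes w.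
  let θ : Letter → List Letter := fun c =>
    if hc : ∃ l ∈ w, σ l = c then [hc.choose] else []
  have hθ : ∀ l ∈ w, θ (σ l) = [l] := by
    intro l hl
    have hc : ∃ l' ∈ w, σ l' = σ l := ⟨l, hl, rfl⟩
    simp only [θ, dif_pos hc]
    rw [hinj _ hc.choose_spec.1 _ hl hc.choose_spec.2]
  have hfilter : u.filter (fun c => c ∈ w.map σ) = w.map σ := by
    have h1 : w.map σ <+ u.filter fun c => c ∈ w.map σ := by
      have := hsub.filter fun c => c ∈ w.map σ
      rwa [List.filter_eq_self.2 fun c hc => by simpa using hc] at this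
    refine (h1.eq_of_length_le
      (List.Subperm.length_le (List.subperm_ext_iff.2 fun c hc => ?_))).symm
    have hc' : c ∈ w.map σ := by simpa using (List.mem_filter.1 hc).2
    obtain ⟨l, hl, rfl⟩ := List.mem_map.1 hc'
    exact (List.filter_sublist.count_le _).trans ((hcount l hl).trans (hmap l hl))
  have hu : u.flatMap θ = w := by
    rw [← flatMap_filter_of_nil (θ := θ) (k := fun c => c ∈ w.map σ), hfilter, List.flatMap_map]
    · conv_rhs => rw [← List.flatMap_singleton' w]
      exact List.flatMap_congr fun l hl => hθ l hl
    · intro c hc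
      have hc' : c ∉ w.map σ := by simpa using hc
      simp only [θ]
      rw [dif_neg]
      rintro ⟨l, hl, rfl⟩
      exact hc' (List.mem_map.2 ⟨l, hl, rfl⟩)
  have e := h.flatMap_eq θ (by rwa [hu])
  rw [hu] at e
  have hp : p ∈ w := by
    rw [← mem_proj_left (b := q), hproj]
    simp
  have hq : q ∈ w := by
    rw [← mem_proj_right (a := p), hproj]
    simp
  -- Projection commutes with θ, so the image of v shows q p q p where the isoterm w shows p q p q.
  have hcomm : ∀ v : List Letter, proj p q (v.flatMap θ) = (proj (σ p) (σ q) v).flatMap θ := by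
    intro v
    induction v with
    | nil => rfl
    | cons c v ih =>
      have hc : proj p q (θ c) = if c = σ p ∨ c = σ q then θ c else [] := by
        by_cases hc : ∃ l ∈ w, σ l = c
        · obtain ⟨l, hl, rfl⟩ := hc
          rw [hθ l hl]
          have h1 : σ l = σ p ↔ l = p := ⟨hinj l hl p hp, fun h => by rw [h]⟩
          have h2 : σ l = σ q ↔ l = q := ⟨hinj l hl q hq, fun h => by rw [h]⟩
          simp only [h1, h2]
          by_cases h3 : l = p ∨ l = q <;> simp [proj, h3]
        · have : θ c = [] := dif_neg hc
          simp [this, proj]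
      rw [List.flatMap_cons, proj, List.filter_append]
      change proj p q (θ c) ++ proj p q (v.flatMap θ) = _
      rw [hc, ih]
      by_cases h3 : c = σ p ∨ c = σ q <;> simp [proj, h3]
  rw [e, hcomm, hv] at hproj
  simp only [List.flatMap_cons, hθ p hp, hθ q hq] at hproj
  simp at hproj
  exact hpq hproj.1.symm

/-- The positions of the letters of `w` in `u`, under the renaming `σ`: the first occurrence of a
letter of `w` that is not in `seen` is sent to the first position, all others to the last one. -/
def positionList (u : List Letter) (σ : Letter → Letter) : List Letter → List Letter → List ℕ
  | _, [] => []
  | seen, l :: w =>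
    (if l ∈ seen then lastPos u (σ l) else firstPos u (σ l)) :: positionList u σ (l :: seen) w

theorem map_sublist_of_positionList {u : List Letter} {σ : Letter → Letter} {w : List Letter}
    (hmem : ∀ l ∈ w, σ l ∈ u) (seen : List Letter)
    (h : (positionList u σ seen w).IsChain (· < ·)) : w.map σ <+ u := by
  refine sublist_of_positions (List.isChain_iff_pairwise.1 h) ?_
  clear h
  induction w generalizing seen with
  | nil => exact .nil
  | cons l w ih =>
    refine .cons ?_ (ih (fun l hl => hmem l (List.mem_cons_of_mem _ hl)) _)
    split_ifs
    · exact getElem?_lastPos (hmem l List.mem_cons_self)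
    · exact getElem?_firstPos (hmem l List.mem_cons_self)

/-- A position criterion for `Holds.not_sublist`. -/
theorem Holds.not_isChain {u v : List Letter} (h : Holds u v) (hu : ∀ c, u.count c ≤ 2)
    {w : List Letter} (hw : IsFactorWord w) (σ : Letter → Letter)
    (hcount : ∀ l ∈ w, w.count l = 2 ∨ (w.count l = 1 ∧ firstPos u (σ l) = lastPos u (σ l)))
    {p q : Letter} (hpq : p ≠ q) (hproj : proj p q w = [p, q, p, q])
    (hv : proj (σ p) (σ q) v = [σ q, σ p, σ q, σ p]) (hmem : ∀ l ∈ w, σ l ∈ u)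
    (hchain : (positionList u σ [] w).IsChain (· < ·)) : False := by
  refine h.not_sublist hw σ (fun l hl => ?_) hpq hproj hv
    (map_sublist_of_positionList hmem [] hchain)
  rcases hcount l hl with h' | ⟨h', h''⟩
  · rw [h']
    exact hu _
  · rw [h']
    exact count_le_one_of_firstPos_eq h''

/-! ### Inverted pairs -/

/-- The letters `a` and `b` cross in `u`, and in the opposite order in `v`. -/
def Inverted (u v : List Letter) (a b : Letter) : Prop :=
  proj a b u = [a, b, a, b] ∧ proj a b v = [b, a, b, a]

theorem Inverted.ne {u v : List Letter} (hu : ∀ c, u.count c ≤ 2) {a b : Letter}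
    (h : Inverted u v a b) : a ≠ b := by
  rintro rfl
  have := hu a
  rw [← count_proj a a, h.1] at this
  simp at this

theorem Inverted.positions {u v : List Letter} (hu : ∀ c, u.count c ≤ 2) {a b : Letter}
    (h : Inverted u v a b) : a ∈ u ∧ b ∈ u ∧ firstPos u a < firstPos u b ∧
      firstPos u b < lastPos u a ∧ lastPos u a < lastPos u b ∧ firstPos v b < firstPos v a ∧
      firstPos v a < lastPos v b ∧ lastPos v b < lastPos v a := by
  have hab := h.ne hu
  obtain ⟨h1, h2, h3⟩ := order_of_proj_eq_cross h.1 hab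
  have hv : proj b a v = [b, a, b, a] := by rw [proj_comm, h.2]
  obtain ⟨h4, h5, h6⟩ := order_of_proj_eq_cross hv hab.symm
  exact ⟨h1, h2, h3.1, h3.2.1, h3.2.2, h6⟩

/-- The form in which identities are used for positions: relative orders agree in u and v except for
inverted pairs. -/
theorem Holds.order {u v : List Letter} (h : Holds u v) (hu : ∀ c, u.count c ≤ 2)
    (hv : ∀ c, v.count c ≤ 2) {a b : Letter} (ha : a ∈ u) (hb : b ∈ u) (hab : a ≠ b) :
    ((firstPos u a < firstPos u b ↔ firstPos v a < firstPos v b) ∧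
    (firstPos u a < lastPos u b ↔ firstPos v a < lastPos v b) ∧
    (lastPos u a < firstPos u b ↔ lastPos v a < firstPos v b) ∧
    (lastPos u a < lastPos u b ↔ lastPos v a < lastPos v b)) ∨ Inverted u v a b ∨
      Inverted u v b a := by
  rcases h.proj_eq hu hv a b with h | h | h
  · exact Or.inl (order_of_proj_eq h ha hb hab)
  · exact Or.inr (Or.inl h)
  · refine Or.inr (Or.inr ?_)
    rw [Inverted, proj_comm b a u, proj_comm b a v]
    exact h

/-- Among the inverted pairs, there is one of two letters that are adjacent twice. -/
theorem Holds.exists_adjacent_inverted {u v : List Letter} (h : Holds u v)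
    (hu : ∀ c, u.count c ≤ 2) (hv : ∀ c, v.count c ≤ 2) (hex : ∃ a b, Inverted u v a b) :
    ∃ a b, Inverted u v a b ∧ firstPos u b = firstPos u a + 1 ∧ lastPos u b = lastPos u a + 1 := by
  classical
  -- Choose an inverted pair with the least distance between first occurrences. A letter between
  -- them forms no inverted pair with a or with b at a smaller distance, so its order relations
  -- would carry over to v and contradict the inversion.
  have hexn : ∃ n, ∃ a b, Inverted u v a b ∧ firstPos u b - firstPos u a = n := by
    obtain ⟨a, b, hab⟩ := hex
    exact ⟨_, a, b, hab, rfl⟩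
  obtain ⟨a, b, hab, hn⟩ := Nat.find_spec hexn
  have hmin : ∀ c d, Inverted u v c d →
      firstPos u b - firstPos u a ≤ firstPos u d - firstPos u c := by
    intro c d hcd
    rw [hn]
    exact Nat.find_min' hexn ⟨c, d, hcd, rfl⟩
  clear hn
  have hne := hab.ne hu
  obtain ⟨ha, hb, p1, p2, p3, p4, p5, p6⟩ := hab.positions hu
  have hbu := lastPos_lt hb
  have hfirst : firstPos u b = firstPos u a + 1 := by
    by_contra hgap
    obtain ⟨c, hc⟩ : ∃ c, u[firstPos u a + 1]? = some c :=
      ⟨_, List.getElem?_eq_getElem (by omega)⟩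
    have hcu := List.mem_of_getElem? hc
    have hpos := eq_firstPos_or_lastPos (hu c) hc
    have hle := firstPos_le_lastPos hcu
    have hac : a ≠ c := by
      rintro rfl
      omega
    have hcb : c ≠ b := by
      rintro rfl
      omega
    have hnac : ¬ Inverted u v a c := by
      intro hi
      have := hmin _ _ hi
      have := hi.positions hu
      omega
    have hncb : ¬ Inverted u v c b := by
      intro hi
      have := hmin _ _ hi
      have := hi.positions hu
      omega
    have hnbc : ¬ Inverted u v b c := by
      intro hi
      have := hi.positions hu
      omega
    have q1 := positions_ne ha hcu hac
    have o2 := (h.order hu hv hcu hb hcb).resolve_right (by tauto)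
    rcases h.order hu hv ha hcu hac with o1 | o1 | o1
    · rcases hpos with hpos | hpos <;> omega
    · exact hnac o1
    · have := o1.positions hu
      omega
  refine ⟨a, b, hab, hfirst, ?_⟩
  by_contra hgap
  obtain ⟨c, hc⟩ : ∃ c, u[lastPos u a + 1]? = some c :=
    ⟨_, List.getElem?_eq_getElem (by omega)⟩
  have hcu := List.mem_of_getElem? hc
  have hpos := eq_firstPos_or_lastPos (hu c) hc
  have hle := firstPos_le_lastPos hcu
  have hac : a ≠ c := by
    rintro rfl
    omega
  have hcb : c ≠ b := by
    rintro rfl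
    omega
  have q1 := positions_ne ha hcu hac
  have q2 := positions_ne hcu hb hcb
  -- A letter c whose last occurrence follows that of a gives cab⋯acb or abc⋯acb. These are the
  -- isoterms xyzyxz and zxyzyx, which determine the order of a and b.
  have hchain : (firstPos u c < firstPos u a ∧ lastPos u c = lastPos u a + 1) ∨
      (firstPos u b < firstPos u c ∧ firstPos u c < lastPos u a ∧
        lastPos u c = lastPos u a + 1) → False := by
    rintro (⟨h1, h2⟩ | ⟨h1, h2, h3⟩)
    · refine h.not_isChain hu (w := [.x, .y, .z, .y, .x, .z]) (p := .y) (q := .z) (by decide)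
        (fun | .x => c | .y => a | _ => b) (fun l hl => Or.inl ?_) (by decide) (by decide) hab.2
        (by simp [ha, hb, hcu]) (by simp [positionList]; omega)
      revert l
      decide
    · refine h.not_isChain hu (w := [.z, .x, .y, .z, .y, .x]) (p := .z) (q := .x) (by decide)
        (fun | .z => a | .x => b | _ => c) (fun l hl => Or.inl ?_) (by decide) (by decide) hab.2
        (by simp [ha, hb, hcu]) (by simp [positionList]; omega)
      revert l
      decide
  -- If c first occurs here, its order relations with a and b carry over to v and rule out the
  -- inversion. The same holds if c is single.
  rcases hpos with hpos | hpos
  · have o1 : (firstPos u a < firstPos u c ↔ firstPos v a < firstPos v c) := by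
      rcases h.order hu hv ha hcu hac with o1 | o1 | o1
      · exact o1.1
      · have := o1.positions hu
        omega
      · have := o1.positions hu
        omega
    rcases h.order hu hv hcu hb hcb with o2 | o2 | o2
    · rcases h.order hu hv ha hcu hac with o1 | o1 | o1
      · omega
      · have := o1.positions hu
        omega
      · have := o1.positions hu
        omega
    · have := o2.positions hu
      omega
    · rcases h.order hu hv ha hcu hac with o1 | o1 | o1
      · have := o2.positions hu
        omega
      · have := o1.positions hu
        omega
      · have := o1.positions hu
        omega
  · by_cases hlin : firstPos u c = lastPos u c
    · rcases h.order hu hv hcu hb hcb with o2 | o2 | o2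
      · rcases h.order hu hv ha hcu hac with o1 | o1 | o1
        · omega
        · have := o1.positions hu
          omega
        · have := o1.positions hu
          omega
      · have := o2.positions hu
        omega
      · have := o2.positions hu
        omega
    · apply hchain
      omega


open scoped List

/-! ### The layout of an inverted pair of adjacent letters -/

/-- The renaming that maps `x, y, a, b, c, d, e` to the given letters and all others to the last. -/
def relabel (p q a b c d e t : Letter) : Letter → Letter
  | .x => p
  | .y => q
  | .a => a
  | .b => b
  | .c => c
  | .d => d
  | .e => e
  | _ => t

theorem Inverted.false_of_square {u v : List Letter} {a b : Letter} (hab : Inverted u v a b)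
    (h : Holds u v) (hu : ∀ c, u.count c ≤ 2) (σ : Letter → Letter) {w : List Letter}
    {p q : Letter} (hw : (p ≠ q ∧ proj p q w = [p, q, p, q]) ∧ (∀ l ∈ w, w.count l = 2) ∧
      IsFactorWord w) (hσ : σ p = a ∧ σ q = b)
    (hpos : (∀ l ∈ w, firstPos u (σ l) < lastPos u (σ l)) ∧
      (positionList u σ [] w).IsChain (· < ·)) : False := by
  obtain ⟨rfl, rfl⟩ := hσ
  exact h.not_isChain hu hw.2.2 σ (fun l hl => Or.inl (hw.2.1 l hl)) hw.1.1 hw.1.2 hab.2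
    (fun l hl => mem_of_firstPos_lt_lastPos (hpos.1 l hl)) hpos.2

theorem Inverted.false_of_linear {u v : List Letter} {a b : Letter} (hab : Inverted u v a b)
    (h : Holds u v) (hu : ∀ c, u.count c ≤ 2) (σ : Letter → Letter) {w : List Letter}
    {p q c : Letter} (hw : (p ≠ q ∧ proj p q w = [p, q, p, q]) ∧
      (∀ l ∈ w, w.count l = 2 ∨ (w.count l = 1 ∧ l = c)) ∧ IsFactorWord w)
    (hσ : σ p = a ∧ σ q = b)
    (hpos : (∀ l ∈ w, firstPos u (σ l) < u.length) ∧ firstPos u (σ c) = lastPos u (σ c) ∧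
      (positionList u σ [] w).IsChain (· < ·)) : False := by
  obtain ⟨rfl, rfl⟩ := hσ
  refine h.not_isChain hu hw.2.2 σ (fun l hl => ?_) hw.1.1 hw.1.2 hab.2
    (fun l hl => mem_of_firstPos_lt (hpos.1 l hl)) hpos.2.2
  rcases hw.2.1 l hl with h | ⟨h, rfl⟩
  · exact Or.inl h
  · exact Or.inr ⟨h, hpos.2.1⟩

theorem lastPos_le (u : List Letter) (a : Letter) : lastPos u a ≤ u.length - 1 :=
  Nat.sub_le _ _

/-- Each forbidden pattern is a word of V, or a factor of one, in which the block letters cross.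
Containing it would fix the order of p and q in v. For the reversed words the block reads yx, so the
roles of p and q are exchanged. -/
theorem Inverted.layout {u v : List Letter} {p q : Letter} (hpq : Inverted u v p q)
    (h : Holds u v) (hu : ∀ c, u.count c ≤ 2) (hf : firstPos u q = firstPos u p + 1)
    (hg : lastPos u q = lastPos u p + 1) :
    Layout (fun t => u.getD t .x) (firstPos u) (lastPos u) u.length (firstPos u p)
      (lastPos u p) := by
  have hL : ∀ {t : ℕ} {a : Letter}, u[t]? = some a → u.getD t .x = a := by
    intro t a ht
    rw [List.getD_eq_getElem?_getD, ht]
    rfl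
  have hget : ∀ t < u.length, u[t]? = some (u.getD t .x) := by
    intro t ht
    rw [List.getD_eq_getElem?_getD, List.getElem?_eq_getElem ht]
    rfl
  obtain ⟨hp, hq, h1, h2, h3, -⟩ := hpq.positions hu
  have hlt := lastPos_lt hq
  have e1 := hL (getElem?_firstPos hp)
  have e2 := hL (getElem?_firstPos hq)
  have e3 := hL (getElem?_lastPos hp)
  have e4 := hL (getElem?_lastPos hq)
  rw [hf] at e2
  rw [hg] at e4
  have hij : firstPos u p + 2 ≤ lastPos u p := by
    omega
  have hle := lastPos_le u
  exact {
    eq_or := fun t ht => eq_firstPos_or_lastPos (hu _) (hget t ht)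
    le := fun t ht => firstPos_le_lastPos (List.mem_of_getElem? (hget t ht))
    L_f := fun a ha => hL (getElem?_firstPos (mem_of_firstPos_lt_lastPos ha))
    L_g := fun a ha => hL (getElem?_lastPos (mem_of_firstPos_lt_lastPos ha))
    g_lt := fun a ha => lastPos_lt (mem_of_firstPos_lt_lastPos ha)
    i_lt := hij
    j_lt := by omega
    L_j := by simp only [e1, e3]
    L_j_succ := by simp only [e2, e4]
    f_i := by simp only [e1]
    g_i := by simp only [e1]
    f_i_succ := by simp only [e2, hf]
    g_i_succ := by simp only [e2, hg]
    no__t_ t _ := hpq.false_of_linear h hu (relabel p q t p p p p t) (w := [.x, .y, .a, .x, .y])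
      (p := .x) (q := .y) (c := .a) (by decide) ⟨rfl, rfl⟩
      (by simp [positionList, relabel]; omega)
    no_a_bcab_c a b c _ := hpq.false_of_square h hu (relabel p q a b c p p p)
      (w := [.a, .x, .y, .b, .c, .a, .b, .x, .y, .c]) (p := .x) (q := .y) (by decide) ⟨rfl, rfl⟩
      (by simp [positionList, relabel]; omega)
    no_ab_acbd_cd a b c d _ := hpq.false_of_square h hu (relabel p q a b c d p p)
      (w := [.a, .b, .x, .y, .a, .c, .b, .d, .x, .y, .c, .d]) (p := .x) (q := .y) (by decide)
      ⟨rfl, rfl⟩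
      (by simp [positionList, relabel]; omega)
    no__abcadbecde_ a b c d e _ := hpq.false_of_square h hu (relabel p q a b c d e p)
      (w := [.x, .y, .a, .b, .c, .a, .d, .b, .e, .c, .d, .e, .x, .y]) (p := .x) (q := .y)
      (by decide) ⟨rfl, rfl⟩
      (by simp [positionList, relabel]; omega)
    no__dcdabcaebe_ a b c d e _ := hpq.false_of_square h hu (relabel p q a b c d e p)
      (w := [.x, .y, .d, .c, .d, .a, .b, .c, .a, .e, .b, .e, .x, .y]) (p := .x) (q := .y)
      (by decide) ⟨rfl, rfl⟩
      (by simp [positionList, relabel]; omega)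
    no_d_cdabcaeb_e a b c d e _ := hpq.false_of_square h hu (relabel p q a b c d e p)
      (w := [.d, .x, .y, .c, .d, .a, .b, .c, .a, .e, .b, .x, .y, .e]) (p := .x) (q := .y)
      (by decide) ⟨rfl, rfl⟩
      (by simp [positionList, relabel]; omega)
    no__abba_ a b _ := hpq.false_of_square h hu (relabel p q a b p p p p)
      (w := [.x, .y, .a, .b, .b, .a, .x, .y]) (p := .x) (q := .y) (by decide) ⟨rfl, rfl⟩
      (by simp [positionList, relabel]; omega)
    no_at_a_ a t _ := hpq.false_of_linear h hu (relabel p q a p p p p t)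
      (w := [.a, .t, .x, .y, .a, .x, .y]) (p := .x) (q := .y) (c := .t) (by decide) ⟨rfl, rfl⟩
      (by simp [positionList, relabel]; omega)
    no__a_ta a t _ := hpq.false_of_linear h hu (relabel q p a p p p p t)
      (w := [.y, .x, .a, .y, .x, .t, .a]) (p := .y) (q := .x) (c := .t) (by decide) ⟨rfl, rfl⟩
      -- The bound on `lastPos` shows that the single letter t really occurs in u, as it stands
      -- before the last a.
      (by have := hle a; simp [positionList, relabel]; omega)
    no_aba_b_ a b _ := hpq.false_of_square h hu (relabel p q a b p p p p)
      (w := [.a, .b, .a, .x, .y, .b, .x, .y]) (p := .x) (q := .y) (by decide) ⟨rfl, rfl⟩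
      (by simp [positionList, relabel]; omega)
    no__b_aba a b _ := hpq.false_of_square h hu (relabel q p a b p p p p)
      (w := [.y, .x, .b, .y, .x, .a, .b, .a]) (p := .y) (q := .x) (by decide) ⟨rfl, rfl⟩
      (by simp [positionList, relabel]; omega)
    no_ab_a_b a b _ := hpq.false_of_square h hu (relabel p q a b p p p p)
      (w := [.a, .b, .x, .y, .a, .x, .y, .b]) (p := .x) (q := .y) (by decide) ⟨rfl, rfl⟩
      (by simp [positionList, relabel]; omega)
    no_b_a_ba a b _ := hpq.false_of_square h hu (relabel q p a b p p p p)
      (w := [.b, .y, .x, .a, .y, .x, .b, .a]) (p := .y) (q := .x) (by decide) ⟨rfl, rfl⟩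
      (by simp [positionList, relabel]; omega)
    no_abb_a_ a b _ := hpq.false_of_square h hu (relabel p q a b p p p p)
      (w := [.a, .b, .b, .x, .y, .a, .x, .y]) (p := .x) (q := .y) (by decide) ⟨rfl, rfl⟩
      (by simp [positionList, relabel]; omega)
    no__a_bba a b _ := hpq.false_of_square h hu (relabel q p a b p p p p)
      (w := [.y, .x, .a, .y, .x, .b, .b, .a]) (p := .y) (q := .x) (by decide) ⟨rfl, rfl⟩
      (by simp [positionList, relabel]; omega)
    no_ab_ba_ a b _ := hpq.false_of_square h hu (relabel p q a b p p p p)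
      (w := [.a, .b, .x, .y, .b, .a, .x, .y]) (p := .x) (q := .y) (by decide) ⟨rfl, rfl⟩
      (by simp [positionList, relabel]; omega)
    no__ab_ba a b _ := hpq.false_of_square h hu (relabel q p a b p p p p)
      (w := [.y, .x, .a, .b, .y, .x, .b, .a]) (p := .y) (q := .x) (by decide) ⟨rfl, rfl⟩
      (by simp [positionList, relabel]; omega)
    no_ab_acbc_ a b c _ := hpq.false_of_square h hu (relabel p q a b c p p p)
      (w := [.a, .b, .x, .y, .a, .c, .b, .c, .x, .y]) (p := .x) (q := .y) (by decide) ⟨rfl, rfl⟩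
      (by simp [positionList, relabel]; omega)
    no__cbca_ba a b c _ := hpq.false_of_square h hu (relabel q p a b c p p p)
      (w := [.y, .x, .c, .b, .c, .a, .y, .x, .b, .a]) (p := .y) (q := .x) (by decide) ⟨rfl, rfl⟩
      (by simp [positionList, relabel]; omega)
    no_a_bcbac_ a b c _ := hpq.false_of_square h hu (relabel p q a b c p p p)
      (w := [.a, .x, .y, .b, .c, .b, .a, .c, .x, .y]) (p := .x) (q := .y) (by decide) ⟨rfl, rfl⟩
      (by simp [positionList, relabel]; omega)
    no__cabcb_a a b c _ := hpq.false_of_square h hu (relabel q p a b c p p p)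
      (w := [.y, .x, .c, .a, .b, .c, .b, .y, .x, .a]) (p := .y) (q := .x) (by decide) ⟨rfl, rfl⟩
      (by simp [positionList, relabel]; omega)
    no_a_bbcac_ a b c _ := hpq.false_of_square h hu (relabel p q a b c p p p)
      (w := [.a, .x, .y, .b, .b, .c, .a, .c, .x, .y]) (p := .x) (q := .y) (by decide) ⟨rfl, rfl⟩
      (by simp [positionList, relabel]; omega)
    no__cacbb_a a b c _ := hpq.false_of_square h hu (relabel q p a b c p p p)
      (w := [.y, .x, .c, .a, .c, .b, .b, .y, .x, .a]) (p := .y) (q := .x) (by decide) ⟨rfl, rfl⟩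
      (by simp [positionList, relabel]; omega)
    no_a_bbacc_ a b c _ := hpq.false_of_square h hu (relabel p q a b c p p p)
      (w := [.a, .x, .y, .b, .b, .a, .c, .c, .x, .y]) (p := .x) (q := .y) (by decide) ⟨rfl, rfl⟩
      (by simp [positionList, relabel]; omega)
    no__ccabb_a a b c _ := hpq.false_of_square h hu (relabel q p a b c p p p)
      (w := [.y, .x, .c, .c, .a, .b, .b, .y, .x, .a]) (p := .y) (q := .x) (by decide) ⟨rfl, rfl⟩
      (by simp [positionList, relabel]; omega)
    no_a_bbac_c a b c _ := hpq.false_of_square h hu (relabel p q a b c p p p)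
      (w := [.a, .x, .y, .b, .b, .a, .c, .x, .y, .c]) (p := .x) (q := .y) (by decide) ⟨rfl, rfl⟩
      (by simp [positionList, relabel]; omega)
    no_c_cabb_a a b c _ := hpq.false_of_square h hu (relabel q p a b c p p p)
      (w := [.c, .y, .x, .c, .a, .b, .b, .y, .x, .a]) (p := .y) (q := .x) (by decide) ⟨rfl, rfl⟩
      (by simp [positionList, relabel]; omega)
    no_a_bcabdc_d a b c d _ := hpq.false_of_square h hu (relabel p q a b c d p p)
      (w := [.a, .x, .y, .b, .c, .a, .b, .d, .c, .x, .y, .d]) (p := .x) (q := .y) (by decide)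
      ⟨rfl, rfl⟩
      (by simp [positionList, relabel]; omega)
    no_d_cdbacb_a a b c d _ := hpq.false_of_square h hu (relabel q p a b c d p p)
      (w := [.d, .y, .x, .c, .d, .b, .a, .c, .b, .y, .x, .a]) (p := .y) (q := .x) (by decide)
      ⟨rfl, rfl⟩
      (by simp [positionList, relabel]; omega)
    no_ab_acbdd_c a b c d _ := hpq.false_of_square h hu (relabel p q a b c d p p)
      (w := [.a, .b, .x, .y, .a, .c, .b, .d, .d, .x, .y, .c]) (p := .x) (q := .y) (by decide)
      ⟨rfl, rfl⟩
      (by simp [positionList, relabel]; omega)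
    no_c_ddbca_ba a b c d _ := hpq.false_of_square h hu (relabel q p a b c d p p)
      (w := [.c, .y, .x, .d, .d, .b, .c, .a, .y, .x, .b, .a]) (p := .y) (q := .x) (by decide)
      ⟨rfl, rfl⟩
      (by simp [positionList, relabel]; omega)
    no_a_bcabdcd_ a b c d _ := hpq.false_of_square h hu (relabel p q a b c d p p)
      (w := [.a, .x, .y, .b, .c, .a, .b, .d, .c, .d, .x, .y]) (p := .x) (q := .y) (by decide)
      ⟨rfl, rfl⟩
      (by simp [positionList, relabel]; omega)
    no__dcdbacb_a a b c d _ := hpq.false_of_square h hu (relabel q p a b c d p p)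
      (w := [.y, .x, .d, .c, .d, .b, .a, .c, .b, .y, .x, .a]) (p := .y) (q := .x) (by decide)
      ⟨rfl, rfl⟩
      (by simp [positionList, relabel]; omega)
    no_d_cdabcaebe_ a b c d e _ := hpq.false_of_square h hu (relabel p q a b c d e p)
      (w := [.d, .x, .y, .c, .d, .a, .b, .c, .a, .e, .b, .e, .x, .y]) (p := .x) (q := .y)
      (by decide) ⟨rfl, rfl⟩
      (by simp [positionList, relabel]; omega)
    no__ebeacbadc_d a b c d e _ := hpq.false_of_square h hu (relabel q p a b c d e p)
      (w := [.y, .x, .e, .b, .e, .a, .c, .b, .a, .d, .c, .y, .x, .d]) (p := .y) (q := .x)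
      (by decide) ⟨rfl, rfl⟩
      (by simp [positionList, relabel]; omega) }


open scoped List

/-! ### Exchanging two adjacent letters -/

theorem derivesList_linked_of_two_le {n : ℕ} (hn : 2 ≤ n) {C m D : List Letter} (h : Chain n C m D)
    (Z Z' X Y : List Letter) : DerivesList identitySystem (linked Z (X ++ Y) C m D Z')
      (linked Z (Y ++ X) C m D Z') := by
  obtain ⟨θ, h1, h2⟩ := exists_chainList_flatMap h Z Z' X Y
  rw [← h1, ← h2]
  exact DerivesList.of_mem (mem_identitySystem.2 (Or.inl ⟨n, hn, rfl, rfl⟩)) θ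

theorem derivesList_of_adjacent (Z Z' X Y : List Letter) : DerivesList identitySystem
    ((Z ++ (X ++ Y) ++ Z') ++ (Z ++ (X ++ Y) ++ Z'))
    ((Z ++ (Y ++ X) ++ Z') ++ (Z ++ (Y ++ X) ++ Z')) := by
  -- The identity for w_2 with all x_k erased exchanges X and Y in a square.
  have h : Chain 2 ([] : List Letter) [] [] := .cons [] (.cons [] (.nil []))
  simpa [linked] using derivesList_linked_of_two_le le_rfl h Z Z' X Y

/-- The indices 0 and 1, absent from the system, reduce to a square: C·BB·C and (CBD)(CBD). -/
theorem derivesList_linked {n : ℕ} {C m D : List Letter} (h : Chain n C m D)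
    (Z Z' X Y : List Letter) : DerivesList identitySystem (linked Z (X ++ Y) C m D Z')
      (linked Z (Y ++ X) C m D Z') := by
  match n, h with
  | 0, .nil C => simpa [linked] using (derivesList_of_adjacent Z Z' X Y).append C C
  | 1, .cons C (.nil D) =>
    simpa [linked] using derivesList_of_adjacent (C ++ Z) (Z' ++ D) X Y
  | n + 2, h => exact derivesList_linked_of_two_le (Nat.le_add_left _ _) h Z Z' X Y

theorem seg_two {α : Type*} (L : ℕ → α) (i : ℕ) : seg L i (i + 2) = [L i, L (i + 1)] := by
  simp [seg, List.range']

/-- Cutting u at the points of the frame exhibits it as a linked word around a chain, to which w_n ≈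
w_n' applies. -/
theorem Inverted.exists_swap {u v : List Letter} {p q : Letter} (hpq : Inverted u v p q)
    (h : Holds u v) (hu : ∀ c, u.count c ≤ 2) (hf : firstPos u q = firstPos u p + 1)
    (hg : lastPos u q = lastPos u p + 1) : ∃ r m s, u = r ++ [p, q] ++ m ++ [p, q] ++ s ∧
      DerivesList identitySystem u (r ++ [q, p] ++ m ++ [q, p] ++ s) := by
  obtain ⟨A, B, C, D, E, F, S⟩ := (hpq.layout h hu hf hg).exists_frame
  obtain ⟨n, hch⟩ := S.exists_chain
  have eZ := S.seg_left_eq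
  have eZ' := S.seg_right_eq
  have e1 := S.A_le
  have e2 := S.B_le
  have e3 := S.le_C
  have e4 := S.C_le
  have e5 := S.D_le
  have e6 := S.le_E
  have e7 := S.E_le
  have e8 := S.F_le
  obtain ⟨hp, hq, -⟩ := hpq.positions hu
  have hget : ∀ {t a}, u[t]? = some a → u.getD t .x = a := by
    intro t a ht
    rw [List.getD_eq_getElem?_getD, ht]
    rfl
  have hp1 := hget (getElem?_firstPos hp)
  have hq1 := hget (getElem?_firstPos hq)
  have hp2 := hget (getElem?_lastPos hp)
  have hq2 := hget (getElem?_lastPos hq)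
  rw [hf] at hq1
  rw [hg] at hq2
  generalize hi : firstPos u p = i at *
  generalize hj : lastPos u p = j at *
  generalize hL : (fun t => u.getD t Letter.x) = L at *
  have b1 : seg L i (i + 2) = [p, q] := by
    rw [← hL]
    rw [seg_two, hp1, hq1]
  have b2 : seg L j (j + 2) = [p, q] := by
    rw [← hL]
    rw [seg_two, hp2, hq2]
  have hseg : seg L 0 u.length = u := by
    rw [← hL]
    refine List.ext_getElem (by simp [seg]) fun t h1 h2 => ?_
    simp [seg, h2]
  have hsplit : u = seg L 0 A ++ linked (seg L B i) ([p] ++ [q]) (seg L A B) (seg L C D)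
      (seg L E F) (seg L (i + 2) C) ++ seg L F u.length := by
    have := hseg
    rw [← seg_append (m := A) (by omega) (by omega),
      ← seg_append (s := A) (m := B) (by omega) (by omega),
      ← seg_append (s := B) (m := i) (by omega) (by omega),
      ← seg_append (s := i) (m := i + 2) (by omega) (by omega),
      ← seg_append (s := i + 2) (m := C) (by omega) (by omega),
      ← seg_append (s := C) (m := D) (by omega) (by omega),
      ← seg_append (s := D) (m := j) (by omega) (by omega),
      ← seg_append (s := j) (m := j + 2) (by omega) (by omega),
      ← seg_append (s := j + 2) (m := E) (by omega) (by omega),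
      ← seg_append (s := E) (m := F) (by omega) (by omega),
      b1, b2, ← eZ, ← eZ'] at this
    conv_lhs => rw [← this]
    simp [linked]
  refine ⟨seg L 0 A ++ seg L A B ++ seg L B i, seg L (i + 2) C ++ seg L C D ++ seg L B i,
    seg L (i + 2) C ++ seg L E F ++ seg L F u.length, ?_, ?_⟩
  · conv_lhs => rw [hsplit]
    simp [linked]
  · have := (derivesList_linked hch (seg L B i) (seg L (i + 2) C) [p] [q]).append (seg L 0 A)
      (seg L F u.length)
    rw [← hsplit] at this
    simpa [linked] using this


open scoped List

/-! ### Derivability of identities of 2-limited words -/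

theorem proj_swap {c d p q : Letter} (r m s : List Letter)
    (h : ¬ ((p = c ∨ p = d) ∧ (q = c ∨ q = d))) :
    proj c d (r ++ [q, p] ++ m ++ [q, p] ++ s) = proj c d (r ++ [p, q] ++ m ++ [p, q] ++ s) := by
  have : proj c d [q, p] = proj c d [p, q] := by
    by_cases hp : p = c ∨ p = d <;> by_cases hq : q = c ∨ q = d
    · exact absurd ⟨hp, hq⟩ h
    all_goals simp [proj, hp, hq]
  simp only [proj] at this ⊢
  simp only [List.filter_append, this]

theorem proj_swap_self {p q : Letter} {r m s : List Letter}
    (h : proj p q (r ++ [p, q] ++ m ++ [p, q] ++ s) = [p, q, p, q]) :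
    proj p q (r ++ [q, p] ++ m ++ [q, p] ++ s) = [q, p, q, p] := by
  have e1 : proj p q [p, q] = [p, q] := by simp [proj]
  have e2 : proj p q [q, p] = [q, p] := by simp [proj]
  simp only [proj] at h e1 e2 ⊢
  simp only [List.filter_append, e1, e2] at h ⊢
  have hlen := congrArg List.length h
  simp only [List.length_append, List.length_cons, List.length_nil] at hlen
  rw [List.length_eq_zero_iff.1 (show (r.filter fun c => c = p ∨ c = q).length = 0 by omega),
    List.length_eq_zero_iff.1 (show (m.filter fun c => c = p ∨ c = q).length = 0 by omega),
    List.length_eq_zero_iff.1 (show (s.filter fun c => c = p ∨ c = q).length = 0 by omega)]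
  rfl

/-- Induction on the number of inverted pairs: exchanging an adjacent one removes it, leaves all
other projections unchanged, and keeps the identity true because derivations are sound. -/
theorem Holds.derivesList_of_count_le_two {u v : List Letter} (h : Holds u v)
    (hu : ∀ c, u.count c ≤ 2) (hv : ∀ c, v.count c ≤ 2) : DerivesList identitySystem u v := by
  classical
  generalize hn : ((u.toFinset ×ˢ u.toFinset).filter fun ab => Inverted u v ab.1 ab.2).card = n
  induction n using Nat.strong_induction_on generalizing u with
  | _ n ih =>
  by_cases hex : ∃ a b, Inverted u v a b
  · obtain ⟨p, q, hpq, hf, hg⟩ := h.exists_adjacent_inverted hu hv hex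
    obtain ⟨r, m, s, rfl, hd⟩ := hpq.exists_swap h hu hf hg
    have hperm : r ++ [q, p] ++ m ++ [q, p] ++ s ~ r ++ [p, q] ++ m ++ [p, q] ++ s := by
      have := List.Perm.swap p q []
      exact ((((List.Perm.refl r).append this).append (.refl m)).append this).append (.refl s)
    refine hd.trans (ih _ ?_ (hd.symm.holds.trans h) (fun c => ?_) rfl)
    · rw [← hn]
      refine Finset.card_lt_card (Finset.ssubset_iff_of_subset ?_ |>.2 ⟨(p, q), ?_, ?_⟩)
      · rintro ⟨c, d⟩ hcd
        simp only [Finset.mem_filter, Finset.mem_product, List.mem_toFinset, hperm.mem_iff]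
          at hcd ⊢
        refine ⟨hcd.1, ?_, hcd.2.2⟩
        rw [← proj_swap, hcd.2.1]
        rintro ⟨hp, hq⟩
        have hne := hpq.ne hu
        have h1 := hcd.2.1
        have h2 := hcd.2.2
        rcases hp with rfl | rfl <;> rcases hq with rfl | rfl
        · exact hne rfl
        · rw [proj_swap_self hpq.1] at h1
          simp at h1
          exact hne h1.1.symm
        · rw [proj_comm, hpq.2] at h2
          simp at h2
          exact hne h2.1.symm
        · exact hne rfl
      · obtain ⟨hp, hq, -⟩ := hpq.positions hu
        simp only [Finset.mem_filter, Finset.mem_product, List.mem_toFinset]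
        exact ⟨⟨hp, hq⟩, hpq⟩
      · intro hmem
        have h1 := (Finset.mem_filter.1 hmem).2.1
        rw [proj_swap_self hpq.1] at h1
        simp at h1
        exact hpq.ne hu h1.1.symm
    · rw [hperm.count_eq]
      exact hu c
  · rw [eq_of_proj_eq (u := u) (v := v) fun a b => ?_]
    · exact .refl _ _
    · rcases h.proj_eq hu hv a b with h | h | h
      · exact h
      · exact absurd ⟨a, b, h⟩ hex
      · exact absurd ⟨b, a, by rw [proj_comm]; exact h.1, by rw [proj_comm]; exact h.2⟩ hex


open scoped List

/-! ### Letters that occur at least three times -/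

theorem derivesList_collect_cube (a : Letter) (T T' : List Letter) : DerivesList identitySystem
    ([a] ++ T ++ [a] ++ T' ++ [a]) ([a, a, a] ++ (T ++ T')) := by
  have := DerivesList.of_mem (mem_identitySystem.2 (Or.inr (Or.inl ⟨rfl, rfl⟩))) fun
    | .x => [a]
    | .tsub 1 => T
    | .tsub 2 => T'
    | _ => []
  simpa using this

theorem derivesList_cube_comm (a : Letter) (T : List Letter) : DerivesList identitySystem
    ([a, a, a] ++ T) (T ++ [a, a, a]) := by
  have := DerivesList.of_mem (mem_identitySystem.2 (Or.inr (Or.inr (Or.inl ⟨rfl, rfl⟩)))) fun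
    | .x => [a]
    | .tsub 1 => T
    | _ => []
  simpa using this

theorem derivesList_cube_fourth (a : Letter) : DerivesList identitySystem
    [a, a, a] [a, a, a, a] := by
  have := DerivesList.of_mem (mem_identitySystem.2 (Or.inr (Or.inr (Or.inr ⟨rfl, rfl⟩)))) fun
    | .x => [a]
    | _ => []
  simpa using this

/-- A cube commutes with every word and absorbs further copies of its letter, so it can sweep
through u. -/
theorem derivesList_cube_filter (a : Letter) (u : List Letter) : DerivesList identitySystem
    ([a, a, a] ++ u) ([a, a, a] ++ u.filter fun c => c ≠ a) := by
  induction u with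
  | nil => exact .refl _ _
  | cons c u ih =>
    by_cases hc : c = a
    · subst hc
      have := (derivesList_cube_fourth c).symm.append [] u
      simpa using this.trans ih
    · have h1 := (derivesList_cube_comm a [c]).append [] u
      have h2 := ih.append [c] []
      have h3 := (derivesList_cube_comm a [c]).symm.append [] (u.filter fun c => c ≠ a)
      simp only [List.nil_append, List.append_nil, List.cons_append] at h1 h2 h3
      simpa [hc] using (h1.trans h2).trans (by simpa using h3)

/-- The cube of a letter that occurs at least three times can be collected at the front. -/
theorem derivesList_of_three_le_count {a : Letter} {u : List Letter} (h : 3 ≤ u.count a) :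
    DerivesList identitySystem u ([a, a, a] ++ u.filter fun c => c ≠ a) := by
  have h3 : [a, a, a] <+ u := List.replicate_sublist_iff.2 h
  obtain ⟨r, s, rfl, hr, hs⟩ := List.cons_sublist_iff.1 h3
  obtain ⟨s, s', rfl, hs, hs'⟩ := List.cons_sublist_iff.1 hs
  obtain ⟨r, T, rfl⟩ := List.append_of_mem hr
  obtain ⟨T₁, T₁', rfl⟩ := List.append_of_mem hs
  obtain ⟨T₂, T₂', rfl⟩ := List.append_of_mem (List.singleton_sublist.1 hs')
  have h1 := (derivesList_collect_cube a (T ++ T₁) (T₁' ++ T₂)).append r T₂'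
  have h2 := (derivesList_cube_comm a r).symm.append [] (T ++ T₁ ++ (T₁' ++ T₂) ++ T₂')
  have h4 := derivesList_cube_filter a (r ++ (T ++ T₁ ++ (T₁' ++ T₂) ++ T₂'))
  simp only [List.nil_append, List.append_assoc, List.cons_append] at h1 h2 h4 ⊢
  simpa [List.filter_cons] using (h1.trans h2).trans h4

/-- The frequent letters are collected one at a time as cubes at the front of both sides, which
leaves only the words without them to be compared. -/
theorem DerivesList.of_filter {u v ts : List Letter} (hts : ts.Nodup)
    (hu : ∀ c ∈ ts, 3 ≤ u.count c) (hv : ∀ c ∈ ts, 3 ≤ v.count c)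
    (h : DerivesList identitySystem (u.filter fun c => c ∉ ts) (v.filter fun c => c ∉ ts)) :
    DerivesList identitySystem u v := by
  induction ts generalizing u v with
  | nil => simpa using h
  | cons a ts ih =>
    rw [List.nodup_cons] at hts
    have hcount : ∀ c ∈ ts, ∀ u : List Letter, (u.filter fun c => c ≠ a).count c = u.count c := by
      intro c hc u
      refine List.count_filter ?_
      have : c ≠ a := fun h => hts.1 (h ▸ hc)
      simpa using this
    have hfilter : ∀ u : List Letter, (u.filter fun c => c ≠ a).filter (fun c => c ∉ ts) =
        u.filter fun c => c ∉ a :: ts := by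
      intro u
      rw [List.filter_filter]
      congr 1
      funext c
      by_cases hc : c = a <;> simp [hc]
    have key : DerivesList identitySystem (u.filter fun c => c ≠ a) (v.filter fun c => c ≠ a) := by
      refine ih hts.2 (fun c hc => ?_) (fun c hc => ?_) ?_
      · rw [hcount c hc]
        exact hu c (List.mem_cons_of_mem _ hc)
      · rw [hcount c hc]
        exact hv c (List.mem_cons_of_mem _ hc)
      · rw [hfilter, hfilter]
        exact h
    have key' := key.append [a, a, a] []
    rw [List.append_nil, List.append_nil] at key'
    exact ((derivesList_of_three_le_count (hu a List.mem_cons_self)).trans key').trans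
      (derivesList_of_three_le_count (hv a List.mem_cons_self)).symm

/-- The powers 1, x and xx are isoterms; erase all letters but c. -/
theorem Holds.count_eq_of_le_two {u v : List Letter} (h : Holds u v) {c : Letter}
    (hc : u.count c ≤ 2) : u.count c = v.count c := by
  have key : ∀ u : List Letter, (u.flatMap fun d => if d = c then [Letter.x] else []) =
      List.replicate (u.count c) Letter.x := by
    intro u
    induction u with
    | nil => rfl
    | cons d u ih =>
      by_cases hd : d = c
      · simp [hd, ih, List.replicate_succ]
      · simp [hd, ih]
  have hf : ∀ n ≤ 2, IsFactorWord (List.replicate n .x) := by decide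
  have e := h.flatMap_eq (fun d => if d = c then [Letter.x] else []) (by
    rw [key]
    exact hf _ hc)
  rw [key, key] at e
  simpa using congrArg List.length e

/-- By `Holds.count_eq_of_le_two` the same letters occur at least three times on both sides. Erasing
them keeps the identity true and leaves words in which no letter occurs more than twice. -/
theorem Holds.derivesList {u v : List Letter} (h : Holds u v) : DerivesList identitySystem u v := by
  have hts : ∀ c, c ∈ u.dedup.filter (fun c => 3 ≤ u.count c) ↔ 3 ≤ u.count c := by
    intro c
    rw [List.mem_filter, List.mem_dedup, decide_eq_true_iff, and_iff_right_iff_imp]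
    exact fun hc => List.count_pos_iff.1 (by omega)
  have hle : ∀ (w : List Letter) (c : Letter), (3 ≤ w.count c → 3 ≤ u.count c) →
      (w.filter fun c => c ∉ u.dedup.filter fun c => 3 ≤ u.count c).count c ≤ 2 := by
    intro w c hw
    by_cases hc : 3 ≤ u.count c
    · rw [List.count_eq_zero_of_not_mem]
      · exact Nat.zero_le _
      · rw [List.mem_filter, decide_eq_true_iff]
        exact fun h => h.2 ((hts c).2 hc)
    · have := List.filter_sublist.count_le (l₁ := w.filter fun c =>
        c ∉ u.dedup.filter fun c => 3 ≤ u.count c) (a := c)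
      omega
  have hiff : ∀ c, 3 ≤ u.count c ↔ 3 ≤ v.count c := by
    intro c
    by_cases hu : u.count c ≤ 2
    · rw [h.count_eq_of_le_two hu]
    · by_cases hv : v.count c ≤ 2
      · rw [h.symm.count_eq_of_le_two hv]
      · omega
  refine DerivesList.of_filter (u.nodup_dedup.filter _) (fun c hc => (hts c).1 hc)
    (fun c hc => (hiff c).1 ((hts c).1 hc)) ((h.filter _).derivesList_of_count_le_two
      (fun c => hle u c id) fun c => hle v c (hiff c).2)

theorem isIdentityBasis_identitySystem :
    IsIdentityBasis identitySystem (ReesMonoid wordSet) :=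
  fun p => ⟨fun h => Holds.derivesList (u := p.1) (v := p.2) h,
    Derives.satisfies fun _ => satisfies_of_mem⟩

end Irredundant

theorem mainTheorem1 :
    Irredundant.wordSet.ncard = 37 ∧
    Finite (Irredundant.ReesMonoid Irredundant.wordSet) ∧
    Irredundant.IsIdentityBasis Irredundant.identitySystem
      (Irredundant.ReesMonoid Irredundant.wordSet) ∧
    Irredundant.identitySystem.Infinite ∧
    Irredundant.IsIrredundant Irredundant.identitySystem :=
  ⟨Irredundant.ncard_wordSet, Irredundant.finite_reesMonoid,
    Irredundant.isIdentityBasis_identitySystem, Irredundant.infinite_identitySystem,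
    Irredundant.isIrredundant_identitySystem⟩
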